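/- **Setting.** Let $m\ge 1$, real $a<b$, $\varepsilon>0$, and $q_1<\dots<q_m$ in $[0,1]$; put $q_0=0$, $q_{m+1}=1$. A database is $X\in\mathbb R^n$, whose entries are clamped to $[a,b]$; two databases of the same size are neighbors if they differ in at most one entry. A randomized algorithm $\mathcal A$ is $\varepsilon$-differentially private if $P(\mathcal A(X)\in Y)\le e^{\varepsilon}P(\mathcal A(X')\in Y)$ for all neighbors $X,X'$ and all measurable $Y$. Let $x_1\le\dots\le x_n$ be the clamped entries in order, $x_0=a$, $x_{n+1}=b$, $I=\{0,\dots,n\}$, $n_j=(q_j-q_{j-1})n$, $\tau(i)=x_{i+1}-x_i$, and $\phi(i,i',j)=\exp\bigl(-\tfrac{\varepsilon}{4}|(i'-i)-n_j|\bigr)$ for $i\le i'$, $\phi(i,i',j)=0$ for $i>i'$. *The mechanism $M_Q$.* On $O=\{a\le o_1\le\dots\le o_m\le b\}$, $M_Q$ has density proportional to $\exp(\tfrac{\varepsilon}{4}u_Q(X,o))$, where $u_Q(X,o)=-\sum_{j=1}^{m+1}\bigl||\{l: o_{j-1}\le x_l<o_j\}|-n_j\bigr|$ with $o_0=a$, $o_{m+1}=b+1$.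 *The law $P_{M_{Q'}}$.* On nondecreasing sequences $s=(i_1,\dots,i_m)\in I^m$, with $i_0=0$, $i_{m+1}=n$, $$P_{M_{Q'}}[s]\propto \exp\Bigl(-\tfrac{\varepsilon}{4}\sum_{j=1}^{m+1}|(i_j-i_{j-1})-n_j|\Bigr)\frac{\prod_{j=1}^m\tau(i_j)}{\prod_{i\in I}(\#\{j: i_j=i\})!}.$$ *JointExp.* (1) Forward pass: $\alpha(1,i,1)=\phi(0,i,1)\tau(i)$, $\alpha(1,i,k)=0$ for $k>1$, and for $2\le j\le m$ $$\alpha(j,i,1)=\tau(i)\sum_{i'<i}\phi(i',i,j)\sum_{k<j}\alpha(j-1,i',k),\qquad \alpha(j,i,k)=\tau(i)\,\phi(i,i,j)\,\alpha(j-1,i,k-1)/k\quad(k>1),$$ where the first family is a product of a strictly triangular Toeplitz matrix with a vector and is computed by a subroutine for this product. (2) Backward pass: start with $j=m$; while $j>0$, draw $(i,k)\in I\times\{1,\dots,j\}$ with probability proportional to $\alpha(m,i,k)\phi(i,n,m+1)$ if $j=m$, and to $\mathbf 1[i<i_{j+1}]\,\alpha(j,i,k)\,\phi(i,i_{j+1},j+1)$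 if $j<m$; set $i_{j-k+1}=\dots=i_j=i$ and replace $j$ by $j-k$. (3) Draw independent uniform $o_j\in[x_{i_j},x_{i_j+1})$ and output them in increasing order. **Theorem.** 1. JointExp is $\varepsilon$-differentially private. 2. For every database, the sequence $(i_1,\dots,i_m)$ drawn by JointExp has exactly the law $P_{M_{Q'}}$, and the output of JointExp has exactly the law of $M_Q$. 3. Consider a randomized real RAM: structured programs with counted loops and comparisons, registers and arrays of natural numbers and of exact reals, in which each arithmetic operation (on reals also $|\cdot|,\exp,\cos,\sin$, the constant $\pi$, and the conversion of a natural number), comparison, memory access and draw of a uniform random number from $[0,1]$ takes one step. There is a subroutine for the Toeplitz product and a constant $C$, both independent of all inputs, with which the following holds for JointExp, written out as a program for this machine, for all $n,m\ge1$, all parameters as above and all sorted data in $[a,b]$. Whatever the random numbers, it takes at most $C(mn\log n+m^2n)$ steps, accesses at most $Cm^2n$ array cells, computes no natural number larger than $Cm^2n$, and ends with the values $\alpha(j,i,k)$, $1\le j,k\le m$, $i\in I$, in its table; and with independent uniform random numbers, the pair (interval sequence, output) that it produces has the joint law given by the description of JointExp above. -/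

import Mathlib

open MeasureTheory ProbabilityTheory
open scoped ENNReal

namespace JointExp

noncomputable section

/-! # Databases and differential privacy (swap model) -/

/-- Two databases of the same size are neighbours if they differ in at most one entry. -/
def Neighbors {n : ℕ} (X X' : Fin n → ℝ) : Prop := ∃ i, ∀ l, l ≠ i → X l = X' l

/-- Pure `ε`-differential privacy of a randomized map on databases of size `n`; the randomized map
is given by its output laws. -/
def IsPureDP {n : ℕ} {Y : Type*} [MeasurableSpace Y] (ε : ℝ) (M : (Fin n → ℝ) → Measure Y) : Prop :=
  ∀ X X', Neighbors X X' → ∀ S, MeasurableSet S → M X S ≤ ENNReal.ofReal (Real.exp ε) * M X' S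

/-! # Parameters and conventions -/

/-- The user's input apart from the data: the data range `[a, b]`, the privacy parameter `ε` and the
target quantiles `q 0 < ⋯ < q (m - 1)`. -/
structure Params (m : ℕ) where
  a : ℝ
  b : ℝ
  ε : ℝ
  q : Fin m → ℝ

/-- The standing assumptions on the parameters. -/
structure Params.Admissible {m : ℕ} (p : Params m) : Prop where
  range : p.a < p.b
  eps : 0 < p.ε
  mono : StrictMono p.q
  mem : ∀ j, p.q j ∈ Set.Icc (0 : ℝ) 1

/-- The finite sequence `y` (read as `y₁, …, y_N`) with `y₀ = lo` and `y_{N+1} = hi` added. -/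
def pad {N : ℕ} (lo hi : ℝ) (y : Fin N → ℝ) : ℕ → ℝ
  | 0 => lo
  | i + 1 => if h : i < N then y ⟨i, h⟩ else hi

/-- The entries of `y` in nondecreasing order. -/
def sorted {N : ℕ} (y : Fin N → ℝ) : Fin N → ℝ := y ∘ Tuple.sort y

/-- Clamping of all entries to `[a, b]`. -/
def clamp {n : ℕ} (a b : ℝ) (X : Fin n → ℝ) : Fin n → ℝ := fun i => max a (min b (X i))

variable {n m : ℕ}

/-- `n_j = (q_j - q_{j-1}) n` for `1 ≤ j ≤ m + 1`, where `q_0 = 0` and `q_{m+1} = 1`. -/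
def gap (p : Params m) (n j : ℕ) : ℝ := (pad 0 1 p.q j - pad 0 1 p.q (j - 1)) * n

/-! # The exponential mechanism `M_Q` -/

/-- `n(u, v)`: the number of data points in `[u, v)`. -/
def countIn (X : Fin n → ℝ) (u v : ℝ) : ℕ := Fintype.card {i : Fin n // u ≤ X i ∧ X i < v}

/-- The utility `u_Q(X, o) = -∑_{j=1}^{m+1} |n(o_{j-1}, o_j) - n_j|`, with `o_0 = a` and
`o_{m+1} = b + 1`. -/
def utilQ (p : Params m) (X : Fin n → ℝ) (o : Fin m → ℝ) : ℝ :=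
  -∑ j ∈ Finset.Icc 1 (m + 1),
    |(countIn X (pad p.a (p.b + 1) o (j - 1)) (pad p.a (p.b + 1) o j) : ℝ) - gap p n j|

/-- The output space of `M_Q`: nondecreasing sequences in `[a, b]`. -/
def outputSpace (p : Params m) : Set (Fin m → ℝ) :=
  {o | Monotone o ∧ ∀ j, o j ∈ Set.Icc p.a p.b}

/-- The exponential mechanism with utility `u`, sensitivity parameter `Δ` and base measure `ν`: the
probability measure whose density with respect to `ν` is proportional to `exp (ε u / (2 Δ))`. -/
def expMechanism {Y : Type*} [MeasurableSpace Y] (ν : Measure Y) (u : Y → ℝ) (ε Δ : ℝ) :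
    Measure Y :=
  (∫⁻ o, ENNReal.ofReal (Real.exp (ε * u o / (2 * Δ))) ∂ν)⁻¹ •
    ν.withDensity (fun o => ENNReal.ofReal (Real.exp (ε * u o / (2 * Δ))))

/-- `M_Q`, on databases that are first clamped to `[a, b]`; its sensitivity parameter is `2`. -/
def mechQ (p : Params m) (X : Fin n → ℝ) : Measure (Fin m → ℝ) :=
  expMechanism (volume.restrict (outputSpace p)) (utilQ p (clamp p.a p.b X)) p.ε 2

/-! # The law of the interval sequence of `M_{Q'}`

From here on `x` is the sorted, clamped database. Interval `i ∈ {0, …, n}` lies between `x_i` and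
`x_{i+1}`, where `x_0 = a` and `x_{n+1} = b`. -/

/-- The law on a finite type that is proportional to the nonnegative weights `w` (the `else` branch
only serves to make the function total). -/
def drawProp {ι : Type*} [Fintype ι] [Nonempty ι] (w : ι → ℝ) : PMF ι :=
  if h : ∑ i, ENNReal.ofReal (w i) ≠ 0 then
    PMF.normalize (fun i => ENNReal.ofReal (w i)) (by rwa [tsum_fintype])
      (by rw [tsum_fintype]; exact ENNReal.sum_ne_top.2 fun _ _ => ENNReal.ofReal_ne_top)
  else PMF.pure (Classical.arbitrary ι)

/-- The length `x_{i+1} - x_i` of interval `i`. -/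
def tau (p : Params m) (x : Fin n → ℝ) (i : ℕ) : ℝ := pad p.a p.b x (i + 1) - pad p.a p.b x i

/-- The positions `i_0 = 0`, `i_1, …, i_m`, `i_{m+1} = n` of an interval sequence. -/
def padSeq (s : Fin m → Fin (n + 1)) : ℕ → ℕ
  | 0 => 0
  | j + 1 => if h : j < m then s ⟨j, h⟩ else n

/-- `u_{Q'}(X, s) = -∑_{j=1}^{m+1} |(i_j - i_{j-1}) - n_j|`. -/
def utilQ' (p : Params m) (s : Fin m → Fin (n + 1)) : ℝ :=
  -∑ j ∈ Finset.Icc 1 (m + 1), |((padSeq s j : ℝ) - (padSeq s (j - 1) : ℝ)) - gap p n j|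

/-- `γ(s)`: the product over all intervals of the factorials of their multiplicities in `s`. -/
def gamma (s : Fin m → Fin (n + 1)) : ℕ :=
  ∏ i : Fin (n + 1), (Fintype.card {j : Fin m // s j = i}).factorial

open Classical in
/-- The law of the interval sequence drawn in the first step of `M_{Q'}`: on nondecreasing sequences,
proportional to `exp (ε u_{Q'} / (2 · 2)) ∏_j (x_{i_j + 1} - x_{i_j}) / γ(s)`. -/
def intervalLawQ' (p : Params m) (x : Fin n → ℝ) : PMF (Fin m → Fin (n + 1)) :=
  drawProp fun s =>
    if Monotone s then
      Real.exp (p.ε * utilQ' p s / (2 * 2)) * (∏ j, tau p x (s j)) / (gamma s : ℝ)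
    else 0

/-! # JointExp: the laws of its random choices -/

/-- `φ(i, i', j) = exp (-(ε / (2 · 2)) |(i' - i) - n_j|)` for `i ≤ i'`, and `0` for `i > i'`. -/
def phi (p : Params m) (n i i' j : ℕ) : ℝ :=
  if i ≤ i' then Real.exp (-(p.ε / (2 * 2)) * |((i' : ℝ) - (i : ℝ)) - gap p n j|) else 0

/-- The forward dynamic program `α(j, i, k)`, for `1 ≤ j ≤ m`, `0 ≤ i ≤ n`, `1 ≤ k ≤ m`. -/
def alpha (p : Params m) (x : Fin n → ℝ) : ℕ → ℕ → ℕ → ℝ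
  | 0, _, _ => 0
  | 1, i, k => if k = 1 then phi p n 0 i 1 * tau p x i else 0
  | _ + 2, _, 0 => 0
  | j + 2, i, 1 =>
      tau p x i * ∑ i' ∈ Finset.range i, phi p n i' i (j + 2) *
        ∑ k ∈ Finset.Icc 1 (j + 1), alpha p x (j + 1) i' k
  | j + 2, i, k + 2 => tau p x i * phi p n i i (j + 2) * alpha p x (j + 1) i (k + 1) / ((k : ℝ) + 2)

/-- The factor that links interval `i` at position `j` to the part of the sequence that has been
sampled already: `φ(i, n, m + 1)` if `j = m`, and otherwise `φ(i, i_{j+1}, j + 1)` restricted to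
`i < i_{j+1}`. Position `j + 1` of the sequence is `s ⟨j, _⟩`. -/
def edge (p : Params m) (s : Fin m → Fin (n + 1)) (j i : ℕ) : ℝ :=
  if h : j < m then (if i < (s ⟨j, h⟩ : ℕ) then phi p n i (s ⟨j, h⟩) (j + 1) else 0)
  else phi p n i n (m + 1)

/-- The backward pass, when positions `1, …, j` are still to be sampled: while `j > 0`, draw
`(i, k)`, `1 ≤ k ≤ j`, with probability proportional to `α(j, i, k)` times the linking factor, set
positions `j - k + 1, …, j` to `i`, and go on with `j - k`. (In the code the current `j` is `j + 1`,
and `k` is `r.2 + 1`.) -/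
def backward (p : Params m) (x : Fin n → ℝ) :
    ℕ → (Fin m → Fin (n + 1)) → PMF (Fin m → Fin (n + 1))
  | 0, s => PMF.pure s
  | j + 1, s =>
      (drawProp fun r : Fin (n + 1) × Fin (j + 1) =>
        alpha p x (j + 1) r.1 (r.2 + 1) * edge p s (j + 1) r.1).bind fun r =>
          backward p x (j - r.2) fun t => if j - r.2 ≤ (t : ℕ) ∧ (t : ℕ) ≤ j then r.1 else s t
termination_by j => j
decreasing_by omega

/-- The law of the interval sequence that JointExp samples. -/
def intervalLaw (p : Params m) (x : Fin n → ℝ) : PMF (Fin m → Fin (n + 1)) :=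
  backward p x m fun _ => 0

/-- The joint law of the interval sequence `s` and the output of JointExp on sorted data `x`: given
`s = (i_1, …, i_m)`, draw `o_j` uniformly from `[x_{i_j}, x_{i_j + 1})`, independently, and sort. -/
def jointLaw (p : Params m) (x : Fin n → ℝ) :
    Measure ((Fin m → Fin (n + 1)) × (Fin m → ℝ)) :=
  ∑ s, intervalLaw p x s •
    (Measure.pi fun j : Fin m =>
      ProbabilityTheory.cond volume
        (Set.Ico (pad p.a p.b x (s j)) (pad p.a p.b x (s j + 1)))).map fun o => (s, sorted o)

/-- JointExp as a mechanism: clamp and sort the database, run the algorithm, release its output. -/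
def mechanism (p : Params m) (X : Fin n → ℝ) : Measure (Fin m → ℝ) :=
  (jointLaw p (sorted (clamp p.a p.b X))).map Prod.snd

/-! # A randomized real RAM

Programs work on natural-number registers, real registers, natural-number arrays and real arrays.
Arithmetic on reals is exact. Every operation, comparison, memory access and random draw costs one
step. -/

inductive NatOp | add | sub | mul | div | mod
inductive RealOp | add | sub | mul | div
inductive RealFn | abs | exp | cos | sin

def NatOp.apply : NatOp → ℕ → ℕ → ℕ
  | .add, x, y => x + y
  | .sub, x, y => x - y
  | .mul, x, y => x * y
  | .div, x, y => x / y
  | .mod, x, y => x % y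

def RealOp.apply : RealOp → ℝ → ℝ → ℝ
  | .add, x, y => x + y
  | .sub, x, y => x - y
  | .mul, x, y => x * y
  | .div, x, y => x / y

def RealFn.apply : RealFn → ℝ → ℝ
  | .abs, x => |x|
  | .exp, x => Real.exp x
  | .cos, x => Real.cos x
  | .sin, x => Real.sin x

/-- Natural-number expressions; `get A e` reads cell `e` of the natural-number array `A`. -/
inductive NExp
  | lit (c : ℕ)
  | var (r : ℕ)
  | bin (op : NatOp) (e f : NExp)
  | get (A : ℕ) (e : NExp)

/-- Real expressions; `get A e` reads cell `e` of the real array `A`. -/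
inductive RExp
  | var (r : ℕ)
  | ofNat (e : NExp)
  | pi
  | bin (op : RealOp) (e f : RExp)
  | fn (f : RealFn) (e : RExp)
  | get (A : ℕ) (e : NExp)

/-- Programs. `rand r` puts a fresh uniform random number into real register `r`; `ifN e f c d` and
`ifR e f c d` run `c` if `e < f` and `d` otherwise; `loop r e c` runs `c` with natural-number
register `r` equal to `0, 1, …, v - 1`, where `v` is the value of `e` before the loop. -/
inductive Cmd
  | skip
  | setN (r : ℕ) (e : NExp)
  | setR (r : ℕ) (e : RExp)
  | putN (A : ℕ) (idx e : NExp)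
  | putR (A : ℕ) (idx : NExp) (e : RExp)
  | rand (r : ℕ)
  | seq (c d : Cmd)
  | ifN (e f : NExp) (c d : Cmd)
  | ifR (e f : RExp) (c d : Cmd)
  | loop (r : ℕ) (e : NExp) (c : Cmd)

/-- The state of a run: the memory, the number of random draws so far, and the resources used:
`steps`, the set `cells` of all array cells that have been read or written (a natural-number cell is
`Sum.inl (array, index)`, a real cell `Sum.inr (array, index)`), and `peak`, the largest natural
number that has been computed. A program names a fixed finite number of registers, which are not
counted. -/
structure State where
  nreg : ℕ → ℕ
  rreg : ℕ → ℝ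
  narr : ℕ → ℕ → ℕ
  rarr : ℕ → ℕ → ℝ
  draws : ℕ
  steps : ℕ
  cells : Finset ((ℕ × ℕ) ⊕ (ℕ × ℕ))
  peak : ℕ

def NExp.eval (σ : State) : NExp → ℕ
  | .lit c => c
  | .var r => σ.nreg r
  | .bin op e f => op.apply (e.eval σ) (f.eval σ)
  | .get A e => σ.narr A (e.eval σ)

/-- The number of steps to evaluate an expression: one for each of its nodes. -/
def NExp.cost : NExp → ℕ
  | .lit _ => 1
  | .var _ => 1
  | .bin _ e f => e.cost + f.cost + 1
  | .get _ e => e.cost + 1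

/-- The array cells that are read in the evaluation. -/
def NExp.cells (σ : State) : NExp → Finset ((ℕ × ℕ) ⊕ (ℕ × ℕ))
  | .lit _ => ∅
  | .var _ => ∅
  | .bin _ e f => e.cells σ ∪ f.cells σ
  | .get A e => insert (Sum.inl (A, e.eval σ)) (e.cells σ)

/-- The largest natural number that occurs in the evaluation. -/
def NExp.peak (σ : State) : NExp → ℕ
  | .lit c => c
  | .var r => σ.nreg r
  | .bin op e f => max (op.apply (e.eval σ) (f.eval σ)) (max (e.peak σ) (f.peak σ))
  | .get A e => max (σ.narr A (e.eval σ)) (e.peak σ)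

def RExp.eval (σ : State) : RExp → ℝ
  | .var r => σ.rreg r
  | .ofNat e => (e.eval σ : ℝ)
  | .pi => Real.pi
  | .bin op e f => op.apply (e.eval σ) (f.eval σ)
  | .fn f e => f.apply (e.eval σ)
  | .get A e => σ.rarr A (e.eval σ)

def RExp.cost : RExp → ℕ
  | .var _ => 1
  | .ofNat e => e.cost + 1
  | .pi => 1
  | .bin _ e f => e.cost + f.cost + 1
  | .fn _ e => e.cost + 1
  | .get _ e => e.cost + 1

def RExp.cells (σ : State) : RExp → Finset ((ℕ × ℕ) ⊕ (ℕ × ℕ))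
  | .var _ => ∅
  | .ofNat e => e.cells σ
  | .pi => ∅
  | .bin _ e f => e.cells σ ∪ f.cells σ
  | .fn _ e => e.cells σ
  | .get A e => insert (Sum.inr (A, e.eval σ)) (e.cells σ)

def RExp.peak (σ : State) : RExp → ℕ
  | .var _ => 0
  | .ofNat e => e.peak σ
  | .pi => 0
  | .bin _ e f => max (e.peak σ) (f.peak σ)
  | .fn _ e => e.peak σ
  | .get _ e => e.peak σ

/-- Book-keeping: `t` more steps, the cells `S` accessed, numbers up to `v` computed. -/
def State.charge (σ : State) (t : ℕ) (S : Finset ((ℕ × ℕ) ⊕ (ℕ × ℕ))) (v : ℕ) : State :=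
  { σ with steps := σ.steps + t, cells := σ.cells ∪ S, peak := max σ.peak v }

def State.writeNReg (σ : State) (r v : ℕ) : State :=
  { σ with nreg := Function.update σ.nreg r v }

def State.writeRReg (σ : State) (r : ℕ) (v : ℝ) : State :=
  { σ with rreg := Function.update σ.rreg r v }

def State.writeNArr (σ : State) (A l v : ℕ) : State :=
  { σ with narr := Function.update σ.narr A (Function.update (σ.narr A) l v) }

def State.writeRArr (σ : State) (A l : ℕ) (v : ℝ) : State :=
  { σ with rarr := Function.update σ.rarr A (Function.update (σ.rarr A) l v) }

/-- Execution of a program from a state; `ω` is the stream of uniform random numbers. -/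
def Cmd.exec (ω : ℕ → unitInterval) : Cmd → State → State
  | .skip, σ => σ
  | .setN r e, σ =>
      (σ.charge (e.cost + 1) (e.cells σ) (e.peak σ)).writeNReg r (e.eval σ)
  | .setR r e, σ =>
      (σ.charge (e.cost + 1) (e.cells σ) (e.peak σ)).writeRReg r (e.eval σ)
  | .putN A idx e, σ =>
      (σ.charge (idx.cost + e.cost + 1)
        (insert (Sum.inl (A, idx.eval σ)) (idx.cells σ ∪ e.cells σ))
        (max (idx.peak σ) (e.peak σ))).writeNArr A (idx.eval σ) (e.eval σ)
  | .putR A idx e, σ =>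
      (σ.charge (idx.cost + e.cost + 1)
        (insert (Sum.inr (A, idx.eval σ)) (idx.cells σ ∪ e.cells σ))
        (max (idx.peak σ) (e.peak σ))).writeRArr A (idx.eval σ) (e.eval σ)
  | .rand r, σ =>
      { (σ.charge 1 ∅ 0).writeRReg r (ω σ.draws : ℝ) with draws := σ.draws + 1 }
  | .seq c d, σ => d.exec ω (c.exec ω σ)
  | .ifN e f c d, σ =>
      let σ' := σ.charge (e.cost + f.cost + 1) (e.cells σ ∪ f.cells σ) (max (e.peak σ) (f.peak σ))
      if e.eval σ < f.eval σ then c.exec ω σ' else d.exec ω σ'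
  | .ifR e f c d, σ =>
      let σ' := σ.charge (e.cost + f.cost + 1) (e.cells σ ∪ f.cells σ) (max (e.peak σ) (f.peak σ))
      open Classical in if e.eval σ < f.eval σ then c.exec ω σ' else d.exec ω σ'
  | .loop r e c, σ =>
      (List.range (e.eval σ)).foldl (fun τ v => c.exec ω ((τ.charge 1 ∅ v).writeNReg r v))
        (σ.charge (e.cost + 1) (e.cells σ) (e.peak σ))

/-- `c.WritesOnly N R A B`: `c` is deterministic, and it writes only to natural-number registers
in `N`, real registers in `R`, natural-number arrays in `A` and real arrays in `B`. -/
def Cmd.WritesOnly (N R A B : Set ℕ) : Cmd → Prop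
  | .skip => True
  | .setN r _ => r ∈ N
  | .setR r _ => r ∈ R
  | .putN a _ _ => a ∈ A
  | .putR a _ _ => a ∈ B
  | .rand _ => False
  | .seq c d => c.WritesOnly N R A B ∧ d.WritesOnly N R A B
  | .ifN _ _ c d => c.WritesOnly N R A B ∧ d.WritesOnly N R A B
  | .ifR _ _ c d => c.WritesOnly N R A B ∧ d.WritesOnly N R A B
  | .loop r _ c => r ∈ N ∧ c.WritesOnly N R A B

/-! # JointExp as a program -/

instance (c : ℕ) : OfNat NExp c := ⟨.lit c⟩
instance : Add NExp := ⟨.bin .add⟩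
instance : Sub NExp := ⟨.bin .sub⟩
instance : Mul NExp := ⟨.bin .mul⟩
instance (c : ℕ) : OfNat RExp c := ⟨.ofNat (.lit c)⟩
instance : Add RExp := ⟨.bin .add⟩
instance : Sub RExp := ⟨.bin .sub⟩
instance : Mul RExp := ⟨.bin .mul⟩
instance : Div RExp := ⟨.bin .div⟩

namespace Prog

/-- Sequential composition of a list of programs. -/
def block : List Cmd → Cmd
  | [] => .skip
  | c :: cs => .seq c (block cs)

/-! Natural-number registers. Registers below `16` belong to the main program. -/

def rn : ℕ := 0
def rm : ℕ := 1
def rj : ℕ := 2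
def ri : ℕ := 3
def rk : ℕ := 4
def rl : ℕ := 5
def found : ℕ := 6
def newI : ℕ := 7
def newK : ℕ := 8
def round : ℕ := 9

/-! Real registers. -/

def ra : ℕ := 0
def rb : ℕ := 1
def reps : ℕ := 2
def acc : ℕ := 3
def total : ℕ := 4
def unif : ℕ := 5
def tmp : ℕ := 6

/-! Real arrays: the inputs `x_1, …, x_n` and `q_1, …, q_m` (from cell `0` on), the table of `α`, the
output, `α̂(j - 1, ·)`, the strictly upper Toeplitz matrix `φ(·, ·, j)` (given by its first row), its
product with `α̂`, the padded data, the padded quantiles, the numbers `n_j`, and the linking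
factors of the backward pass. Arrays below `16` belong to the main program. -/

def inX : ℕ := 0
def inQ : ℕ := 1
def tab : ℕ := 2
def out : ℕ := 3
def hat : ℕ := 4
def ker : ℕ := 5
def prod : ℕ := 6
def xs : ℕ := 7
def qs : ℕ := 8
def gaps : ℕ := 9
def link : ℕ := 10

/-! The natural-number array of the interval sequence: `i_j` is in cell `j - 1`. -/

def sqn : ℕ := 0

def N : NExp := .var rn
def M : NExp := .var rm
def J : NExp := .var rj
def I : NExp := .var ri
def K : NExp := .var rk
def L : NExp := .var rl

/-- The position of `α(j, i, k)` in its table, `1 ≤ j`, `1 ≤ k`. -/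
def tabIndex (n m j i k : ℕ) : ℕ := ((j - 1) * (n + 1) + i) * m + (k - 1)

/-- The same position as an expression. -/
def cell (j i k : NExp) : NExp := ((j - 1) * (N + 1) + i) * M + (k - 1)

/-- `α(j, i, k)`. -/
def alphaE (j i k : NExp) : RExp := .get tab (cell j i k)

/-- `φ(i, i', j)` for `i' - i = d ≥ 0`. -/
def phiE (d j : NExp) : RExp :=
  .fn .exp ((0 - .var reps / (2 * 2)) * .fn .abs (.ofNat d - .get gaps j))

/-- `τ(i)`. -/
def tauE (i : NExp) : RExp := .get xs (i + 1) - .get xs i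

/-- Padding of the inputs and computation of the `n_j`. -/
def setup : Cmd := block [
  .putR xs 0 (.var ra),
  .loop rl N (.putR xs (L + 1) (.get inX L)),
  .putR xs (N + 1) (.var rb),
  .putR qs 0 0,
  .loop rl M (.putR qs (L + 1) (.get inQ L)),
  .putR qs (M + 1) 1,
  .loop rl (M + 1) (.putR gaps (L + 1) ((.get qs (L + 1) - .get qs L) * .ofNat N))]

/-- `α(1, i, 1) = φ(0, i, 1) τ(i)`. -/
def base : Cmd := .loop ri (N + 1) (.putR tab (cell 1 I 1) (phiE I 1 * tauE I))

/-- One round `j ≥ 2` of the forward pass. The subroutine `toeplitz` has to compute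
`∑_{i' < i} φ(i', i, j) α̂(j - 1, i')` for all `i`. -/
def forwardRound (toeplitz : Cmd) : Cmd := block [
  .loop ri (N + 1) (block [
    .setR acc 0,
    .loop rl (J - 1) (.setR acc (.var acc + alphaE (J - 1) I (L + 1))),
    .putR hat I (.var acc)]),
  .putR ker 0 0,
  .loop rl N (.putR ker (L + 1) (phiE (L + 1) J)),
  toeplitz,
  .loop ri (N + 1) (.putR tab (cell J I 1) (tauE I * .get prod I)),
  .loop rl (J - 1) (block [
    .setN rk (L + 2),
    .loop ri (N + 1) (.putR tab (cell J I K)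
      (tauE I * phiE 0 J * alphaE (J - 1) I (K - 1) / .ofNat K))])]

/-- The forward pass. -/
def forward (toeplitz : Cmd) : Cmd := block [
  base,
  .loop round (M - 1) (.seq (.setN rj (.var round + 2)) (forwardRound toeplitz))]

/-- The linking factors of all intervals `i` at position `j`. -/
def links : Cmd :=
  .loop ri (N + 1)
    (.ifN J M
      (.ifN I (.get sqn J)
        (.putR link I (phiE (.get sqn J - I) (J + 1)))
        (.putR link I 0))
      (.putR link I (phiE (N - I) (M + 1))))

/-- Draw `(i, k)` with probability proportional to `α(j, i, k)` times the linking factor of `i`, by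
inversion of the distribution function at the uniform number in register `unif`. -/
def draw : Cmd := block [
  links,
  .setR total 0,
  .loop ri (N + 1) (.loop rk J
    (.setR total (.var total + alphaE J I (K + 1) * .get link I))),
  .setR acc 0,
  .setN found 0,
  .setN newI 0,
  .setN newK 1,
  .loop ri (N + 1) (.loop rk J
    (.ifN (.var found) 1
      (.seq (.setR acc (.var acc + alphaE J I (K + 1) * .get link I))
        (.ifR (.var unif * .var total) (.var acc)
          (block [.setN found 1, .setN newI I, .setN newK (K + 1)])
          .skip))
      .skip))]

/-- The backward pass: at most `m` rounds are needed, and each has one uniform number at its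
disposal. -/
def backwardPass : Cmd := block [
  .setN rj M,
  .loop round M (.seq (.rand unif)
    (.ifN 0 J
      (block [
        draw,
        .loop rl (.var newK) (.putN sqn (J - .var newK + L) (.var newI)),
        .setN rj (J - .var newK)])
      .skip))]

/-- Uniform samples from the chosen intervals, in increasing order (by bubble sort). -/
def output : Cmd := block [
  .loop rl M (.seq (.rand unif)
    (.putR out L (.get xs (.get sqn L) + .var unif * tauE (.get sqn L)))),
  .loop ri M (.loop rl (M - 1)
    (.ifR (.get out (L + 1)) (.get out L)
      (block [
        .setR tmp (.get out L),
        .putR out L (.get out (L + 1)),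
        .putR out (L + 1) (.var tmp)])
      .skip))]

/-- JointExp, with a subroutine for the multiplication of a Toeplitz matrix with a vector. -/
def jointExp (toeplitz : Cmd) : Cmd := block [setup, forward toeplitz, backwardPass, output]

/-- What it means to be a subroutine for the product: it is deterministic and, apart from the array
`prod` for its result, writes only to registers and arrays that the main program does not use. -/
def IsSubroutine (c : Cmd) : Prop :=
  c.WritesOnly (Set.Ici 16) (Set.Ici 16) (Set.Ici 16) (insert prod (Set.Ici 16))

/-- The initial state: the input, and zeros elsewhere. -/
def init (p : Params m) (x : Fin n → ℝ) : State where
  nreg := fun r => if r = rn then n else if r = rm then m else 0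
  rreg := fun r => if r = ra then p.a else if r = rb then p.b else if r = reps then p.ε else 0
  narr := fun _ _ => 0
  rarr := fun A l =>
    if A = inX then (if h : l < n then x ⟨l, h⟩ else 0)
    else if A = inQ then (if h : l < m then p.q ⟨l, h⟩ else 0)
    else 0
  draws := 0
  steps := 0
  cells := ∅
  peak := 0

/-- The final state of JointExp. -/
def final (toeplitz : Cmd) (p : Params m) (x : Fin n → ℝ) (ω : ℕ → unitInterval) : State :=
  (jointExp toeplitz).exec ω (init p x)

/-- The interval sequence and the output, as read from the memory. -/
def result (m : ℕ) (σ : State) : (Fin m → ℕ) × (Fin m → ℝ) :=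
  (fun j => σ.narr sqn j, fun j => σ.rarr out j)

/-- The random source: independent uniform random numbers in `[0, 1]`. -/
def source : Measure (ℕ → unitInterval) := Measure.infinitePi fun _ => volume

end Prog

end

end JointExp

/-!
JointExp first draws an interval sequence and then uniform points in its intervals.

*The interval sequence.* The weight of a nondecreasing sequence under `intervalLawQ'` factors over its
maximal blocks of equal entries, and `α(j, i, k)` is the total weight of all initial pieces of length
`j` that end with a block of exactly `k` entries `i`. Hence a draw of the backward pass chooses the last
block of what is left with its correct conditional probability. Formally, the sum of the weights of a
draw is the total weight of all ways to complete the sequence, and each single weight is the weight of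
a block times the corresponding total for the next draw (`sum_alpha_mul_edge`,
`alpha_eq_blockWeight_mul_totalWeight`). An induction gives `totalWeight_mul_backward` and then
`intervalLaw_eq_intervalLawQ'`.

*The output.* Almost everywhere on the box that belongs to a nondecreasing interval sequence `s`, the
utility `u_Q` is constant and equal to `u_{Q'}(s)`, and these boxes cover almost all of the output space.
Sorting the points of the box of `s` covers its ordered points `γ(s)` times, once for each permutation
that fixes `s` (`volume_box_inter_sorted`). So uniform points in the intervals, sorted, have the density
of `M_Q`, which is `mechanism_eq_mechQ`. Privacy is that of the exponential mechanism: a data point lies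
in only one of the intervals between consecutive outputs, so that the utility changes by at most `2`
between neighbours (`utilQ_le_add_two`, `isPureDP_mechQ`).

*The program.* The Toeplitz product is computed with two fast Fourier transforms. The vector and the first
column of the matrix are the real and the imaginary part of one complex vector `z`, and the product is
half of the imaginary part of the convolution of `z` with itself, which the transform of the square of
the transform of `z` contains in reverse order (`dft_sq_dft`, `im_sum_mul_reflect`). The transform
follows the self-sorting recursion `stockham`. `exec_jointExp` describes the final memory as a function of
the random numbers, and `lintegral_run` and `map_samples` compute the law of this function. Draws whose
weights are all zero, where the program and the definition of `backward` resort to different arbitrary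
choices, have probability zero.

*Resources.* Given bounds for all natural-number registers and arrays, time and largest number can be read
off from the text of a program (`Cmd.Fits.bounded`). Only the loop that determines the size of the
transform needs its own argument (`fftSize_bounded`). Since every address is a computed number, the
bound for the numbers is also one for the accessed cells (`Cmd.cells_subset`).
-/

namespace JointExp

noncomputable section

section

/-! ### Reasoning about runs of the machine -/

namespace State

variable (σ : State) (t v r A l : ℕ) (y : ℝ) (S : Finset ((ℕ × ℕ) ⊕ (ℕ × ℕ)))

@[simp] lemma charge_nreg : (σ.charge t S v).nreg = σ.nreg := rfl
@[simp] lemma charge_rreg : (σ.charge t S v).rreg = σ.rreg := rfl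
@[simp] lemma charge_narr : (σ.charge t S v).narr = σ.narr := rfl
@[simp] lemma charge_rarr : (σ.charge t S v).rarr = σ.rarr := rfl
@[simp] lemma charge_steps : (σ.charge t S v).steps = σ.steps + t := rfl

@[simp] lemma writeNReg_nreg : (σ.writeNReg r v).nreg = Function.update σ.nreg r v := rfl
@[simp] lemma writeNReg_rreg : (σ.writeNReg r v).rreg = σ.rreg := rfl

@[simp] lemma writeRReg_nreg : (σ.writeRReg r y).nreg = σ.nreg := rfl
@[simp] lemma writeRReg_rreg : (σ.writeRReg r y).rreg = Function.update σ.rreg r y := rfl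
@[simp] lemma writeRReg_rarr : (σ.writeRReg r y).rarr = σ.rarr := rfl

@[simp] lemma writeNArr_narr : (σ.writeNArr A l v).narr =
    Function.update σ.narr A (Function.update (σ.narr A) l v) := rfl

@[simp] lemma writeRArr_nreg : (σ.writeRArr A l y).nreg = σ.nreg := rfl
@[simp] lemma writeRArr_rreg : (σ.writeRArr A l y).rreg = σ.rreg := rfl
@[simp] lemma writeRArr_rarr : (σ.writeRArr A l y).rarr =
    Function.update σ.rarr A (Function.update (σ.rarr A) l y) := rfl

end State

/-- The state in which the body of a loop starts its round number `v`. -/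
def State.enter (σ : State) (r v : ℕ) : State := (σ.charge 1 ∅ v).writeNReg r v

namespace State

variable (σ : State) (r v : ℕ)

@[simp] lemma enter_nreg : (σ.enter r v).nreg = Function.update σ.nreg r v := rfl
@[simp] lemma enter_rreg : (σ.enter r v).rreg = σ.rreg := rfl
@[simp] lemma enter_narr : (σ.enter r v).narr = σ.narr := rfl
@[simp] lemma enter_rarr : (σ.enter r v).rarr = σ.rarr := rfl
@[simp] lemma enter_draws : (σ.enter r v).draws = σ.draws := rfl
@[simp] lemma enter_steps : (σ.enter r v).steps = σ.steps + 1 := rfl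

end State

variable {ω : ℕ → unitInterval}

/-- The loop rule: an invariant, indexed by the number of completed rounds. -/
theorem exec_loop_induction {r k : ℕ} {e : NExp} {c : Cmd} {σ : State} (hk : e.eval σ = k)
    (P : ℕ → State → Prop) (h0 : P 0 (σ.charge (e.cost + 1) (e.cells σ) (e.peak σ)))
    (hs : ∀ v < k, ∀ τ, P v τ → P (v + 1) (c.exec ω (τ.enter r v))) :
    P k ((Cmd.loop r e c).exec ω σ) := by
  have key : ∀ j ≤ k, P j ((List.range j).foldl (fun τ v => c.exec ω (τ.enter r v))
      (σ.charge (e.cost + 1) (e.cells σ) (e.peak σ))) := by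
    intro j
    induction j with
    | zero => intro _; simpa using h0
    | succ j ih =>
      intro hj
      rw [List.range_succ, List.foldl_append]
      exact hs j (by omega) _ (ih (by omega))
  have := key k le_rfl
  rw [← hk] at this ⊢
  exact this

/-- `τ` arises from `σ` by changes of natural-number registers in `N`, real registers in `R`,
natural-number arrays in `A` and real arrays in `B` only, without random draws. -/
structure Agrees (N R A B : Set ℕ) (σ τ : State) : Prop where
  nreg : ∀ r, r ∉ N → τ.nreg r = σ.nreg r
  rreg : ∀ r, r ∉ R → τ.rreg r = σ.rreg r
  narr : ∀ r, r ∉ A → τ.narr r = σ.narr r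
  rarr : ∀ r, r ∉ B → τ.rarr r = σ.rarr r
  draws : τ.draws = σ.draws

namespace Agrees

variable {N R A B N' R' A' B' : Set ℕ} {σ τ ρ : State}

lemma refl : Agrees N R A B σ σ := ⟨fun _ _ => rfl, fun _ _ => rfl, fun _ _ => rfl, fun _ _ => rfl, rfl⟩

lemma trans (h : Agrees N R A B σ τ) (h' : Agrees N R A B τ ρ) : Agrees N R A B σ ρ :=
  ⟨fun r hr => (h'.nreg r hr).trans (h.nreg r hr), fun r hr => (h'.rreg r hr).trans (h.rreg r hr),
    fun r hr => (h'.narr r hr).trans (h.narr r hr), fun r hr => (h'.rarr r hr).trans (h.rarr r hr),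
    h'.draws.trans h.draws⟩

lemma mono (h : Agrees N R A B σ τ) (hN : N ⊆ N') (hR : R ⊆ R') (hA : A ⊆ A') (hB : B ⊆ B') :
    Agrees N' R' A' B' σ τ :=
  ⟨fun r hr => h.nreg r fun h => hr (hN h), fun r hr => h.rreg r fun h => hr (hR h),
    fun r hr => h.narr r fun h => hr (hA h), fun r hr => h.rarr r fun h => hr (hB h), h.draws⟩

lemma charge {t S v} (h : Agrees N R A B σ τ) : Agrees N R A B σ (τ.charge t S v) :=
  ⟨h.nreg, h.rreg, h.narr, h.rarr, h.draws⟩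

lemma enter {r v} (h : Agrees N R A B σ τ) (hr : r ∈ N) : Agrees N R A B σ (τ.enter r v) :=
  ⟨fun r' hr' => by
    have : r' ≠ r := by rintro rfl; exact hr' hr
    simpa [this] using h.nreg r' hr', h.rreg, h.narr, h.rarr, h.draws⟩

end Agrees

lemma Cmd.WritesOnly.mono {N R A B N' R' A' B' : Set ℕ} {c : Cmd} (h : c.WritesOnly N R A B)
    (hN : N ⊆ N') (hR : R ⊆ R') (hA : A ⊆ A') (hB : B ⊆ B') : c.WritesOnly N' R' A' B' := by
  induction c with
  | skip => trivial
  | setN r e => exact hN h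
  | setR r e => exact hR h
  | putN A idx e => exact hA h
  | putR A idx e => exact hB h
  | rand r => exact h
  | seq c d hc hd => exact ⟨hc h.1, hd h.2⟩
  | ifN e f c d hc hd => exact ⟨hc h.1, hd h.2⟩
  | ifR e f c d hc hd => exact ⟨hc h.1, hd h.2⟩
  | loop r e c hc => exact ⟨hN h.1, hc h.2⟩

theorem Cmd.WritesOnly.agrees {N R A B : Set ℕ} {c : Cmd} (h : c.WritesOnly N R A B) (σ : State) :
    Agrees N R A B σ (c.exec ω σ) := by
  have upd : ∀ {α : Type} (f : ℕ → α) (v : α) (S : Set ℕ) (r : ℕ), r ∈ S →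
      ∀ r', r' ∉ S → Function.update f r v r' = f r' := by
    intro α f v S r hr r' hr'
    have : r' ≠ r := by rintro rfl; exact hr' hr
    simp [this]
  induction c generalizing σ with
  | skip => exact .refl
  | setN r e => exact ⟨upd _ _ _ _ h, fun _ _ => rfl, fun _ _ => rfl, fun _ _ => rfl, rfl⟩
  | setR r e => exact ⟨fun _ _ => rfl, upd _ _ _ _ h, fun _ _ => rfl, fun _ _ => rfl, rfl⟩
  | putN A idx e => exact ⟨fun _ _ => rfl, fun _ _ => rfl, upd _ _ _ _ h, fun _ _ => rfl, rfl⟩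
  | putR A idx e => exact ⟨fun _ _ => rfl, fun _ _ => rfl, fun _ _ => rfl, upd _ _ _ _ h, rfl⟩
  | rand r => exact h.elim
  | seq c d hc hd => exact (hc h.1 σ).trans (hd h.2 _)
  | ifN e f c d hc hd =>
    simp only [Cmd.exec]
    split_ifs
    · exact Agrees.trans (Agrees.charge .refl) (hc h.1 _)
    · exact Agrees.trans (Agrees.charge .refl) (hd h.2 _)
  | ifR e f c d hc hd =>
    simp only [Cmd.exec]
    split_ifs
    · exact Agrees.trans (Agrees.charge .refl) (hc h.1 _)
    · exact Agrees.trans (Agrees.charge .refl) (hd h.2 _)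
  | loop r e c hc =>
    exact exec_loop_induction (k := e.eval σ) rfl (fun _ τ => Agrees N R A B σ τ)
      (Agrees.charge .refl) fun v _ τ hτ => (hτ.enter h.1).trans (hc h.2 _)

/-- A loop whose round `v` writes the number `g v` to cell `f v` of the real array `A`, where `f` is
injective. The numbers `g v` may depend on the cells of `A` that the loop does not write. -/
theorem exec_loop_fill {r k : ℕ} {e : NExp} {c : Cmd} {σ : State} (hk : e.eval σ = k) {A : ℕ}
    (f : ℕ → ℕ) (g : ℕ → ℝ) (N R : Set ℕ) (hr : r ∈ N) (hw : c.WritesOnly N R ∅ {A})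
    (hf : Set.InjOn f (Set.Iio k))
    (h : ∀ v < k, ∀ τ, Agrees N R ∅ {A} σ τ → τ.nreg r = v →
      (∀ l, (∀ v < k, f v ≠ l) → τ.rarr A l = σ.rarr A l) →
      (c.exec ω τ).rarr A = Function.update (τ.rarr A) (f v) (g v)) :
    (∀ v < k, ((Cmd.loop r e c).exec ω σ).rarr A (f v) = g v) ∧
      ∀ l, (∀ v < k, f v ≠ l) → ((Cmd.loop r e c).exec ω σ).rarr A l = σ.rarr A l := by
  have := exec_loop_induction (ω := ω) (r := r) (c := c) hk (fun j τ => Agrees N R ∅ {A} σ τ ∧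
      (∀ v < j, τ.rarr A (f v) = g v) ∧ ∀ l, (∀ v < k, f v ≠ l) → τ.rarr A l = σ.rarr A l)
    ⟨Agrees.charge .refl, fun v hv => absurd hv (by omega), fun _ _ => rfl⟩ ?_
  · exact this.2
  · rintro v hv τ ⟨h1, h2, h3⟩
    have key := h v hv (τ.enter r v) (h1.enter hr) (by simp) (by simpa using h3)
    refine ⟨(h1.enter hr).trans (hw.agrees _), fun v' hv' => ?_, fun l hl => ?_⟩
    · rw [key]
      rcases eq_or_ne v' v with rfl | hne
      · simp
      · rw [Function.update_of_ne (fun h => hne (hf (show v' < k by omega) hv h))]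
        exact h2 v' (by omega)
    · rw [key, Function.update_of_ne (hl v hv).symm]
      exact h3 l hl

/-- A loop whose round `v` adds `g v` to the real register `q`. -/
theorem exec_loop_sum {r k q : ℕ} {e : NExp} {c : Cmd} {σ : State} (hk : e.eval σ = k)
    (g : ℕ → ℝ) (N R : Set ℕ) (hr : r ∈ N) (hw : c.WritesOnly N R ∅ ∅)
    (h : ∀ v < k, ∀ τ, Agrees N R ∅ ∅ σ τ → τ.nreg r = v →
      (c.exec ω τ).rreg q = τ.rreg q + g v) :
    ((Cmd.loop r e c).exec ω σ).rreg q = σ.rreg q + ∑ v ∈ Finset.range k, g v := by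
  refine (exec_loop_induction (ω := ω) (r := r) (c := c) hk (fun j τ => Agrees N R ∅ ∅ σ τ ∧
      τ.rreg q = σ.rreg q + ∑ v ∈ Finset.range j, g v) ⟨Agrees.charge .refl, by simp⟩ ?_).2
  rintro v hv τ ⟨h1, h2⟩
  refine ⟨(h1.enter hr).trans (hw.agrees _), ?_⟩
  rw [h v hv _ (h1.enter hr) (by simp), Finset.sum_range_succ, ← add_assoc, ← h2]
  simp

/-! ### A static analysis of the resources -/

/-- An upper bound for the value of an expression, from bounds `β` for the natural-number registers
and `γ` for the entries of the natural-number arrays. -/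
def NExp.ub (β γ : ℕ → ℕ) : NExp → ℕ
  | .lit c => c
  | .var r => β r
  | .bin .add e f => e.ub β γ + f.ub β γ
  | .bin .mul e f => e.ub β γ * f.ub β γ
  | .bin _ e _ => e.ub β γ
  | .get A _ => γ A

/-- All natural numbers in the evaluation of the expression are at most `V`, by the bounds `ub`. -/
def NExp.Fits (β γ : ℕ → ℕ) (V : ℕ) : NExp → Prop
  | .lit c => c ≤ V
  | .var r => β r ≤ V
  | .bin .add e f => e.ub β γ + f.ub β γ ≤ V ∧ e.Fits β γ V ∧ f.Fits β γ V
  | .bin .mul e f => e.ub β γ * f.ub β γ ≤ V ∧ e.Fits β γ V ∧ f.Fits β γ V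
  | .bin _ e f => e.Fits β γ V ∧ f.Fits β γ V
  | .get A e => γ A ≤ V ∧ e.Fits β γ V

/-- All natural numbers in the evaluation of the expression are at most `V`, by the bounds `ub`. -/
def RExp.Fits (β γ : ℕ → ℕ) (V : ℕ) : RExp → Prop
  | .var _ => True
  | .ofNat e => e.Fits β γ V
  | .pi => True
  | .bin _ e f => e.Fits β γ V ∧ f.Fits β γ V
  | .fn _ e => e.Fits β γ V
  | .get _ e => e.Fits β γ V

/-- The bounds `β`, `γ` for registers and arrays are kept by all assignments of the program, and all
natural numbers that it computes are at most `V`. -/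
def Cmd.Fits (β γ : ℕ → ℕ) (V : ℕ) : Cmd → Prop
  | .skip => True
  | .setN r e => e.Fits β γ V ∧ e.ub β γ ≤ β r
  | .setR _ e => e.Fits β γ V
  | .putN A idx e => idx.Fits β γ V ∧ e.Fits β γ V ∧ e.ub β γ ≤ γ A
  | .putR _ idx e => idx.Fits β γ V ∧ e.Fits β γ V
  | .rand _ => True
  | .seq c d => c.Fits β γ V ∧ d.Fits β γ V
  | .ifN e f c d => (e.Fits β γ V ∧ f.Fits β γ V) ∧ c.Fits β γ V ∧ d.Fits β γ V
  | .ifR e f c d => (e.Fits β γ V ∧ f.Fits β γ V) ∧ c.Fits β γ V ∧ d.Fits β γ V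
  | .loop r e c => e.Fits β γ V ∧ e.ub β γ ≤ β r + 1 ∧ c.Fits β γ V

/-- An upper bound for the running time, from the bounds `β` and `γ`; both branches of a conditional are
counted. -/
def Cmd.time (β γ : ℕ → ℕ) : Cmd → ℕ
  | .skip => 0
  | .setN _ e => e.cost + 1
  | .setR _ e => e.cost + 1
  | .putN _ idx e => idx.cost + e.cost + 1
  | .putR _ idx e => idx.cost + e.cost + 1
  | .rand _ => 1
  | .seq c d => c.time β γ + d.time β γ
  | .ifN e f c d => e.cost + f.cost + 1 + (c.time β γ + d.time β γ)
  | .ifR e f c d => e.cost + f.cost + 1 + (c.time β γ + d.time β γ)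
  | .loop _ e c => e.cost + 1 + e.ub β γ * (c.time β γ + 1)

/-- The registers and arrays of the state satisfy the bounds `β` and `γ`. -/
def State.Within (β γ : ℕ → ℕ) (σ : State) : Prop :=
  (∀ r, σ.nreg r ≤ β r) ∧ ∀ A l, σ.narr A l ≤ γ A

/-- From states within the bounds `β`, `γ` the program leads to such states again, in at most `T`
steps, and without numbers above `V`. -/
def Cmd.Bounded (β γ : ℕ → ℕ) (V : ℕ) (c : Cmd) (T : ℕ) : Prop :=
  ∀ (ω : ℕ → unitInterval) (σ : State), σ.Within β γ → σ.peak ≤ V →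
    (c.exec ω σ).Within β γ ∧ (c.exec ω σ).steps ≤ σ.steps + T ∧ (c.exec ω σ).peak ≤ V

section Resources

variable {β γ : ℕ → ℕ} {V : ℕ} {σ : State}

lemma NExp.eval_le_ub (hσ : σ.Within β γ) (e : NExp) : e.eval σ ≤ e.ub β γ := by
  induction e with
  | lit c => exact le_rfl
  | var r => exact hσ.1 r
  | bin op e f he hf =>
    cases op with
    | add => exact add_le_add he hf
    | mul => exact mul_le_mul' he hf
    | sub => exact (Nat.sub_le _ _).trans he
    | div => exact (Nat.div_le_self _ _).trans he
    | mod => exact (Nat.mod_le _ _).trans he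
  | get A e => exact hσ.2 _ _

lemma NExp.Fits.peak_le (hσ : σ.Within β γ) {e : NExp} (h : e.Fits β γ V) : e.peak σ ≤ V := by
  have hev := fun e => NExp.eval_le_ub hσ e
  have key : ∀ e : NExp, e.Fits β γ V → e.eval σ ≤ V ∧ e.peak σ ≤ V := by
    intro e h
    induction e with
    | lit c => exact ⟨h, h⟩
    | var r => exact ⟨(hσ.1 r).trans h, (hσ.1 r).trans h⟩
    | bin op e f he hf =>
      cases op with
      | add =>
        have := (add_le_add (hev e) (hev f)).trans h.1
        exact ⟨this, max_le this (max_le (he h.2.1).2 (hf h.2.2).2)⟩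
      | mul =>
        have := (mul_le_mul' (hev e) (hev f)).trans h.1
        exact ⟨this, max_le this (max_le (he h.2.1).2 (hf h.2.2).2)⟩
      | sub =>
        have := (Nat.sub_le (e.eval σ) (f.eval σ)).trans (he h.1).1
        exact ⟨this, max_le this (max_le (he h.1).2 (hf h.2).2)⟩
      | div =>
        have := (Nat.div_le_self (e.eval σ) (f.eval σ)).trans (he h.1).1
        exact ⟨this, max_le this (max_le (he h.1).2 (hf h.2).2)⟩
      | mod =>
        have := (Nat.mod_le (e.eval σ) (f.eval σ)).trans (he h.1).1
        exact ⟨this, max_le this (max_le (he h.1).2 (hf h.2).2)⟩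
    | get A e he =>
      have := (hσ.2 A (e.eval σ)).trans h.1
      exact ⟨this, max_le this (he h.2).2⟩
  exact (key e h).2

lemma RExp.Fits.peak_le (hσ : σ.Within β γ) {e : RExp} (h : e.Fits β γ V) : e.peak σ ≤ V := by
  induction e with
  | var r => exact Nat.zero_le _
  | ofNat e => exact NExp.Fits.peak_le hσ h
  | pi => exact Nat.zero_le _
  | bin op e f he hf => exact max_le (he h.1) (hf h.2)
  | fn f e he => exact he h
  | get A e => exact NExp.Fits.peak_le hσ h

lemma State.Within.mono {β' : ℕ → ℕ} (h : σ.Within β γ) (hβ : ∀ r, β r ≤ β' r) :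
    σ.Within β' γ :=
  ⟨fun r => (h.1 r).trans (hβ r), h.2⟩

lemma State.Within.enter (hσ : σ.Within β γ) {r v : ℕ} (hv : v ≤ β r) :
    (σ.enter r v).Within β γ := by
  refine ⟨fun r' => ?_, hσ.2⟩
  rcases eq_or_ne r' r with rfl | h
  · simpa using hv
  · simpa [h] using hσ.1 r'

lemma State.Within.writeNReg (hσ : σ.Within β γ) {r v : ℕ} (hv : v ≤ β r) :
    (σ.writeNReg r v).Within β γ := hσ.enter (r := r) hv

lemma Cmd.Bounded.seq {c d : Cmd} {S T : ℕ} (hc : c.Bounded β γ V S) (hd : d.Bounded β γ V T) :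
    (Cmd.seq c d).Bounded β γ V (S + T) := by
  intro ω σ hσ hp
  obtain ⟨h1, h2, h3⟩ := hc ω σ hσ hp
  obtain ⟨h4, h5, h6⟩ := hd ω _ h1 h3
  exact ⟨h4, by simp only [Cmd.exec]; omega, h6⟩

lemma Cmd.Bounded.loop {c : Cmd} {r T : ℕ} {e : NExp} (he : e.Fits β γ V)
    (hr : e.ub β γ ≤ β r + 1) (hc : c.Bounded β γ V T) :
    (Cmd.loop r e c).Bounded β γ V (e.cost + 1 + e.ub β γ * (T + 1)) := by
  intro ω σ hσ hp
  have hub := NExp.eval_le_ub hσ e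
  have hpk : e.eval σ ≤ V := by
    have : ∀ f : NExp, f.eval σ ≤ f.peak σ := by
      rintro (_ | _ | _ | _) <;> simp [NExp.eval, NExp.peak]
    exact (this e).trans (he.peak_le hσ)
  have := exec_loop_induction (ω := ω) (r := r) (c := c) (σ := σ) (e := e) rfl
    (fun v τ => τ.Within β γ ∧ τ.steps ≤ σ.steps + (e.cost + 1 + v * (T + 1)) ∧ τ.peak ≤ V)
    ⟨hσ, by simp, max_le hp (he.peak_le hσ)⟩ ?_
  · refine ⟨this.1, this.2.1.trans ?_, this.2.2⟩
    gcongr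
  · rintro v hv τ ⟨h1, h2, h3⟩
    obtain ⟨h4, h5, h6⟩ := hc ω (τ.enter r v) (h1.enter (by omega)) (max_le h3 (by omega))
    refine ⟨h4, h5.trans ?_, h6⟩
    have : (v + 1) * (T + 1) = v * (T + 1) + (T + 1) := by ring
    simp only [State.enter_steps]
    omega

/-- The static analysis is sound. -/
theorem Cmd.Fits.bounded {c : Cmd} (h : c.Fits β γ V) : c.Bounded β γ V (c.time β γ) := by
  induction c with
  | skip => exact fun ω σ hσ hp => ⟨hσ, le_rfl, hp⟩
  | setN r e =>
    intro ω σ hσ hp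
    exact ⟨State.Within.writeNReg (σ := σ.charge _ _ _) hσ ((NExp.eval_le_ub hσ e).trans h.2), le_rfl,
      max_le hp (h.1.peak_le hσ)⟩
  | setR r e => exact fun ω σ hσ hp => ⟨hσ, le_rfl, max_le hp (RExp.Fits.peak_le hσ h)⟩
  | putN A idx e =>
    intro ω σ hσ hp
    refine ⟨⟨hσ.1, fun A' l => ?_⟩, le_rfl, max_le hp (max_le (h.1.peak_le hσ) (h.2.1.peak_le hσ))⟩
    simp only [Cmd.exec, State.writeNArr_narr, State.charge_narr]
    rcases eq_or_ne A' A with rfl | hA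
    · rw [Function.update_self]
      rcases eq_or_ne l (idx.eval σ) with rfl | hl
      · rw [Function.update_self]
        exact (NExp.eval_le_ub hσ e).trans h.2.2
      · rw [Function.update_of_ne hl]
        exact hσ.2 _ _
    · rw [Function.update_of_ne hA]
      exact hσ.2 _ _
  | putR A idx e =>
    exact fun ω σ hσ hp => ⟨hσ, le_rfl, max_le hp (max_le (h.1.peak_le hσ) (h.2.peak_le hσ))⟩
  | rand r => exact fun ω σ hσ hp => ⟨hσ, le_rfl, max_le hp (Nat.zero_le _)⟩
  | seq c d hc hd => exact (hc h.1).seq (hd h.2)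
  | ifN e f c d hc hd =>
    intro ω σ hσ hp
    have hp' := max_le hp (max_le (h.1.1.peak_le hσ) (h.1.2.peak_le hσ))
    have h1 := hc h.2.1 ω (σ.charge (e.cost + f.cost + 1) (e.cells σ ∪ f.cells σ) _) hσ hp'
    have h2 := hd h.2.2 ω (σ.charge (e.cost + f.cost + 1) (e.cells σ ∪ f.cells σ) _) hσ hp'
    simp only [Cmd.exec, Cmd.time]
    simp only [State.charge_steps] at h1 h2
    split_ifs
    · exact ⟨h1.1, by omega, h1.2.2⟩
    · exact ⟨h2.1, by omega, h2.2.2⟩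
  | ifR e f c d hc hd =>
    intro ω σ hσ hp
    have hp' := max_le hp (max_le (h.1.1.peak_le hσ) (h.1.2.peak_le hσ))
    have h1 := hc h.2.1 ω (σ.charge (e.cost + f.cost + 1) (e.cells σ ∪ f.cells σ) _) hσ hp'
    have h2 := hd h.2.2 ω (σ.charge (e.cost + f.cost + 1) (e.cells σ ∪ f.cells σ) _) hσ hp'
    simp only [Cmd.exec, Cmd.time]
    simp only [State.charge_steps] at h1 h2
    split_ifs
    · exact ⟨h1.1, by omega, h1.2.2⟩
    · exact ⟨h2.1, by omega, h2.2.2⟩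
  | loop r e c hc => exact Cmd.Bounded.loop h.1 h.2.1 (hc h.2.2)

end Resources

/-! ### The accessed cells -/

/-- The numbers of all arrays that occur in the expression. -/
def NExp.arrays : NExp → List ℕ
  | .lit _ => []
  | .var _ => []
  | .bin _ e f => e.arrays ++ f.arrays
  | .get A e => A :: e.arrays

/-- The numbers of all arrays, of natural numbers or of reals, that occur in the expression. -/
def RExp.arrays : RExp → List ℕ
  | .var _ => []
  | .ofNat e => e.arrays
  | .pi => []
  | .bin _ e f => e.arrays ++ f.arrays
  | .fn _ e => e.arrays
  | .get A e => A :: e.arrays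

/-- The numbers of all arrays, of natural numbers or of reals, that occur in the program. -/
def Cmd.arrays : Cmd → List ℕ
  | .skip => []
  | .setN _ e => e.arrays
  | .setR _ e => e.arrays
  | .putN A idx e => A :: (idx.arrays ++ e.arrays)
  | .putR A idx e => A :: (idx.arrays ++ e.arrays)
  | .rand _ => []
  | .seq c d => c.arrays ++ d.arrays
  | .ifN e f c d => e.arrays ++ f.arrays ++ (c.arrays ++ d.arrays)
  | .ifR e f c d => e.arrays ++ f.arrays ++ (c.arrays ++ d.arrays)
  | .loop _ e c => e.arrays ++ c.arrays

/-- The first `v + 1` cells of the first `K` arrays of either kind. -/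
def cellBox (K v : ℕ) : Finset ((ℕ × ℕ) ⊕ (ℕ × ℕ)) :=
  (Finset.range K ×ˢ Finset.range (v + 1)).disjSum (Finset.range K ×ˢ Finset.range (v + 1))

lemma card_cellBox (K v : ℕ) : (cellBox K v).card = 2 * (K * (v + 1)) := by
  simp [cellBox, two_mul]

lemma cellBox_mono {K v w : ℕ} (h : v ≤ w) : cellBox K v ⊆ cellBox K w := by
  have : Finset.range (v + 1) ⊆ Finset.range (w + 1) := by simpa using h
  exact Finset.disjSum_mono (Finset.product_subset_product_right this)
    (Finset.product_subset_product_right this)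

lemma NExp.eval_le_peak (σ : State) (e : NExp) : e.eval σ ≤ e.peak σ := by
  rcases e with _ | _ | _ | _ <;> simp [NExp.eval, NExp.peak]

lemma NExp.cells_subset {K : ℕ} (σ : State) {e : NExp} (h : ∀ A ∈ e.arrays, A < K) :
    e.cells σ ⊆ cellBox K (e.peak σ) := by
  induction e with
  | lit c => simp [NExp.cells]
  | var r => simp [NExp.cells]
  | bin op e f he hf =>
    simp only [NExp.arrays, List.mem_append] at h
    exact Finset.union_subset
      ((he fun A hA => h A (.inl hA)).trans (cellBox_mono (by simp [NExp.peak])))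
      ((hf fun A hA => h A (.inr hA)).trans (cellBox_mono (by simp [NExp.peak])))
  | get A e he =>
    simp only [NExp.arrays, List.mem_cons] at h
    refine Finset.insert_subset ?_
      ((he fun A hA => h A (.inr hA)).trans (cellBox_mono (by simp [NExp.peak])))
    have := NExp.eval_le_peak σ e
    simp [cellBox, h A (.inl rfl), NExp.peak]
    omega

lemma RExp.cells_subset {K : ℕ} (σ : State) {e : RExp} (h : ∀ A ∈ e.arrays, A < K) :
    e.cells σ ⊆ cellBox K (e.peak σ) := by
  induction e with
  | var r => simp [RExp.cells]
  | ofNat e => exact NExp.cells_subset σ h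
  | pi => simp [RExp.cells]
  | bin op e f he hf =>
    simp only [RExp.arrays, List.mem_append] at h
    exact Finset.union_subset
      ((he fun A hA => h A (.inl hA)).trans (cellBox_mono (by simp [RExp.peak])))
      ((hf fun A hA => h A (.inr hA)).trans (cellBox_mono (by simp [RExp.peak])))
  | fn f e he => exact he h
  | get A e =>
    simp only [RExp.arrays, List.mem_cons] at h
    refine Finset.insert_subset ?_ (NExp.cells_subset σ fun A hA => h A (.inr hA))
    have := NExp.eval_le_peak σ e
    simp [cellBox, h A (.inl rfl), RExp.peak]
    omega

/-- An address is a computed number, so the accessed cells are bounded by the largest number. -/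
theorem Cmd.cells_subset {K : ℕ} {c : Cmd} (h : ∀ A ∈ c.arrays, A < K) {σ : State}
    (hσ : σ.cells ⊆ cellBox K σ.peak) :
    (c.exec ω σ).cells ⊆ cellBox K (c.exec ω σ).peak := by
  have chg : ∀ (σ : State) t S v, σ.cells ⊆ cellBox K σ.peak → S ⊆ cellBox K v →
      (σ.charge t S v).cells ⊆ cellBox K (σ.charge t S v).peak := by
    intro σ t S v h1 h2
    exact Finset.union_subset (h1.trans (cellBox_mono (le_max_left _ _)))
      (h2.trans (cellBox_mono (le_max_right _ _)))
  have un : ∀ {S T : Finset ((ℕ × ℕ) ⊕ (ℕ × ℕ))} {v w : ℕ}, S ⊆ cellBox K v → T ⊆ cellBox K w →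
      S ∪ T ⊆ cellBox K (max v w) := fun h1 h2 =>
    Finset.union_subset (h1.trans (cellBox_mono (le_max_left _ _)))
      (h2.trans (cellBox_mono (le_max_right _ _)))
  induction c generalizing σ with
  | skip => exact hσ
  | setN r e => exact chg _ (e.cost + 1) _ _ hσ (NExp.cells_subset σ h)
  | setR r e => exact chg _ (e.cost + 1) _ _ hσ (RExp.cells_subset σ h)
  | putN A idx e =>
    simp only [Cmd.arrays, List.mem_cons, List.mem_append] at h
    refine chg _ (idx.cost + e.cost + 1) _ _ hσ (Finset.insert_subset ?_ (un
      (NExp.cells_subset σ fun A hA => h A (.inr (.inl hA)))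
      (NExp.cells_subset σ fun A hA => h A (.inr (.inr hA)))))
    have := NExp.eval_le_peak σ idx
    simp [cellBox, h A (.inl rfl)]
    omega
  | putR A idx e =>
    simp only [Cmd.arrays, List.mem_cons, List.mem_append] at h
    refine chg _ (idx.cost + e.cost + 1) _ _ hσ (Finset.insert_subset ?_ (un
      (NExp.cells_subset σ fun A hA => h A (.inr (.inl hA)))
      (RExp.cells_subset σ fun A hA => h A (.inr (.inr hA)))))
    have := NExp.eval_le_peak σ idx
    simp [cellBox, h A (.inl rfl)]
    omega
  | rand r => exact chg _ 1 ∅ 0 hσ (by simp)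
  | seq c d hc hd =>
    simp only [Cmd.arrays, List.mem_append] at h
    exact hd (fun A hA => h A (.inr hA)) (hc (fun A hA => h A (.inl hA)) hσ)
  | ifN e f c d hc hd =>
    simp only [Cmd.arrays, List.mem_append] at h
    have h0 := chg σ (e.cost + f.cost + 1) _ _ hσ (un
      (NExp.cells_subset σ fun A hA => h A (.inl (.inl hA)))
      (NExp.cells_subset σ fun A hA => h A (.inl (.inr hA))))
    simp only [Cmd.exec]
    split_ifs
    · exact hc (fun A hA => h A (.inr (.inl hA))) h0
    · exact hd (fun A hA => h A (.inr (.inr hA))) h0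
  | ifR e f c d hc hd =>
    simp only [Cmd.arrays, List.mem_append] at h
    have h0 := chg σ (e.cost + f.cost + 1) _ _ hσ (un
      (RExp.cells_subset σ fun A hA => h A (.inl (.inl hA)))
      (RExp.cells_subset σ fun A hA => h A (.inl (.inr hA))))
    simp only [Cmd.exec]
    split_ifs
    · exact hc (fun A hA => h A (.inr (.inl hA))) h0
    · exact hd (fun A hA => h A (.inr (.inr hA))) h0
  | loop r e c hc =>
    simp only [Cmd.arrays, List.mem_append] at h
    refine exec_loop_induction (k := e.eval σ) rfl (fun _ τ => τ.cells ⊆ cellBox K τ.peak)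
      (chg _ (e.cost + 1) _ _ hσ (NExp.cells_subset σ fun A hA => h A (.inl hA))) fun v _ τ hτ => ?_
    exact hc (fun A hA => h A (.inr hA)) (chg _ 1 ∅ v hτ (by simp))

end

section

/-! ### The fast Fourier transform -/

/-- The values in memory after `v` of the `k` stages of the fast Fourier transform of
`z 0, …, z (2 ^ k - 1)` in the self-sorting arrangement of Stockham, with `ζ` as root of unity. After
stage `v`, cell `R * q + r`, where `R = 2 ^ (k - v)` and `r < R`, holds entry `q` of the Fourier
transform of length `2 ^ v` of the subsequence `z r, z (r + R), z (r + 2 * R), …`. -/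
def stockham (z : ℕ → ℂ) (ζ : ℂ) (k : ℕ) : ℕ → ℕ → ℂ
  | 0, a => z a
  | v + 1, a =>
      stockham z ζ k v
          (2 * (a - a % 2 ^ (k - (v + 1))) % 2 ^ k + a % 2 ^ (k - (v + 1))) +
        ζ ^ (a - a % 2 ^ (k - (v + 1))) * stockham z ζ k v
          (2 * (a - a % 2 ^ (k - (v + 1))) % 2 ^ k + a % 2 ^ (k - (v + 1)) + 2 ^ (k - (v + 1)))

lemma sum_range_two_mul (f : ℕ → ℂ) (L : ℕ) :
    ∑ l ∈ Finset.range (2 * L), f l = ∑ l ∈ Finset.range L, (f (2 * l) + f (2 * l + 1)) := by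
  induction L with
  | zero => simp
  | succ L ih =>
    rw [show 2 * (L + 1) = 2 * L + 1 + 1 by ring, Finset.sum_range_succ, Finset.sum_range_succ, ih,
      Finset.sum_range_succ]
    ring

lemma pow_mod_of_pow_eq_one {ζ : ℂ} {R L : ℕ} (hζ : ζ ^ (R * L) = 1) (q l : ℕ) :
    ζ ^ (R * (q % L) * l) = ζ ^ (R * q * l) := by
  conv_rhs => rw [← Nat.mod_add_div q L]
  rw [show R * (q % L + L * (q / L)) * l = R * (q % L) * l + (R * L) * (q / L * l) by ring, pow_add,
    pow_mul ζ (R * L), hζ, one_pow, mul_one]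

lemma stockham_eq (z : ℕ → ℂ) {ζ : ℂ} {k : ℕ} (hζ : ζ ^ 2 ^ k = 1) {v : ℕ} (hv : v ≤ k) :
    ∀ q < 2 ^ v, ∀ r < 2 ^ (k - v), stockham z ζ k v (2 ^ (k - v) * q + r) =
      ∑ l ∈ Finset.range (2 ^ v), z (r + 2 ^ (k - v) * l) * ζ ^ (2 ^ (k - v) * q * l) := by
  induction v with
  | zero => intro q hq r hr; simp at hq; simp [stockham, hq]
  | succ v ih =>
    intro q hq r hr
    have hR : 2 ^ (k - v) = 2 * 2 ^ (k - (v + 1)) := by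
      rw [← pow_succ']; congr 1; omega
    have hP : 2 ^ k = 2 ^ (k - v) * 2 ^ v := by rw [← pow_add]; congr 1; omega
    have ih := ih (by omega)
    simp only [stockham]
    rw [hR] at ih
    rw [hP, hR] at hζ ⊢
    set h := 2 ^ (k - (v + 1)) with hh
    set L := 2 ^ v with hL
    have hmod : (h * q + r) % h = r := by rw [Nat.mul_add_mod, Nat.mod_eq_of_lt hr]
    have hLpos : 0 < L := by positivity
    have hq' : q % L < L := Nat.mod_lt _ hLpos
    rw [hmod, Nat.add_sub_cancel, ← mul_assoc, Nat.mul_mod_mul_left, add_assoc,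
      ih _ hq' r (by omega), ih _ hq' (r + h) (by omega), pow_succ', ← hL, sum_range_two_mul,
      Finset.mul_sum, ← Finset.sum_add_distrib]
    refine Finset.sum_congr rfl fun l _ => ?_
    rw [pow_mod_of_pow_eq_one hζ]
    rw [show r + h + 2 * h * l = r + h * (2 * l + 1) by ring,
      show r + 2 * h * l = r + h * (2 * l) by ring,
      show h * q * (2 * l + 1) = h * q + 2 * h * q * l by ring, pow_add,
      show h * q * (2 * l) = 2 * h * q * l by ring]
    ring

/-- All stages together compute the discrete Fourier transform. -/
theorem stockham_last (z : ℕ → ℂ) {ζ : ℂ} {k : ℕ} (hζ : ζ ^ 2 ^ k = 1) {a : ℕ} (ha : a < 2 ^ k) :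
    stockham z ζ k k a = ∑ l ∈ Finset.range (2 ^ k), z l * ζ ^ (a * l) := by
  simpa using stockham_eq z hζ le_rfl a ha 0 (by simp)

lemma sum_pow_of_isPrimitiveRoot {ζ : ℂ} {P : ℕ} (hζ : IsPrimitiveRoot ζ P) (e : ℕ) :
    ∑ a ∈ Finset.range P, ζ ^ (a * e) = if P ∣ e then (P : ℂ) else 0 := by
  split_ifs with h
  · obtain ⟨d, rfl⟩ := h
    have : ∀ a, ζ ^ (a * (P * d)) = 1 := fun a => by
      rw [show a * (P * d) = P * (a * d) by ring, pow_mul, hζ.pow_eq_one, one_pow]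
    simp [this]
  · have h1 : ζ ^ e - 1 ≠ 0 := sub_ne_zero.2 fun h' => h ((hζ.pow_eq_one_iff_dvd e).1 h')
    have h2 := mul_geom_sum (ζ ^ e) P
    rw [← pow_mul, mul_comm e P, pow_mul, hζ.pow_eq_one, one_pow, sub_self] at h2
    rw [← (mul_eq_zero.1 h2).resolve_left h1]
    exact Finset.sum_congr rfl fun a _ => by rw [← pow_mul, mul_comm]

/-- The Fourier transform of the square of the Fourier transform of `z` contains, in reverse order,
the products of the convolution of `z` with itself. There is no wrap-around if `z` vanishes outside
`0, …, n` and `2 * n < P`. -/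
lemma dft_sq_dft {ζ : ℂ} {P n : ℕ} (hζ : IsPrimitiveRoot ζ P) (hP : 2 * n < P) (z : ℕ → ℂ)
    (hz : ∀ l, n < l → z l = 0) {i : ℕ} (hi : i ≤ n) :
    ∑ a ∈ Finset.range P, (∑ l ∈ Finset.range P, z l * ζ ^ (a * l)) ^ 2 *
        ζ ^ ((P - i) % P * a) =
      P * ∑ l ∈ Finset.range (i + 1), z l * z (i - l) := by
  have hpow : ∀ a, ζ ^ ((P - i) % P * a) = ζ ^ (a * (P - i)) := by
    intro a
    have := pow_mod_of_pow_eq_one (R := 1) (L := P) (by simpa using hζ.pow_eq_one) (P - i) a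
    rwa [one_mul, one_mul, mul_comm (P - i)] at this
  calc _ = ∑ a ∈ Finset.range P, ∑ l ∈ Finset.range P, ∑ l' ∈ Finset.range P,
        z l * z l' * ζ ^ (a * (l + l' + (P - i))) := by
        refine Finset.sum_congr rfl fun a _ => ?_
        rw [sq, Finset.sum_mul_sum, Finset.sum_mul, hpow]
        refine Finset.sum_congr rfl fun l _ => ?_
        rw [Finset.sum_mul]
        refine Finset.sum_congr rfl fun l' _ => ?_
        rw [mul_add, mul_add, pow_add, pow_add]; ring
    _ = ∑ l ∈ Finset.range P, ∑ l' ∈ Finset.range P,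
        z l * z l' * (if P ∣ l + l' + (P - i) then (P : ℂ) else 0) := by
        rw [Finset.sum_comm]
        refine Finset.sum_congr rfl fun l _ => ?_
        rw [Finset.sum_comm]
        refine Finset.sum_congr rfl fun l' _ => ?_
        rw [← Finset.mul_sum, sum_pow_of_isPrimitiveRoot hζ]
    _ = ∑ l ∈ Finset.range P, if l < i + 1 then (P : ℂ) * (z l * z (i - l)) else 0 := by
        refine Finset.sum_congr rfl fun l _ => ?_
        -- among the pairs with `l, l' ≤ n`, only those with `l + l' = i` contribute
        have hdvd : ∀ l', l ≤ n → l' ≤ n → (P ∣ l + l' + (P - i) ↔ l + l' = i) := by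
          intro l' h1 h2
          constructor
          · rintro ⟨d, hd⟩
            rcases d with _ | _ | d
            · omega
            · omega
            · have : P * (d + 1 + 1) = P * d + 2 * P := by ring
              have : 0 ≤ P * d := Nat.zero_le _
              omega
          · intro h
            rw [h, Nat.add_sub_cancel' (by omega)]
        rcases le_or_gt l n with hl | hl
        swap
        · rw [if_neg (by omega)]
          exact Finset.sum_eq_zero fun l' _ => by rw [hz l hl]; ring
        split_ifs with hli
        · rw [Finset.sum_eq_single (i - l)]
          · rw [if_pos ((hdvd _ hl (by omega)).2 (by omega))]; ring
          · intro l' _ hne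
            rcases le_or_gt l' n with hl' | hl'
            · rw [if_neg fun h => hne (by have := (hdvd _ hl hl').1 h; omega), mul_zero]
            · rw [hz l' hl']; ring
          · intro h; exact absurd (Finset.mem_range.2 (by omega)) h
        · refine Finset.sum_eq_zero fun l' _ => ?_
          rcases le_or_gt l' n with hl' | hl'
          · rw [if_neg fun h => hli (by have := (hdvd _ hl hl').1 h; omega), mul_zero]
          · rw [hz l' hl']; ring
    _ = _ := by
        rw [← Finset.sum_filter, Finset.mul_sum]
        refine Finset.sum_congr ?_ fun _ _ => rfl
        ext l; simp; omega

/-- With the factors of a convolution as real and imaginary part of `z`, the convolution is half of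
the imaginary part of the convolution of `z` with itself. -/
lemma im_sum_mul_reflect (u w : ℕ → ℝ) (i : ℕ) :
    (∑ l ∈ Finset.range (i + 1), (⟨u l, w l⟩ : ℂ) * ⟨u (i - l), w (i - l)⟩).im =
      2 * ∑ l ∈ Finset.range (i + 1), u l * w (i - l) := by
  have h : ∑ l ∈ Finset.range (i + 1), w l * u (i - l) =
      ∑ l ∈ Finset.range (i + 1), u l * w (i - l) := by
    rw [← Finset.sum_range_reflect]
    refine Finset.sum_congr rfl fun l hl => ?_
    have : i - (i - l) = l := by have := Finset.mem_range.1 hl; omega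
    simp only [Nat.add_sub_cancel]
    rw [this, mul_comm]
  rw [Complex.im_sum, two_mul]
  nth_rw 2 [← h]
  rw [← Finset.sum_add_distrib]
  exact Finset.sum_congr rfl fun l _ => by simp [Complex.mul_im]

/-! ### A subroutine for the Toeplitz product -/

namespace Prog

/-! Registers of the subroutine: the length `2 ^ k` of the Fourier transform, its logarithm `k`, the
power of two that belongs to the current stage, and two loop variables. -/

def rsize : ℕ := 16
def rlog : ℕ := 17
def rhalf : ℕ := 18
def rcell : ℕ := 19
def rstage : ℕ := 20

/-! Arrays of the subroutine: real and imaginary part, and space for their new values. -/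

def re : ℕ := 16
def im : ℕ := 17
def newRe : ℕ := 18
def newIm : ℕ := 19

/-- The least power of two above `2 * n + 1`, and its logarithm. -/
def fftSize : Cmd := block [
  .setN rsize 1,
  .setN rlog 0,
  .loop rcell (2 * N + 2) (.ifN (.var rsize) (2 * N + 2)
    (.seq (.setN rsize (2 * .var rsize)) (.setN rlog (.var rlog + 1)))
    .skip)]

/-- Simultaneous assignment of new values to all cells of `re` and `im`. -/
def assign (F G : RExp) : Cmd := block [
  .loop rcell (.var rsize) (.putR newRe (.var rcell) F),
  .loop rcell (.var rsize) (.putR newIm (.var rcell) G),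
  .loop rcell (.var rsize) (.putR re (.var rcell) (.get newRe (.var rcell))),
  .loop rcell (.var rsize) (.putR im (.var rcell) (.get newIm (.var rcell)))]

/-- The residue of the current cell modulo `rhalf`. -/
def low : NExp := .bin .mod (.var rcell) (.var rhalf)

/-- The exponent of the twiddle factor of the current cell. -/
def high : NExp := .var rcell - low

/-- The first of the two cells that the current cell is computed from. -/
def src : NExp := .bin .mod (2 * high) (.var rsize) + low

/-- The argument of the twiddle factor. -/
def angle : RExp := 2 * .pi * .ofNat high / .ofNat (.var rsize)

/-- The real part of the new value of the current cell, in one stage of the recursion `stockham`. -/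
def stageRe : RExp := .get re src + (.fn .cos angle * .get re (src + .var rhalf) -
  .fn .sin angle * .get im (src + .var rhalf))

/-- The imaginary part of the new value. -/
def stageIm : RExp := .get im src + (.fn .cos angle * .get im (src + .var rhalf) +
  .fn .sin angle * .get re (src + .var rhalf))

/-- The fast Fourier transform, by the recursion `stockham`. -/
def fft : Cmd := .seq (.setN rhalf (.var rsize)) (.loop rstage (.var rlog) (block [
  .setN rhalf (.bin .div (.var rhalf) 2),
  assign stageRe stageIm]))

/-- The product of the lower triangular Toeplitz matrix with first column `ker` and the vector `hat`,
by two Fourier transforms of the vector `hat + i ker`. -/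
def toeplitz : Cmd := block [
  fftSize,
  assign 0 0,
  .loop rcell (N + 1) (.putR re (.var rcell) (.get hat (.var rcell))),
  .loop rcell (N + 1) (.putR im (.var rcell) (.get ker (.var rcell))),
  fft,
  assign
    (.get re (.var rcell) * .get re (.var rcell) - .get im (.var rcell) * .get im (.var rcell))
    (2 * .get re (.var rcell) * .get im (.var rcell)),
  fft,
  .loop rcell (N + 1) (.putR prod (.var rcell)
    (.get im (.bin .mod (.var rsize - .var rcell) (.var rsize)) / .ofNat (2 * .var rsize)))]

lemma isSubroutine_toeplitz : IsSubroutine toeplitz := by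
  simp [IsSubroutine, toeplitz, fft, assign, fftSize, block, Cmd.WritesOnly, rsize, rlog, rhalf, rcell,
    rstage, re, im, newRe, newIm]

section Spec

variable {ω : ℕ → unitInterval} {σ : State}

@[simp] lemma exec_block_nil : (block []).exec ω σ = σ := rfl
@[simp] lemma exec_block_cons (c : Cmd) (cs : List Cmd) :
    (block (c :: cs)).exec ω σ = (block cs).exec ω (c.exec ω σ) := rfl

@[simp] lemma eval_ofNat (c : ℕ) : NExp.eval σ (no_index (OfNat.ofNat c) : NExp) = c := rfl
@[simp] lemma eval_one : NExp.eval σ (1 : NExp) = 1 := rfl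
@[simp] lemma eval_add (e f : NExp) : NExp.eval σ (e + f) = e.eval σ + f.eval σ := rfl
@[simp] lemma eval_sub (e f : NExp) : NExp.eval σ (e - f) = e.eval σ - f.eval σ := rfl
@[simp] lemma eval_mul (e f : NExp) : NExp.eval σ (e * f) = e.eval σ * f.eval σ := rfl
@[simp] lemma eval_div (e f : NExp) : NExp.eval σ (.bin .div e f) = e.eval σ / f.eval σ := rfl
@[simp] lemma eval_mod (e f : NExp) : NExp.eval σ (.bin .mod e f) = e.eval σ % f.eval σ := rfl
@[simp] lemma eval_var (r : ℕ) : NExp.eval σ (.var r) = σ.nreg r := rfl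
@[simp] lemma eval_get (A : ℕ) (e : NExp) : NExp.eval σ (.get A e) = σ.narr A (e.eval σ) := rfl
@[simp] lemma eval_N : NExp.eval σ N = σ.nreg rn := rfl
@[simp] lemma eval_M : NExp.eval σ M = σ.nreg rm := rfl
@[simp] lemma eval_I : NExp.eval σ I = σ.nreg ri := rfl
@[simp] lemma eval_J : NExp.eval σ J = σ.nreg rj := rfl
@[simp] lemma eval_K : NExp.eval σ K = σ.nreg rk := rfl
@[simp] lemma eval_L : NExp.eval σ L = σ.nreg rl := rfl

@[simp] lemma reval_ofNat (c : ℕ) : RExp.eval σ (no_index (OfNat.ofNat c) : RExp) = c := rfl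
@[simp] lemma reval_zero : RExp.eval σ (0 : RExp) = 0 := Nat.cast_zero
@[simp] lemma reval_cast (e : NExp) : RExp.eval σ (.ofNat e) = e.eval σ := rfl
@[simp] lemma reval_pi : RExp.eval σ .pi = Real.pi := rfl
@[simp] lemma reval_add (e f : RExp) : RExp.eval σ (e + f) = e.eval σ + f.eval σ := rfl
@[simp] lemma reval_sub (e f : RExp) : RExp.eval σ (e - f) = e.eval σ - f.eval σ := rfl
@[simp] lemma reval_mul (e f : RExp) : RExp.eval σ (e * f) = e.eval σ * f.eval σ := rfl
@[simp] lemma reval_div (e f : RExp) : RExp.eval σ (e / f) = e.eval σ / f.eval σ := rfl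
@[simp] lemma reval_var (r : ℕ) : RExp.eval σ (.var r) = σ.rreg r := rfl
@[simp] lemma reval_get (A : ℕ) (e : NExp) : RExp.eval σ (.get A e) = σ.rarr A (e.eval σ) := rfl
@[simp] lemma reval_abs (e : RExp) : RExp.eval σ (.fn .abs e) = |e.eval σ| := rfl
@[simp] lemma reval_exp (e : RExp) : RExp.eval σ (.fn .exp e) = Real.exp (e.eval σ) := rfl
@[simp] lemma reval_cos (e : RExp) : RExp.eval σ (.fn .cos e) = Real.cos (e.eval σ) := rfl
@[simp] lemma reval_sin (e : RExp) : RExp.eval σ (.fn .sin e) = Real.sin (e.eval σ) := rfl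

lemma assign_writesOnly (F G : RExp) :
    (assign F G).WritesOnly {rcell} ∅ ∅ {newRe, newIm, re, im} := by
  simp [assign, block, Cmd.WritesOnly]

lemma exec_assign {F G : RExp} (f g : ℕ → ℝ)
    (h : ∀ v < σ.nreg rsize, ∀ τ, Agrees {rcell} ∅ ∅ {newRe, newIm} σ τ → τ.nreg rcell = v →
      F.eval τ = f v ∧ G.eval τ = g v) :
    ∀ v < σ.nreg rsize, ((assign F G).exec ω σ).rarr re v = f v ∧
      ((assign F G).exec ω σ).rarr im v = g v := by
  simp only [assign, exec_block_cons, exec_block_nil]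
  have fill : ∀ (σ : State) (A : ℕ) (E : RExp) (f : ℕ → ℝ),
      (∀ v < σ.nreg rsize, ∀ τ, Agrees {rcell} ∅ ∅ {A} σ τ → τ.nreg rcell = v → E.eval τ = f v) →
      Agrees {rcell} ∅ ∅ {A} σ
          ((Cmd.loop rcell (.var rsize) (.putR A (.var rcell) E)).exec ω σ) ∧
        ∀ v < σ.nreg rsize,
          ((Cmd.loop rcell (.var rsize) (.putR A (.var rcell) E)).exec ω σ).rarr A v = f v := by
    intro σ A E f h
    refine ⟨Cmd.WritesOnly.agrees (by simp [Cmd.WritesOnly]) σ, ?_⟩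
    refine (exec_loop_fill (k := σ.nreg rsize) (by simp) id f {rcell} ∅ (by simp)
      (by simp [Cmd.WritesOnly]) (fun _ _ _ _ h => h) ?_).1
    intro v hv τ hτ hr _
    simp [Cmd.exec, hr, h v hv τ hτ hr]
  obtain ⟨a1, f1⟩ := fill σ newRe F f fun v hv τ hτ hr =>
    (h v hv τ (hτ.mono le_rfl le_rfl le_rfl (by simp)) hr).1
  set σ1 := (Cmd.loop rcell (.var rsize) (.putR newRe (.var rcell) F)).exec ω σ
  have s1 : σ1.nreg rsize = σ.nreg rsize := a1.nreg _ (by simp [rsize, rcell])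
  obtain ⟨a2, f2⟩ := fill σ1 newIm G g fun v hv τ hτ hr =>
    (h v (s1 ▸ hv) τ (.trans (a1.mono le_rfl le_rfl le_rfl (by simp))
      (hτ.mono le_rfl le_rfl le_rfl (by simp))) hr).2
  set σ2 := (Cmd.loop rcell (.var rsize) (.putR newIm (.var rcell) G)).exec ω σ1
  have s2 : σ2.nreg rsize = σ.nreg rsize := (a2.nreg _ (by simp [rsize, rcell])).trans s1
  obtain ⟨a3, f3⟩ := fill σ2 re (.get newRe (.var rcell)) (σ2.rarr newRe)
    fun v hv τ hτ hr => by simp [hr, hτ.rarr newRe (by simp [newRe, re])]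
  set σ3 := (Cmd.loop rcell (.var rsize) (.putR re (.var rcell) (.get newRe (.var rcell)))).exec ω σ2
  have s3 : σ3.nreg rsize = σ.nreg rsize := (a3.nreg _ (by simp [rsize, rcell])).trans s2
  obtain ⟨a4, f4⟩ := fill σ3 im (.get newIm (.var rcell)) (σ3.rarr newIm)
    fun v hv τ hτ hr => by simp [hr, hτ.rarr newIm (by simp [newIm, im])]
  rw [s1] at f2
  rw [s2] at f3
  rw [s3] at f4
  intro v hv
  constructor
  · rw [a4.rarr re (by simp [re, im]), f3 v hv, a2.rarr newRe (by simp [newRe, newIm]), f1 v hv]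
  · rw [f4 v hv, a3.rarr newIm (by simp [newIm, re]), f2 v hv]

/-- The root of unity that belongs to the cosines and sines of the program. -/
def unity (P : ℕ) : ℂ := Complex.exp (2 * Real.pi * Complex.I / P)

lemma unity_pow (P e : ℕ) : unity P ^ e =
    ⟨Real.cos (2 * Real.pi * e / P), Real.sin (2 * Real.pi * e / P)⟩ := by
  have : unity P ^ e = Complex.exp ((2 * Real.pi * e / P : ℝ) * Complex.I) := by
    rw [unity, ← Complex.exp_nat_mul]
    congr 1
    push_cast
    ring
  rw [this, Complex.exp_mul_I]
  apply Complex.ext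
  · simp [← Complex.ofReal_cos, ← Complex.ofReal_sin, -Complex.ofReal_div, -Complex.ofReal_mul]
  · simp [← Complex.ofReal_cos, ← Complex.ofReal_sin, -Complex.ofReal_div, -Complex.ofReal_mul]

/-- The content of cell `a` of `re` and `im` as a complex number. -/
def complexAt (σ : State) (a : ℕ) : ℂ := ⟨σ.rarr re a, σ.rarr im a⟩

lemma fft_writesOnly : fft.WritesOnly {rcell, rstage, rhalf} ∅ ∅ {newRe, newIm, re, im} := by
  simp [fft, assign, block, Cmd.WritesOnly]

lemma exec_fft {k : ℕ} (hP : σ.nreg rsize = 2 ^ k) (hk : σ.nreg rlog = k) (z : ℕ → ℂ)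
    (hz : ∀ a < 2 ^ k, complexAt σ a = z a) {a : ℕ} (ha : a < 2 ^ k) :
    complexAt (fft.exec ω σ) a = ∑ l ∈ Finset.range (2 ^ k), z l * unity (2 ^ k) ^ (a * l) := by
  have hroot : unity (2 ^ k) ^ 2 ^ k = 1 :=
    (Complex.isPrimitiveRoot_exp (2 ^ k) (by positivity)).pow_eq_one
  rw [← stockham_last z hroot ha]
  have := exec_loop_induction (ω := ω) (r := rstage) (e := .var rlog) (k := k)
    (c := block [.setN rhalf (.bin .div (.var rhalf) 2), assign stageRe stageIm])
    (σ := (Cmd.setN rhalf (.var rsize)).exec ω σ) (by simpa [Cmd.exec, rlog, rhalf] using hk)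
    (fun v τ => τ.nreg rsize = 2 ^ k ∧ τ.nreg rhalf = 2 ^ (k - v) ∧
      ∀ a < 2 ^ k, complexAt τ a = stockham z (unity (2 ^ k)) k v a)
    ⟨by simpa [Cmd.exec, rsize, rhalf] using hP, by simpa [Cmd.exec] using hP, hz⟩ ?_
  · exact this.2.2 a ha
  · rintro v hv τ ⟨h1, h2, h3⟩
    simp only [exec_block_cons, exec_block_nil]
    set τ' := (Cmd.setN rhalf (.bin .div (.var rhalf) 2)).exec ω (τ.enter rstage v) with hτ'
    have e1 : τ'.nreg rsize = 2 ^ k := by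
      simpa [hτ', Cmd.exec, rsize, rhalf, rstage] using h1
    have e2 : τ'.nreg rhalf = 2 ^ (k - (v + 1)) := by
      have : 2 ^ (k - v) = 2 ^ (k - (v + 1)) * 2 := by rw [← pow_succ]; congr 1; omega
      simp [hτ', Cmd.exec, rhalf, rstage] at h2 ⊢
      rw [h2, this, Nat.mul_div_cancel _ (by norm_num)]
    have e3 : ∀ a < 2 ^ k, complexAt τ' a = stockham z (unity (2 ^ k)) k v a := h3
    refine ⟨?_, ?_, ?_⟩
    · rw [((assign_writesOnly _ _).agrees τ').nreg _ (by simp [rsize, rcell]), e1]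
    · rw [((assign_writesOnly _ _).agrees τ').nreg _ (by simp [rhalf, rcell]), e2]
    · intro a ha
      have key := exec_assign (ω := ω) (σ := τ') (F := stageRe) (G := stageIm)
        (fun a => (stockham z (unity (2 ^ k)) k (v + 1) a).re)
        (fun a => (stockham z (unity (2 ^ k)) k (v + 1) a).im) ?_ a (by rwa [e1])
      · exact Complex.ext key.1 key.2
      intro a ha ρ hρ hr
      rw [e1] at ha
      have g1 : ρ.nreg rsize = 2 ^ k := (hρ.nreg _ (by simp [rsize, rcell])).trans e1
      have g2 : ρ.nreg rhalf = 2 ^ (k - (v + 1)) := (hρ.nreg _ (by simp [rhalf, rcell])).trans e2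
      have g3 : ρ.rarr re = τ'.rarr re := hρ.rarr re (by simp [re, newRe, newIm])
      have g4 : ρ.rarr im = τ'.rarr im := hρ.rarr im (by simp [im, newRe, newIm])
      set h := 2 ^ (k - (v + 1)) with hh
      have hhP : 2 ^ k = 2 * h * 2 ^ v := by
        rw [hh, ← pow_succ', ← pow_add]; congr 1; omega
      have hpos : 0 < h := by positivity
      have hlow : a % h < h := Nat.mod_lt _ hpos
      have hsrc : 2 * (a - a % h) % 2 ^ k + a % h + h < 2 ^ k := by
        have e : a - a % h = h * (a / h) := by have := Nat.mod_add_div a h; omega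
        rw [e, ← mul_assoc, hhP, Nat.mul_mod_mul_left]
        have : (a / h) % 2 ^ v + 1 ≤ 2 ^ v := Nat.mod_lt _ (by positivity)
        have := Nat.mul_le_mul_left (2 * h) this
        rw [mul_add] at this
        omega
      have c1 := e3 _ (show 2 * (a - a % h) % 2 ^ k + a % h < 2 ^ k by omega)
      have c2 := e3 _ hsrc
      simp only [stockham]
      rw [← hh, ← c1, ← c2, unity_pow]
      simp only [stageRe, stageIm, src, high, low, angle, reval_add, reval_sub, reval_mul, reval_get, reval_cos,
        reval_sin, reval_div, reval_cast, reval_pi, eval_add, eval_sub, eval_mul, eval_mod, eval_var,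
        eval_ofNat, reval_ofNat, hr, g1, g2, g3, g4, complexAt, Complex.add_re, Complex.add_im,
        Complex.mul_re, Complex.mul_im]
      simp

lemma exec_fftSize {n : ℕ} (hn : σ.nreg rn = n) :
    (fftSize.exec ω σ).nreg rsize = 2 ^ Nat.clog 2 (2 * n + 2) ∧
      (fftSize.exec ω σ).nreg rlog = Nat.clog 2 (2 * n + 2) := by
  simp only [fftSize, exec_block_cons, exec_block_nil]
  have := exec_loop_induction (ω := ω) (r := rcell) (e := 2 * N + 2) (k := 2 * n + 2)
    (c := .ifN (.var rsize) (2 * N + 2)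
      (.seq (.setN rsize (2 * .var rsize)) (.setN rlog (.var rlog + 1))) .skip)
    (σ := (Cmd.setN rlog 0).exec ω ((Cmd.setN rsize 1).exec ω σ))
    (by simp [Cmd.exec, ← hn, rn, rlog, rsize])
    (fun v τ => τ.nreg rn = n ∧ τ.nreg rsize = 2 ^ min v (Nat.clog 2 (2 * n + 2)) ∧
      τ.nreg rlog = min v (Nat.clog 2 (2 * n + 2)))
    (by simp [Cmd.exec, ← hn, rn, rlog, rsize]) ?_
  · have hle : Nat.clog 2 (2 * n + 2) ≤ 2 * n + 2 :=
      (Nat.clog_le_iff_le_pow (by norm_num)).2 Nat.lt_two_pow_self.le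
    rw [min_eq_right hle] at this
    exact this.2
  · rintro v hv τ ⟨h1, h2, h3⟩
    have hlt : 2 ^ min v (Nat.clog 2 (2 * n + 2)) < 2 * n + 2 ↔ v < Nat.clog 2 (2 * n + 2) := by
      rw [← Nat.lt_clog_iff_pow_lt (by norm_num)]; simp
    have n1 : (τ.enter rcell v).nreg rn = n := by simpa [rcell, rn] using h1
    have n2 : (τ.enter rcell v).nreg rsize = 2 ^ min v (Nat.clog 2 (2 * n + 2)) := by
      simpa [rcell, rsize] using h2
    have n3 : (τ.enter rcell v).nreg rlog = min v (Nat.clog 2 (2 * n + 2)) := by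
      simpa [rcell, rlog] using h3
    simp only [Cmd.exec, eval_var, eval_add, eval_mul, eval_N, eval_ofNat, n1, n2, hlt]
    split_ifs with h
    · rw [min_eq_left (by omega)] at n2 n3
      rw [min_eq_left (show v + 1 ≤ Nat.clog 2 (2 * n + 2) by omega)]
      simp only [State.writeNReg_nreg, State.charge_nreg]
      refine ⟨?_, ?_, ?_⟩
      · simpa [rn, rlog, rsize] using n1
      · rw [Function.update_of_ne (by simp [rlog, rsize]), Function.update_self]
        simp [n2, pow_succ, mul_comm]
      · rw [Function.update_self]
        simpa [Function.update_of_ne (show rlog ≠ rsize by simp [rlog, rsize])] using n3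
    · rw [min_eq_right (by omega)] at n2 n3
      rw [min_eq_right (by omega)]
      exact ⟨n1, n2, n3⟩

/-- The subroutine multiplies any lower triangular Toeplitz matrix with any vector. -/
theorem exec_toeplitz {n : ℕ} (hn : σ.nreg rn = n) {i : ℕ} (hi : i ≤ n) :
    (toeplitz.exec ω σ).rarr prod i =
      ∑ l ∈ Finset.range (i + 1), σ.rarr hat l * σ.rarr ker (i - l) := by
  set k := Nat.clog 2 (2 * n + 2) with hk
  have hPn : 2 * n + 2 ≤ 2 ^ k := Nat.le_pow_clog (by norm_num) _
  simp only [toeplitz, exec_block_cons, exec_block_nil]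
  obtain ⟨p1, l1⟩ := exec_fftSize (ω := ω) hn
  rw [← hk] at p1 l1
  have a1 : Agrees {rcell, rsize, rlog} ∅ ∅ ∅ σ (fftSize.exec ω σ) :=
    Cmd.WritesOnly.agrees (by simp [fftSize, block, Cmd.WritesOnly]) σ
  have n1 : (fftSize.exec ω σ).nreg rn = n := (a1.nreg _ (by simp [rn, rcell, rsize, rlog])).trans hn
  have u1 : (fftSize.exec ω σ).rarr hat = σ.rarr hat := a1.rarr _ (by simp)
  have w1 : (fftSize.exec ω σ).rarr ker = σ.rarr ker := a1.rarr _ (by simp)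
  generalize fftSize.exec ω σ = σ1 at p1 l1 n1 u1 w1
  -- zeros beyond cell `n` keep the cyclic convolution from wrapping around
  have z2 := exec_assign (ω := ω) (σ := σ1) (F := 0) (G := 0) (fun _ => 0) (fun _ => 0)
    (fun v hv τ hτ hr => by simp)
  have a2 := (assign_writesOnly 0 0).agrees (ω := ω) σ1
  have n2 := (a2.nreg rn (by simp [rn, rcell])).trans n1
  have p2 := (a2.nreg rsize (by simp [rsize, rcell])).trans p1
  have l2 := (a2.nreg rlog (by simp [rlog, rcell])).trans l1
  have u2 := (a2.rarr hat (by simp [hat, re, im, newRe, newIm])).trans u1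
  have w2 := (a2.rarr ker (by simp [ker, re, im, newRe, newIm])).trans w1
  rw [p1] at z2
  generalize (assign 0 0).exec ω σ1 = σ2 at z2 n2 p2 l2 u2 w2
  -- the vector becomes the real part
  have h3 := exec_loop_fill (ω := ω) (r := rcell) (e := N + 1)
    (c := .putR re (.var rcell) (.get hat (.var rcell))) (σ := σ2) (A := re) (k := n + 1)
    (by simp [n2]) id (σ.rarr hat) {rcell} ∅ (by simp) (by simp [Cmd.WritesOnly])
    (fun _ _ _ _ h => h)
    (fun v hv τ hτ hr _ => by simp [Cmd.exec, hr, hτ.rarr hat (by simp [hat, re]), u2])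
  have a3 : Agrees {rcell} ∅ ∅ {re} σ2
      ((Cmd.loop rcell (N + 1) (.putR re (.var rcell) (.get hat (.var rcell)))).exec ω σ2) :=
    Cmd.WritesOnly.agrees (by simp [Cmd.WritesOnly]) σ2
  have n3 := (a3.nreg rn (by simp [rn, rcell])).trans n2
  have p3 := (a3.nreg rsize (by simp [rsize, rcell])).trans p2
  have l3 := (a3.nreg rlog (by simp [rlog, rcell])).trans l2
  have w3 := (a3.rarr ker (by simp [ker, re])).trans w2
  have i3 := a3.rarr im (by simp [im, re])
  generalize (Cmd.loop rcell (N + 1)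
    (.putR re (.var rcell) (.get hat (.var rcell)))).exec ω σ2 = σ3 at h3 n3 p3 l3 w3 i3
  -- the matrix becomes the imaginary part
  have h4 := exec_loop_fill (ω := ω) (r := rcell) (e := N + 1)
    (c := .putR im (.var rcell) (.get ker (.var rcell))) (σ := σ3) (A := im) (k := n + 1)
    (by simp [n3]) id (σ.rarr ker) {rcell} ∅ (by simp) (by simp [Cmd.WritesOnly])
    (fun _ _ _ _ h => h)
    (fun v hv τ hτ hr _ => by simp [Cmd.exec, hr, hτ.rarr ker (by simp [ker, im]), w3])
  have a4 : Agrees {rcell} ∅ ∅ {im} σ3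
      ((Cmd.loop rcell (N + 1) (.putR im (.var rcell) (.get ker (.var rcell)))).exec ω σ3) :=
    Cmd.WritesOnly.agrees (by simp [Cmd.WritesOnly]) σ3
  have n4 := (a4.nreg rn (by simp [rn, rcell])).trans n3
  have p4 := (a4.nreg rsize (by simp [rsize, rcell])).trans p3
  have l4 := (a4.nreg rlog (by simp [rlog, rcell])).trans l3
  have i4 := a4.rarr re (by simp [im, re])
  generalize (Cmd.loop rcell (N + 1)
    (.putR im (.var rcell) (.get ker (.var rcell)))).exec ω σ3 = σ4 at h4 n4 p4 l4 i4
  set u : ℕ → ℝ := fun l => if l ≤ n then σ.rarr hat l else 0 with hu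
  set w : ℕ → ℝ := fun l => if l ≤ n then σ.rarr ker l else 0 with hw
  have c4 : ∀ a < 2 ^ k, complexAt σ4 a = ⟨u a, w a⟩ := by
    intro a ha
    simp only [complexAt, hu, hw, i4]
    split_ifs with han
    · exact Complex.ext (h3.1 a (by omega)) (h4.1 a (by omega))
    · rw [h3.2 a (by intro v hv; simp; omega), h4.2 a (by intro v hv; simp; omega), i3,
        (z2 a ha).1, (z2 a ha).2]
  -- the transform of `hat + i ker`
  have c5 := fun a (ha : a < 2 ^ k) => exec_fft (ω := ω) p4 l4 _ c4 ha
  have a5 := fft_writesOnly.agrees (ω := ω) σ4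
  have n5 := (a5.nreg rn (by simp [rn, rcell, rstage, rhalf])).trans n4
  have p5 := (a5.nreg rsize (by simp [rsize, rcell, rstage, rhalf])).trans p4
  have l5 := (a5.nreg rlog (by simp [rlog, rcell, rstage, rhalf])).trans l4
  generalize fft.exec ω σ4 = σ5 at c5 n5 p5 l5
  -- the complex squares of the transformed values
  set F : RExp := .get re (.var rcell) * .get re (.var rcell) -
    .get im (.var rcell) * .get im (.var rcell)
  set G : RExp := 2 * .get re (.var rcell) * .get im (.var rcell)
  have c6 := exec_assign (ω := ω) (σ := σ5) (F := F) (G := G)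
    (fun a => (complexAt σ5 a ^ 2).re) (fun a => (complexAt σ5 a ^ 2).im) (by
      intro v hv τ hτ hr
      have g1 := hτ.rarr re (by simp [re, newRe, newIm])
      have g2 := hτ.rarr im (by simp [im, newRe, newIm])
      simp [F, G, hr, g1, g2, complexAt, sq]
      ring)
  have a6 := (assign_writesOnly F G).agrees (ω := ω) σ5
  have n6 := (a6.nreg rn (by simp [rn, rcell])).trans n5
  have p6 := (a6.nreg rsize (by simp [rsize, rcell])).trans p5
  have l6 := (a6.nreg rlog (by simp [rlog, rcell])).trans l5
  rw [p5] at c6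
  have c6' : ∀ a < 2 ^ k, complexAt ((assign F G).exec ω σ5) a = complexAt σ5 a ^ 2 :=
    fun a ha => Complex.ext (c6 a ha).1 (c6 a ha).2
  generalize (assign F G).exec ω σ5 = σ6 at c6' n6 p6 l6
  -- the transform of the squares, where `dft_sq_dft` finds the convolution
  have c7 := fun a (ha : a < 2 ^ k) => exec_fft (ω := ω) p6 l6 _ c6' ha
  have a7 := fft_writesOnly.agrees (ω := ω) σ6
  have n7 := (a7.nreg rn (by simp [rn, rcell, rstage, rhalf])).trans n6
  have p7 := (a7.nreg rsize (by simp [rsize, rcell, rstage, rhalf])).trans p6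
  generalize fft.exec ω σ6 = σ7 at c7 n7 p7
  have h8 := exec_loop_fill (ω := ω) (r := rcell) (e := N + 1)
    (c := .putR prod (.var rcell) (.get im (.bin .mod (.var rsize - .var rcell) (.var rsize)) /
      .ofNat (2 * .var rsize))) (σ := σ7) (A := prod) (k := n + 1)
    (by simp [n7]) id (fun v => (complexAt σ7 ((2 ^ k - v) % 2 ^ k)).im / (2 * 2 ^ k : ℝ)) {rcell} ∅
    (by simp) (by simp [Cmd.WritesOnly]) (fun _ _ _ _ h => h)
    (fun v hv τ hτ hr _ => by
      simp [Cmd.exec, hr, hτ.rarr im (by simp [im, prod]),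
        hτ.nreg rsize (by simp [rsize, rcell]), p7, complexAt])
  refine (h8.1 i (by omega)).trans ?_
  rw [c7 _ (Nat.mod_lt _ (by positivity))]
  have hroot : IsPrimitiveRoot (unity (2 ^ k)) (2 ^ k) :=
    Complex.isPrimitiveRoot_exp (2 ^ k) (by positivity)
  rw [Finset.sum_congr rfl fun a ha => by rw [c5 a (Finset.mem_range.1 ha)],
    dft_sq_dft hroot (n := n) (by omega) _
      (fun l hl => by simp [hu, hw, not_le.2 hl]; rfl) hi]
  have hre : ((2 ^ k : ℕ) : ℂ) = ((2 ^ k : ℝ) : ℂ) := by push_cast; rfl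
  rw [hre, Complex.im_ofReal_mul, im_sum_mul_reflect]
  have : (2 : ℝ) ^ k ≠ 0 := by positivity
  rw [show (2 : ℝ) ^ k * (2 * ∑ l ∈ Finset.range (i + 1), u l * w (i - l)) / (2 * 2 ^ k) =
    ∑ l ∈ Finset.range (i + 1), u l * w (i - l) by field_simp]
  refine Finset.sum_congr rfl fun l hl => ?_
  have := Finset.mem_range.1 hl
  simp only [hu, hw]
  rw [if_pos (by omega), if_pos (by omega)]

end Spec

end Prog

end

section

/-! ### The forward pass of the program -/

variable {n m : ℕ} {p : Params m} {x : Fin n → ℝ}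

lemma alpha_eq_zero : ∀ {j i k : ℕ}, j < k → alpha p x j i k = 0
  | 0, _, _, _ => by rw [alpha]
  | 1, _, k, h => by rw [alpha, if_neg (by omega)]
  | j + 2, _, 0, h => by omega
  | j + 2, _, 1, h => by omega
  | j + 2, i, k + 2, h => by rw [alpha, alpha_eq_zero (by omega)]; simp

namespace Prog

variable {ω : ℕ → unitInterval} {σ τ : State}

/-- The memory holds the parameters and the padded data, as after `setup`. -/
structure Ready (p : Params m) (x : Fin n → ℝ) (σ : State) : Prop where
  rn : σ.nreg rn = n
  rm : σ.nreg rm = m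
  reps : σ.rreg reps = p.ε
  xs : ∀ l ≤ n + 1, σ.rarr xs l = pad p.a p.b x l
  gaps : ∀ l ≤ m, σ.rarr gaps (l + 1) = gap p n (l + 1)

lemma Ready.of_agrees {N R A B : Set ℕ} (h : Ready p x σ) (ha : Agrees N R A B σ τ)
    (h1 : Prog.rn ∉ N) (h2 : Prog.rm ∉ N) (h3 : Prog.reps ∉ R) (h4 : Prog.xs ∉ B)
    (h5 : Prog.gaps ∉ B) : Ready p x τ :=
  ⟨(ha.nreg _ h1).trans h.rn, (ha.nreg _ h2).trans h.rm, (ha.rreg _ h3).trans h.reps,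
    fun l hl => by rw [ha.rarr _ h4, h.xs l hl], fun l hl => by rw [ha.rarr _ h5, h.gaps l hl]⟩

lemma Ready.eval_tauE (h : Ready p x σ) {e : NExp} {i : ℕ} (he : e.eval σ = i) (hi : i ≤ n) :
    (tauE e).eval σ = tau p x i := by
  simp [tauE, he, h.xs i (by omega), h.xs (i + 1) (by omega), tau]

lemma Ready.eval_phiE (h : Ready p x σ) {d e : NExp} {i i' j : ℕ} (hd : d.eval σ = i' - i)
    (hi : i ≤ i') (he : e.eval σ = j + 1) (hj : j ≤ m) :
    (phiE d e).eval σ = phi p n i i' (j + 1) := by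
  simp only [phiE, reval_exp, reval_mul, reval_sub, reval_div, reval_var, reval_ofNat,
    reval_abs, reval_cast, reval_get, he, hd, h.reps, h.gaps j hj, phi, if_pos hi,
    Nat.cast_sub hi]
  norm_num

lemma Ready.eval_cell (h : Ready p x σ) {e f g : NExp} {j i k : ℕ} (he : e.eval σ = j)
    (hf : f.eval σ = i) (hg : g.eval σ = k) : (cell e f g).eval σ = tabIndex n m j i k := by
  simp [cell, tabIndex, he, hf, hg, h.rn, h.rm]

lemma tabIndex_inj {j i k j' i' k' : ℕ} (hj : 1 ≤ j) (hi : i ≤ n) (hk : 1 ≤ k) (hkm : k ≤ m)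
    (hj' : 1 ≤ j') (hi' : i' ≤ n) (hk' : 1 ≤ k') (hkm' : k' ≤ m)
    (h : tabIndex n m j i k = tabIndex n m j' i' k') : j = j' ∧ i = i' ∧ k = k' := by
  have digits : ∀ {N a b a' b' : ℕ}, b < N → b' < N → a * N + b = a' * N + b' → a = a' ∧ b = b' := by
    intro N a b a' b' hb hb' h
    have h1 := congrArg (· / N) h
    have h2 := congrArg (· % N) h
    have hN : 0 < N := by omega
    simp only [mul_comm _ N, Nat.mul_add_div hN, Nat.mul_add_mod, Nat.div_eq_of_lt hb,
      Nat.div_eq_of_lt hb', Nat.mod_eq_of_lt hb, Nat.mod_eq_of_lt hb'] at h1 h2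
    exact ⟨by simpa using h1, h2⟩
  obtain ⟨h1, h2⟩ := digits (by omega) (by omega) h
  obtain ⟨h3, h4⟩ := digits (by omega) (by omega) h1
  omega

/-- Rows `1, …, j` of the table are computed, and the others are still zero. -/
def TableUpTo (p : Params m) (x : Fin n → ℝ) (j : ℕ) (σ : State) : Prop :=
  ∀ j' i k, 1 ≤ j' → i ≤ n → 1 ≤ k → k ≤ m →
    σ.rarr tab (tabIndex n m j' i k) = if j' ≤ j then alpha p x j' i k else 0

lemma exec_setup : Ready p x (setup.exec ω (init p x)) ∧
    Agrees {rl} ∅ ∅ {xs, qs, gaps} (init p x) (setup.exec ω (init p x)) := by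
  refine ⟨?_, Cmd.WritesOnly.agrees (by simp [setup, block, Cmd.WritesOnly]) _⟩
  simp only [setup, exec_block_cons, exec_block_nil]
  have a1 : Agrees {rl} ∅ ∅ {xs} (init p x) ((Cmd.putR xs 0 (.var ra)).exec ω (init p x)) :=
    Cmd.WritesOnly.agrees (by simp [Cmd.WritesOnly]) _
  have x1 : ((Cmd.putR xs 0 (.var ra)).exec ω (init p x)).rarr xs 0 = p.a := by
    simp [Cmd.exec, init]
  generalize (Cmd.putR xs 0 (.var ra)).exec ω (init p x) = σ1 at a1 x1
  have n1 : σ1.nreg rn = n := (a1.nreg rn (by simp [rn, rl])).trans (by simp [init])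
  have x2 := exec_loop_fill (ω := ω) (r := rl) (e := N) (c := .putR xs (L + 1) (.get inX L))
    (σ := σ1) (A := xs) (k := n) (by simp [n1]) (· + 1) (fun v => pad p.a p.b x (v + 1)) {rl} ∅
    (by simp) (by simp [Cmd.WritesOnly]) (fun _ _ _ _ h => by simpa using h)
    (fun v hv τ hτ hr _ => by
      simp [Cmd.exec, hr, hτ.rarr inX (by simp [inX, xs]), a1.rarr inX (by simp [inX, xs]), init,
        pad, hv])
  have a2 : Agrees {rl} ∅ ∅ {xs} σ1 ((Cmd.loop rl N (.putR xs (L + 1) (.get inX L))).exec ω σ1) :=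
    Cmd.WritesOnly.agrees (by simp [Cmd.WritesOnly]) _
  have x2' := x2.2 0 (by simp)
  generalize (Cmd.loop rl N (.putR xs (L + 1) (.get inX L))).exec ω σ1 = σ2 at x2 a2 x2'
  have a3 : Agrees {rl} ∅ ∅ {xs} σ2 ((Cmd.putR xs (N + 1) (.var rb)).exec ω σ2) :=
    Cmd.WritesOnly.agrees (by simp [Cmd.WritesOnly]) _
  have n2 : σ2.nreg rn = n := (a2.nreg rn (by simp [rn, rl])).trans n1
  have b2 : σ2.rreg rb = p.b :=
    ((a2.rreg rb (by simp)).trans (a1.rreg rb (by simp))).trans (by simp [init, rb, ra])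
  have x3 : ∀ l ≤ n + 1, ((Cmd.putR xs (N + 1) (.var rb)).exec ω σ2).rarr xs l
      = pad p.a p.b x l := by
    intro l hl
    simp only [Cmd.exec, State.writeRArr_rarr, Function.update_self, eval_add, eval_N, eval_one, n2]
    rcases eq_or_ne l (n + 1) with rfl | hne
    · simp [b2, pad]
    · rw [Function.update_of_ne hne]
      rcases l with _ | l
      · exact x2'.trans x1
      · exact x2.1 l (by omega)
  have a3' := (a1.trans a2).trans a3
  generalize (Cmd.putR xs (N + 1) (.var rb)).exec ω σ2 = σ3 at x3 a3'
  have a4 : Agrees {rl} ∅ ∅ {qs} σ3 ((Cmd.putR qs 0 0).exec ω σ3) :=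
    Cmd.WritesOnly.agrees (by simp [Cmd.WritesOnly]) _
  have q4 : ((Cmd.putR qs 0 0).exec ω σ3).rarr qs 0 = 0 := by simp [Cmd.exec]
  generalize (Cmd.putR qs 0 0).exec ω σ3 = σ4 at a4 q4
  have m4 : σ4.nreg rm = m := ((a4.nreg rm (by simp [rm, rl])).trans
    (a3'.nreg rm (by simp [rm, rl]))).trans (by simp [init, rm, rn])
  have q5 := exec_loop_fill (ω := ω) (r := rl) (e := M) (c := .putR qs (L + 1) (.get inQ L))
    (σ := σ4) (A := qs) (k := m) (by simp [m4]) (· + 1) (fun v => pad 0 1 p.q (v + 1)) {rl} ∅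
    (by simp) (by simp [Cmd.WritesOnly]) (fun _ _ _ _ h => by simpa using h)
    (fun v hv τ hτ hr _ => by
      have : (init p x).rarr inQ v = p.q ⟨v, hv⟩ := by simp [init, hv, inX, inQ]
      simp [Cmd.exec, hr, hτ.rarr inQ (by simp [inQ, qs]), a4.rarr inQ (by simp [inQ, qs]),
        a3'.rarr inQ (by simp [inQ, xs]), this, pad, hv])
  have a5 : Agrees {rl} ∅ ∅ {qs} σ4 ((Cmd.loop rl M (.putR qs (L + 1) (.get inQ L))).exec ω σ4) :=
    Cmd.WritesOnly.agrees (by simp [Cmd.WritesOnly]) _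
  have q5' := q5.2 0 (by simp)
  generalize (Cmd.loop rl M (.putR qs (L + 1) (.get inQ L))).exec ω σ4 = σ5 at q5 a5 q5'
  have a6 : Agrees {rl} ∅ ∅ {qs} σ5 ((Cmd.putR qs (M + 1) 1).exec ω σ5) :=
    Cmd.WritesOnly.agrees (by simp [Cmd.WritesOnly]) _
  have m5 : σ5.nreg rm = m := (a5.nreg rm (by simp [rm, rl])).trans m4
  have q6 : ∀ l ≤ m + 1, ((Cmd.putR qs (M + 1) 1).exec ω σ5).rarr qs l = pad 0 1 p.q l := by
    intro l hl
    simp only [Cmd.exec, State.writeRArr_rarr, Function.update_self, eval_add, eval_M, eval_one, m5]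
    rcases eq_or_ne l (m + 1) with rfl | hne
    · simp [pad]
    · rw [Function.update_of_ne hne]
      rcases l with _ | l
      · exact q5'.trans q4
      · exact q5.1 l (by omega)
  have a6' := (a4.trans a5).trans a6
  have a6'' : Agrees {rl} ∅ ∅ {xs, qs} (init p x) ((Cmd.putR qs (M + 1) 1).exec ω σ5) :=
    (a3'.mono le_rfl le_rfl le_rfl (by simp)).trans (a6'.mono le_rfl le_rfl le_rfl (by simp))
  generalize (Cmd.putR qs (M + 1) 1).exec ω σ5 = σ6 at q6 a6' a6''
  have n6 : σ6.nreg rn = n := (a6''.nreg rn (by simp [rn, rl])).trans (by simp [init])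
  have m6 : σ6.nreg rm = m := (a6''.nreg rm (by simp [rm, rl])).trans (by simp [init, rm, rn])
  have g7 := exec_loop_fill (ω := ω) (r := rl) (e := M + 1)
    (c := .putR gaps (L + 1) ((.get qs (L + 1) - .get qs L) * .ofNat N))
    (σ := σ6) (A := gaps) (k := m + 1) (by simp [m6]) (· + 1) (fun v => gap p n (v + 1)) {rl} ∅
    (by simp) (by simp [Cmd.WritesOnly]) (fun _ _ _ _ h => by simpa using h)
    (fun v hv τ hτ hr _ => by
      simp [Cmd.exec, hr, hτ.rarr qs (by simp [gaps, qs]), q6 v (by omega), q6 (v + 1) (by omega),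
        gap, hτ.nreg rn (by simp [rn, rl]), n6])
  have a7 : Agrees {rl} ∅ ∅ {gaps} σ6 ((Cmd.loop rl (M + 1)
      (.putR gaps (L + 1) ((.get qs (L + 1) - .get qs L) * .ofNat N))).exec ω σ6) :=
    Cmd.WritesOnly.agrees (by simp [Cmd.WritesOnly]) _
  refine ⟨(a7.nreg rn (by simp [rn, rl])).trans n6, (a7.nreg rm (by simp [rm, rl])).trans m6,
    ((a7.rreg reps (by simp)).trans (a6''.rreg reps (by simp))).trans
      (by simp [init, reps, ra, rb]), fun l hl => ?_, fun l hl => g7.1 l (by omega)⟩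
  rw [a7.rarr xs (by simp [xs, gaps]), a6'.rarr xs (by simp [xs, qs]), x3 l hl]

lemma base_writesOnly : base.WritesOnly {ri} ∅ ∅ {tab} := by simp [base, Cmd.WritesOnly]

lemma exec_base (hm : 1 ≤ m) (h : Ready p x σ) (h0 : ∀ l, σ.rarr tab l = 0) :
    TableUpTo p x 1 (base.exec ω σ) := by
  obtain ⟨h1, h2⟩ := exec_loop_fill (ω := ω) (r := ri) (e := N + 1)
    (c := .putR tab (cell 1 I 1) (phiE I 1 * tauE I)) (σ := σ) (A := tab) (k := n + 1)
    (by simp [h.rn]) (fun i => tabIndex n m 1 i 1) (fun i => alpha p x 1 i 1) {ri} ∅ (by simp)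
    (by simp [Cmd.WritesOnly])
    (fun i hi i' hi' hii => (tabIndex_inj (m := m) le_rfl (Nat.lt_succ_iff.1 hi) le_rfl hm le_rfl
      (Nat.lt_succ_iff.1 hi') le_rfl hm hii).2.1)
    (fun i hi τ hτ hr _ => by
      have hR := h.of_agrees hτ (by simp [rn, ri]) (by simp [rm, ri]) (by simp) (by simp [xs, tab])
        (by simp [gaps, tab])
      simp only [Cmd.exec, State.writeRArr_rarr, State.charge_rarr, Function.update_self]
      rw [hR.eval_cell (e := 1) (f := I) (g := 1) (j := 1) (i := i) (k := 1) rfl hr rfl, reval_mul,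
        hR.eval_tauE (e := I) (i := i) hr (by omega), hR.eval_phiE (d := I) (i := 0) (i' := i) (j := 0) hr (by omega)
          rfl (by omega)]
      simp [alpha])
  intro j' i k hj' hi hk hkm
  rcases eq_or_ne j' 1 with rfl | hne
  · rcases eq_or_ne k 1 with rfl | hk1
    · rw [if_pos le_rfl]; exact h1 i (by omega)
    · rw [if_pos le_rfl, alpha_eq_zero (by omega)]
      refine (h2 _ fun v hv hv' => ?_).trans (h0 _)
      exact hk1 (tabIndex_inj le_rfl (by omega) le_rfl hm le_rfl hi hk hkm hv').2.2.symm
  · rw [if_neg (by omega)]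
    refine (h2 _ fun v hv hv' => ?_).trans (h0 _)
    exact hne (tabIndex_inj le_rfl (by omega) le_rfl hm hj' hi hk hkm hv').1.symm

/-- The registers and arrays that the forward pass changes. -/
lemma forwardRound_agrees : Agrees ({ri, rl, rk} ∪ Set.Ici 16) ({acc} ∪ Set.Ici 16) (Set.Ici 16)
    ({hat, ker, tab, prod} ∪ Set.Ici 16) σ ((forwardRound toeplitz).exec ω σ) := by
  have ht := isSubroutine_toeplitz.mono (N' := {ri, rl, rk} ∪ Set.Ici 16)
    (R' := {acc} ∪ Set.Ici 16) (A' := Set.Ici 16) (B' := {hat, ker, tab, prod} ∪ Set.Ici 16)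
    (by simp) (by simp) le_rfl (by
      rintro l (rfl | h)
      · exact .inl (by simp)
      · exact .inr h)
  refine Cmd.WritesOnly.agrees ?_ σ
  simp only [forwardRound, block, Cmd.WritesOnly, ht, true_and]
  simp

/-- The vector that the first loop of a round of the forward pass puts into `hat`. -/
lemma exec_hat {j : ℕ} (h : Ready p x σ) (hj : σ.nreg rj = j + 2) (hjm : j + 2 ≤ m)
    (ht : TableUpTo p x (j + 1) σ) : ∀ i ≤ n,
    ((Cmd.loop ri (N + 1) (block [
      .setR acc 0,
      .loop rl (J - 1) (.setR acc (.var acc + alphaE (J - 1) I (L + 1))),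
      .putR hat I (.var acc)])).exec ω σ).rarr hat i =
    ∑ k ∈ Finset.Icc 1 (j + 1), alpha p x (j + 1) i k := by
  intro i hi
  refine (exec_loop_fill (k := n + 1) (by simp [h.rn]) id
    (fun i => ∑ k ∈ Finset.Icc 1 (j + 1), alpha p x (j + 1) i k) {ri, rl} {acc} (by simp)
    (by simp [block, Cmd.WritesOnly]) (fun _ _ _ _ h => h) ?_).1 i (by omega)
  intro i hi τ hτ hr _
  simp only [exec_block_cons, exec_block_nil]
  set τ' := (Cmd.setR acc 0).exec ω τ with hτ'
  have e1 : Agrees {ri, rl} {acc} ∅ {hat} σ τ' :=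
    hτ.trans (Cmd.WritesOnly.agrees (by simp [Cmd.WritesOnly]) τ)
  have hj' : τ'.nreg rj = j + 2 := (e1.nreg rj (by simp [rj, ri, rl])).trans hj
  have hi' : τ'.nreg ri = i := hr
  have hacc : τ'.rreg acc = 0 := by simp [hτ', Cmd.exec]
  have key := exec_loop_sum (ω := ω) (r := rl) (q := acc) (e := J - 1)
    (c := .setR acc (.var acc + alphaE (J - 1) I (L + 1))) (σ := τ') (k := j + 1) (by simp [hj'])
    (fun v => alpha p x (j + 1) i (v + 1)) {rl} {acc} (by simp) (by simp [Cmd.WritesOnly])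
    (fun v hv ρ hρ hrl => by
      have g1 : Agrees {ri, rl} {acc} ∅ {hat} σ ρ :=
        e1.trans (hρ.mono (by simp) le_rfl le_rfl (by simp))
      have hR := h.of_agrees g1 (by simp [rn, ri, rl]) (by simp [rm, ri, rl])
        (by simp [reps, acc]) (by simp [xs, hat]) (by simp [gaps, hat])
      have c1 : (cell (J - 1) I (L + 1)).eval ρ = tabIndex n m (j + 1) i (v + 1) := by
        refine hR.eval_cell ?_ ?_ ?_
        · simp [hρ.nreg rj (by simp [rj, rl]), hj']
        · simp [hρ.nreg ri (by simp [ri, rl]), hi']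
        · simp [hrl]
      simp only [Cmd.exec, State.writeRReg_rreg, State.charge_rreg, Function.update_self, reval_add,
        reval_var, alphaE, reval_get, c1]
      rw [g1.rarr tab (by simp [tab, hat]), ht _ _ _ (by omega) (by omega) (by omega) (by omega),
        if_pos le_rfl])
  have g2 : Agrees {rl} {acc} ∅ ∅ τ' ((Cmd.loop rl (J - 1)
      (.setR acc (.var acc + alphaE (J - 1) I (L + 1)))).exec ω τ') :=
    Cmd.WritesOnly.agrees (by simp [Cmd.WritesOnly]) _
  generalize (Cmd.loop rl (J - 1)
    (.setR acc (.var acc + alphaE (J - 1) I (L + 1)))).exec ω τ' = ρ at key g2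
  have hρi : ρ.nreg ri = i := (g2.nreg ri (by simp [ri, rl])).trans hi'
  have hρh : ρ.rarr hat = τ.rarr hat := g2.rarr hat (by simp)
  simp only [Cmd.exec, State.writeRArr_rarr, State.charge_rarr, Function.update_self, eval_I, hρi,
    reval_var, hρh, key, hacc, zero_add, id]
  congr 1
  rw [Finset.range_eq_Ico, Finset.sum_Ico_add' (fun k => alpha p x (j + 1) i k)]
  rfl

/-- The last loop of a round of the forward pass. -/
lemma exec_repeat {j : ℕ} (h : Ready p x σ) (hj : σ.nreg rj = j + 2) (hjm : j + 2 ≤ m)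
    (ht : ∀ j' i k, 1 ≤ j' → i ≤ n → 1 ≤ k → k ≤ m → σ.rarr tab (tabIndex n m j' i k) =
      if j' ≤ j + 1 ∨ j' = j + 2 ∧ k = 1 then alpha p x j' i k else 0) :
    TableUpTo p x (j + 2) ((Cmd.loop rl (J - 1) (block [
      .setN rk (L + 2),
      .loop ri (N + 1) (.putR tab (cell J I K)
        (tauE I * phiE 0 J * alphaE (J - 1) I (K - 1) / .ofNat K))])).exec ω σ) := by
  have key := exec_loop_induction (ω := ω) (r := rl) (e := J - 1) (k := j + 1) (σ := σ)
    (c := block [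
      .setN rk (L + 2),
      .loop ri (N + 1) (.putR tab (cell J I K)
        (tauE I * phiE 0 J * alphaE (J - 1) I (K - 1) / .ofNat K))]) (by simp [hj])
    (fun v τ => Agrees {rl, ri, rk} ∅ ∅ {tab} σ τ ∧
      ∀ j' i k, 1 ≤ j' → i ≤ n → 1 ≤ k → k ≤ m → τ.rarr tab (tabIndex n m j' i k) =
        if j' ≤ j + 1 ∨ j' = j + 2 ∧ k ≤ v + 1 then alpha p x j' i k else 0)
    ⟨Agrees.charge .refl, fun j' i k h1 h2 h3 h4 => by
      simp only [State.charge_rarr, ht j' i k h1 h2 h3 h4]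
      congr 1
      simp only [eq_iff_iff]; omega⟩ ?_
  · intro j' i k h1 h2 h3 h4
    rw [key.2 j' i k h1 h2 h3 h4]
    by_cases hk : k ≤ j + 2
    · congr 1
      simp only [eq_iff_iff]; omega
    · split_ifs with c1 c2 c2
      · rfl
      · omega
      · rw [alpha_eq_zero (by omega)]
      · rfl
  · rintro v hv τ ⟨h1, h2⟩
    simp only [exec_block_cons, exec_block_nil]
    set τ' := (Cmd.setN rk (L + 2)).exec ω (τ.enter rl v) with hτ'
    have e1 : Agrees {rl, ri, rk} ∅ ∅ {tab} σ τ' :=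
      (h1.enter (by simp)).trans (Cmd.WritesOnly.agrees (by simp [Cmd.WritesOnly]) _)
    have hk : τ'.nreg rk = v + 2 := by simp [hτ', Cmd.exec]
    have hj' : τ'.nreg rj = j + 2 := (e1.nreg rj (by simp [rj, rl, ri, rk])).trans hj
    have e2 : τ'.rarr tab = τ.rarr tab := rfl
    have hR := h.of_agrees e1 (by simp [rn, rl, ri, rk]) (by simp [rm, rl, ri, rk]) (by simp)
      (by simp [xs, tab]) (by simp [gaps, tab])
    refine ⟨e1.trans (Cmd.WritesOnly.agrees (by simp [Cmd.WritesOnly]) _), ?_⟩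
    obtain ⟨f1, f2⟩ := exec_loop_fill (ω := ω) (r := ri) (e := N + 1)
      (c := .putR tab (cell J I K)
        (tauE I * phiE 0 J * alphaE (J - 1) I (K - 1) / .ofNat K)) (σ := τ') (A := tab)
      (k := n + 1) (by simp [hR.rn]) (fun i => tabIndex n m (j + 2) i (v + 2))
      (fun i => alpha p x (j + 2) i (v + 2)) {ri} ∅ (by simp) (by simp [Cmd.WritesOnly])
      (fun i hi i' hi' hii => (tabIndex_inj (m := m) (by omega) (Nat.lt_succ_iff.1 hi) (by omega)
        (by omega) (by omega) (Nat.lt_succ_iff.1 hi') (by omega) (by omega) hii).2.1)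
      (fun i hi ρ hρ hr hu => by
        have g := hR.of_agrees hρ (by simp [rn, ri]) (by simp [rm, ri]) (by simp) (by simp [xs, tab])
          (by simp [gaps, tab])
        have gj : ρ.nreg rj = j + 2 := (hρ.nreg rj (by simp [rj, ri])).trans hj'
        have gk : ρ.nreg rk = v + 2 := (hρ.nreg rk (by simp [rk, ri])).trans hk
        have c1 : (cell J I K).eval ρ = tabIndex n m (j + 2) i (v + 2) := g.eval_cell gj hr gk
        have c2 : (cell (J - 1) I (K - 1)).eval ρ = tabIndex n m (j + 1) i (v + 1) :=
          g.eval_cell (by simp [gj]) hr (by simp [gk])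
        have c3 : ρ.rarr tab (tabIndex n m (j + 1) i (v + 1)) = alpha p x (j + 1) i (v + 1) := by
          rw [hu, e2, h2 _ _ _ (by omega) (by omega) (by omega) (by omega), if_pos (by omega)]
          intro v' hv' hh
          have := (tabIndex_inj (by omega) (by omega) (by omega) (by omega) (by omega) (by omega)
            (by omega) (by omega) hh).1
          omega
        simp only [Cmd.exec, State.writeRArr_rarr, State.charge_rarr, Function.update_self]
        rw [c1, reval_div, reval_mul, reval_mul, g.eval_tauE (e := I) (i := i) hr (by omega),
          g.eval_phiE (i := i) (i' := i) (j := j + 1) (by simp) le_rfl (by simp [gj]) (by omega),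
          alphaE, reval_get, c2, c3]
        simp [gk, alpha])
    intro j' i k g1 g2 g3 g4
    by_cases hc : j' = j + 2 ∧ k = v + 2
    · obtain ⟨rfl, rfl⟩ := hc
      rw [if_pos (by omega)]
      exact f1 i (by omega)
    · rw [f2 _ (fun v' hv' hh => ?_), e2, h2 j' i k g1 g2 g3 g4]
      · congr 1
        simp only [eq_iff_iff]; omega
      · have := tabIndex_inj (by omega) (by omega) (by omega) (by omega) g1 g2 g3 g4 hh
        omega

/-- A round of the forward pass computes the next row of the table. -/
lemma exec_forwardRound {j : ℕ} (h : Ready p x σ) (hj : σ.nreg rj = j + 2) (hjm : j + 2 ≤ m)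
    (ht : TableUpTo p x (j + 1) σ) :
    TableUpTo p x (j + 2) ((forwardRound toeplitz).exec ω σ) := by
  simp only [forwardRound, exec_block_cons, exec_block_nil]
  have v1 := exec_hat (ω := ω) h hj hjm ht
  set c1 : Cmd := .loop ri (N + 1) (block [.setR acc 0,
      .loop rl (J - 1) (.setR acc (.var acc + alphaE (J - 1) I (L + 1))), .putR hat I (.var acc)])
  have a1 : Agrees {ri, rl} {acc} ∅ {hat} σ (c1.exec ω σ) :=
    Cmd.WritesOnly.agrees (by simp [c1, block, Cmd.WritesOnly]) _
  generalize c1.exec ω σ = σ1 at v1 a1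
  have h1 := h.of_agrees a1 (by simp [rn, rl, ri]) (by simp [rm, rl, ri]) (by simp [reps, acc])
      (by simp [xs, hat]) (by simp [gaps, hat])
  have a2 : Agrees {rl} ∅ ∅ {ker} σ1 ((Cmd.putR ker 0 0).exec ω σ1) :=
    Cmd.WritesOnly.agrees (by simp [Cmd.WritesOnly]) _
  have k2 : ((Cmd.putR ker 0 0).exec ω σ1).rarr ker 0 = 0 := by simp [Cmd.exec]
  generalize (Cmd.putR ker 0 0).exec ω σ1 = σ2 at a2 k2
  have h2 := h1.of_agrees a2 (by simp [rn, rl]) (by simp [rm, rl]) (by simp)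
      (by simp [xs, ker]) (by simp [gaps, ker])
  have j2 : σ2.nreg rj = j + 2 := ((a2.nreg rj (by simp [rj, rl])).trans
    (a1.nreg rj (by simp [rj, rl, ri]))).trans hj
  have k3 := exec_loop_fill (ω := ω) (r := rl) (e := N)
    (c := .putR ker (L + 1) (phiE (L + 1) J)) (σ := σ2) (A := ker) (k := n) (by simp [h2.rn])
    (· + 1) (fun v => phi p n 0 (v + 1) (j + 2)) {rl} ∅ (by simp) (by simp [Cmd.WritesOnly])
    (fun _ _ _ _ h => by simpa using h)
    (fun v hv τ hτ hr _ => by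
      have hR := h2.of_agrees hτ (by simp [rn, rl]) (by simp [rm, rl]) (by simp)
        (by simp [xs, ker]) (by simp [gaps, ker])
      simp only [Cmd.exec, State.writeRArr_rarr, State.charge_rarr, Function.update_self]
      rw [hR.eval_phiE (i := 0) (i' := v + 1) (j := j + 1) (by simp [hr]) (by omega)
        (by simp [hτ.nreg rj (by simp [rj, rl]), j2]) (by omega)]
      simp [hr])
  have a3 : Agrees {rl} ∅ ∅ {ker} σ2 ((Cmd.loop rl N (.putR ker (L + 1) (phiE (L + 1) J))).exec ω σ2) :=
    Cmd.WritesOnly.agrees (by simp [Cmd.WritesOnly]) _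
  have k3' := (k3.2 0 (by simp)).trans k2
  generalize (Cmd.loop rl N (.putR ker (L + 1) (phiE (L + 1) J))).exec ω σ2 = σ3 at a3 k3 k3'
  have h3 := h2.of_agrees a3 (by simp [rn, rl]) (by simp [rm, rl]) (by simp)
      (by simp [xs, ker]) (by simp [gaps, ker])
  have u3 : σ3.rarr hat = σ1.rarr hat :=
    (a3.rarr hat (by simp [hat, ker])).trans (a2.rarr hat (by simp [hat, ker]))
  have t3 : σ3.rarr tab = σ.rarr tab := ((a3.rarr tab (by simp [tab, ker])).trans
    (a2.rarr tab (by simp [tab, ker]))).trans (a1.rarr tab (by simp [tab, hat]))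
  have j3 := (a3.nreg rj (by simp [rj, rl])).trans j2
  have p4 := fun i (hi : i ≤ n) => exec_toeplitz (ω := ω) h3.rn hi
  have a4 := Cmd.WritesOnly.agrees (ω := ω) isSubroutine_toeplitz σ3
  generalize toeplitz.exec ω σ3 = σ4 at p4 a4
  have h4 := h3.of_agrees a4 (by simp [rn]) (by simp [rm]) (by simp [reps]) (by simp [xs, prod])
    (by simp [gaps, prod])
  have t4 : σ4.rarr tab = σ.rarr tab := (a4.rarr tab (by simp [tab, prod])).trans t3
  have j4 := (a4.nreg rj (by simp [rj])).trans j3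
  have p4' : ∀ i ≤ n, σ4.rarr prod i = ∑ i' ∈ Finset.range i, phi p n i' i (j + 2) *
        ∑ k ∈ Finset.Icc 1 (j + 1), alpha p x (j + 1) i' k := by
    intro i hi
    rw [p4 i hi, Finset.sum_range_succ, Nat.sub_self, k3', mul_zero, add_zero]
    refine Finset.sum_congr rfl fun l hl => ?_
    have hl := Finset.mem_range.1 hl
    have e : i - l = (i - l - 1) + 1 := by omega
    rw [u3, v1 l (by omega), e, k3.1 (i - l - 1) (by omega), ← e, mul_comm]
    congr 1
    rw [phi, phi, if_pos (by omega), if_pos (by omega), Nat.cast_sub hl.le]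
    simp
  have f5 := exec_loop_fill (ω := ω) (r := ri) (e := N + 1)
    (c := .putR tab (cell J I 1) (tauE I * .get prod I)) (σ := σ4) (A := tab) (k := n + 1)
    (by simp [h4.rn]) (fun i => tabIndex n m (j + 2) i 1) (fun i => alpha p x (j + 2) i 1) {ri} ∅
    (by simp) (by simp [Cmd.WritesOnly])
    (fun i hi i' hi' hii => (tabIndex_inj (m := m) (by omega) (Nat.lt_succ_iff.1 hi) (by omega)
        (by omega) (by omega) (Nat.lt_succ_iff.1 hi') (by omega) (by omega) hii).2.1)
    (fun i hi τ hτ hr _ => by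
      have hR := h4.of_agrees hτ (by simp [rn, ri]) (by simp [rm, ri]) (by simp)
        (by simp [xs, tab]) (by simp [gaps, tab])
      simp only [Cmd.exec, State.writeRArr_rarr, State.charge_rarr, Function.update_self]
      rw [hR.eval_cell (e := J) (f := I) (g := 1) (j := j + 2) (i := i) (k := 1)
        (by simp [hτ.nreg rj (by simp [rj, ri]), j4]) hr rfl, reval_mul,
        hR.eval_tauE (e := I) (i := i) hr (by omega), reval_get, eval_I, hr,
        hτ.rarr prod (by simp [prod, tab]), p4' i (by omega)]
      simp [alpha])
  have a5 : Agrees {ri} ∅ ∅ {tab} σ4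
      ((Cmd.loop ri (N + 1) (.putR tab (cell J I 1) (tauE I * .get prod I))).exec ω σ4) :=
    Cmd.WritesOnly.agrees (by simp [Cmd.WritesOnly]) _
  generalize (Cmd.loop ri (N + 1)
    (.putR tab (cell J I 1) (tauE I * .get prod I))).exec ω σ4 = σ5 at f5 a5
  refine exec_repeat (h4.of_agrees a5 (by simp [rn, ri]) (by simp [rm, ri]) (by simp)
        (by simp [xs, tab]) (by simp [gaps, tab])) ((a5.nreg rj (by simp [rj, ri])).trans j4) hjm ?_
  intro j' i k g1 g2 g3 g4
  by_cases hc : j' = j + 2 ∧ k = 1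
  · obtain ⟨rfl, rfl⟩ := hc
    rw [if_pos (by simp)]
    exact f5.1 i (by omega)
  · rw [f5.2 _ (fun v hv hh => hc ?_), t4, ht j' i k g1 g2 g3 g4]
    · congr 1
      simp only [eq_iff_iff]; omega
    · have := tabIndex_inj (by omega) (by omega) (by omega) (by omega) g1 g2 g3 g4 hh
      omega

/-- The forward pass computes the table. -/
theorem exec_forward (hm : 1 ≤ m) (h : Ready p x σ) (h0 : ∀ l, σ.rarr tab l = 0) :
    Ready p x ((forward toeplitz).exec ω σ) ∧ TableUpTo p x m ((forward toeplitz).exec ω σ) ∧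
      Agrees ({round, rj, ri, rl, rk} ∪ Set.Ici 16) ({acc} ∪ Set.Ici 16) (Set.Ici 16)
        ({hat, ker, tab, prod} ∪ Set.Ici 16) σ ((forward toeplitz).exec ω σ) := by
  simp only [forward, exec_block_cons, exec_block_nil]
  have t1 := exec_base (ω := ω) hm h h0
  have a1 := base_writesOnly.agrees (ω := ω) σ
  generalize base.exec ω σ = σ1 at t1 a1
  have a1' : Agrees ({round, rj, ri, rl, rk} ∪ Set.Ici 16) ({acc} ∪ Set.Ici 16) (Set.Ici 16)
        ({hat, ker, tab, prod} ∪ Set.Ici 16) σ σ1 :=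
    a1.mono (by simp) (by simp) (by simp) (by simp)
  have hm1 : σ1.nreg rm = m := (a1.nreg rm (by simp [rm, ri])).trans h.rm
  have key := exec_loop_induction (ω := ω) (r := round) (e := M - 1) (k := m - 1) (σ := σ1)
    (c := .seq (.setN rj (.var round + 2)) (forwardRound toeplitz)) (by simp [hm1])
    (fun v τ => Agrees ({round, rj, ri, rl, rk} ∪ Set.Ici 16) ({acc} ∪ Set.Ici 16) (Set.Ici 16)
        ({hat, ker, tab, prod} ∪ Set.Ici 16) σ τ ∧ TableUpTo p x (v + 1) τ)
    ⟨a1'.charge, t1⟩ ?_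
  · rw [Nat.sub_add_cancel hm] at key
    exact ⟨h.of_agrees key.1 (by simp [rn, round, rj, ri, rl, rk])
      (by simp [rm, round, rj, ri, rl, rk]) (by simp [reps, acc])
      (by simp [xs, hat, ker, tab, prod]) (by simp [gaps, hat, ker, tab, prod]), key.2, key.1⟩
  · rintro v hv τ ⟨b1, b2⟩
    have b3 := (b1.enter (r := round) (v := v) (by simp)).trans (Cmd.WritesOnly.agrees (ω := ω)
      (c := .setN rj (.var round + 2)) (by simp [Cmd.WritesOnly]) _)
    have b4 := h.of_agrees b3 (by simp [rn, round, rj, ri, rl, rk])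
      (by simp [rm, round, rj, ri, rl, rk]) (by simp [reps, acc])
      (by simp [xs, hat, ker, tab, prod]) (by simp [gaps, hat, ker, tab, prod])
    refine ⟨b3.trans (forwardRound_agrees.mono ?_ le_rfl le_rfl le_rfl),
      exec_forwardRound b4 (by simp [Cmd.exec]) (by omega) b2⟩
    refine Set.union_subset_union_left _ ?_
    intro r; simp; tauto

end Prog

end

section

/-! ### The backward pass and the output of the program -/

variable {n m : ℕ} {p : Params m} {x : Fin n → ℝ}

/-- Inversion of the distribution function: the first of the indices `0, …, T - 1` at which the
partial sums of the weights `f` exceed the fraction `u` of their total, and `0` if there is none. -/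
def pick (f : ℕ → ℝ) (T : ℕ) (u : ℝ) : ℕ :=
  sInf {t | t < T ∧ u * ∑ v ∈ Finset.range T, f v < ∑ v ∈ Finset.range (t + 1), f v}

lemma pick_eq {f : ℕ → ℝ} {T : ℕ} {u : ℝ} {t : ℕ} (ht : t < T)
    (h : u * ∑ v ∈ Finset.range T, f v < ∑ v ∈ Finset.range (t + 1), f v)
    (h' : ∀ t' < t, ¬ u * ∑ v ∈ Finset.range T, f v < ∑ v ∈ Finset.range (t' + 1), f v) :
    pick f T u = t := by
  refine le_antisymm (Nat.sInf_le ⟨ht, h⟩) ?_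
  by_contra hlt
  have := Nat.sInf_mem (s := {t | t < T ∧ u * ∑ v ∈ Finset.range T, f v <
    ∑ v ∈ Finset.range (t + 1), f v}) ⟨t, ht, h⟩
  exact h' _ (not_le.1 hlt) this.2

lemma pick_eq_zero {f : ℕ → ℝ} {T : ℕ} {u : ℝ}
    (h : ∀ t < T, ¬ u * ∑ v ∈ Finset.range T, f v < ∑ v ∈ Finset.range (t + 1), f v) :
    pick f T u = 0 := by
  have : {t | t < T ∧ u * ∑ v ∈ Finset.range T, f v < ∑ v ∈ Finset.range (t + 1), f v} = ∅ :=
    Set.eq_empty_of_forall_notMem fun t ht => h t ht.1 ht.2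
  rw [pick, this, Nat.sInf_empty]

lemma pick_lt {f : ℕ → ℝ} {T : ℕ} {u : ℝ} (hT : 0 < T) : pick f T u < T := by
  by_cases h : ∃ t < T, u * ∑ v ∈ Finset.range T, f v < ∑ v ∈ Finset.range (t + 1), f v
  · obtain ⟨t, ht, h⟩ := h
    exact lt_of_le_of_lt (Nat.sInf_le ⟨ht, h⟩) ht
  · rw [pick_eq_zero fun t ht h' => h ⟨t, ht, h'⟩]
    exact hT

/-- The weights of the pairs `(i, k)` in a draw of the backward pass with `j + 1` open positions, in
lexicographic order: the pair `(i, k + 1)` has index `i * (j + 1) + k`. -/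
def drawWeight (p : Params m) (x : Fin n → ℝ) (j : ℕ) (s : Fin m → Fin (n + 1)) (t : ℕ) : ℝ :=
  alpha p x (j + 1) (t / (j + 1)) (t % (j + 1) + 1) * edge p s (j + 1) (t / (j + 1))

/-- The pair that is drawn with the uniform number `u`. -/
def pickPair (p : Params m) (x : Fin n → ℝ) (j : ℕ) (s : Fin m → Fin (n + 1)) (u : ℝ) :
    Fin (n + 1) × Fin (j + 1) :=
  finProdFinEquiv.symm ⟨pick (drawWeight p x j s) ((n + 1) * (j + 1)) u, pick_lt (by positivity)⟩

/-- The interval sequence after a draw. -/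
def fillIn (j : ℕ) (s : Fin m → Fin (n + 1)) (r : Fin (n + 1) × Fin (j + 1)) :
    Fin m → Fin (n + 1) :=
  fun t => if j - r.2 ≤ (t : ℕ) ∧ (t : ℕ) ≤ j then r.1 else s t

/-- `R` rounds of the backward pass with the uniform numbers `ω 0, …, ω (R - 1)`, when positions
`1, …, j` are still to be sampled. -/
def run (p : Params m) (x : Fin n → ℝ) :
    ℕ → ℕ → (Fin m → Fin (n + 1)) → (ℕ → unitInterval) → Fin m → Fin (n + 1)
  | 0, _, s, _ => s
  | _ + 1, 0, s, _ => s
  | R + 1, j + 1, s, ω =>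
      run p x R (j - (pickPair p x j s (ω 0)).2) (fillIn j s (pickPair p x j s (ω 0)))
        fun t => ω (t + 1)

lemma pickPair_fst (p : Params m) (x : Fin n → ℝ) (j : ℕ) (s : Fin m → Fin (n + 1)) (u : ℝ) :
    ((pickPair p x j s u).1 : ℕ) = pick (drawWeight p x j s) ((n + 1) * (j + 1)) u / (j + 1) := rfl

lemma pickPair_snd (p : Params m) (x : Fin n → ℝ) (j : ℕ) (s : Fin m → Fin (n + 1)) (u : ℝ) :
    ((pickPair p x j s u).2 : ℕ) = pick (drawWeight p x j s) ((n + 1) * (j + 1)) u % (j + 1) := rfl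

lemma run_zero (R : ℕ) (s : Fin m → Fin (n + 1)) (ω : ℕ → unitInterval) : run p x R 0 s ω = s := by
  cases R <;> rw [run]

lemma sum_range_mul (f : ℕ → ℝ) (a b : ℕ) :
    ∑ t ∈ Finset.range (a * b), f t =
      ∑ i ∈ Finset.range a, ∑ k ∈ Finset.range b, f (i * b + k) := by
  induction a with
  | zero => simp
  | succ a ih => rw [add_mul, one_mul, Finset.sum_range_add, ih, Finset.sum_range_succ]

namespace Prog

variable {ω : ℕ → unitInterval} {σ τ : State}

/-- The interval sequence in memory. -/
def HoldsSeq (s : Fin m → Fin (n + 1)) (σ : State) : Prop := ∀ t : Fin m, σ.narr sqn t = s t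

lemma exec_ifN_of_lt {e f : NExp} {c d : Cmd} (h : e.eval σ < f.eval σ) :
    ∃ τ, Agrees ∅ ∅ ∅ ∅ σ τ ∧ (Cmd.ifN e f c d).exec ω σ = c.exec ω τ :=
  ⟨_, Agrees.charge .refl, by rw [Cmd.exec, if_pos h]⟩

lemma exec_ifN_of_not_lt {e f : NExp} {c d : Cmd} (h : ¬ e.eval σ < f.eval σ) :
    ∃ τ, Agrees ∅ ∅ ∅ ∅ σ τ ∧ (Cmd.ifN e f c d).exec ω σ = d.exec ω τ :=
  ⟨_, Agrees.charge .refl, by rw [Cmd.exec, if_neg h]⟩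

lemma exec_ifR_of_lt {e f : RExp} {c d : Cmd} (h : e.eval σ < f.eval σ) :
    ∃ τ, Agrees ∅ ∅ ∅ ∅ σ τ ∧ (Cmd.ifR e f c d).exec ω σ = c.exec ω τ :=
  ⟨_, Agrees.charge .refl, by rw [Cmd.exec, if_pos h]⟩

lemma exec_ifR_of_not_lt {e f : RExp} {c d : Cmd} (h : ¬ e.eval σ < f.eval σ) :
    ∃ τ, Agrees ∅ ∅ ∅ ∅ σ τ ∧ (Cmd.ifR e f c d).exec ω σ = d.exec ω τ :=
  ⟨_, Agrees.charge .refl, by rw [Cmd.exec, if_neg h]⟩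

lemma exec_links {j : ℕ} {s : Fin m → Fin (n + 1)} (h : Ready p x σ) (hj : σ.nreg rj = j + 1)
    (hjm : j + 1 ≤ m) (hs : HoldsSeq s σ) :
    ∀ i ≤ n, (links.exec ω σ).rarr link i = edge p s (j + 1) i := by
  intro i hi
  refine (exec_loop_fill (k := n + 1) (by simp [h.rn]) id (fun i => edge p s (j + 1) i) {ri} ∅
    (by simp) (by simp [Cmd.WritesOnly]) (fun _ _ _ _ h => h) ?_).1 i (by omega)
  intro i hi τ hτ hr _
  -- what is known in any state that differs from `σ` in `ri` and `link` only
  have known : ∀ ρ, Agrees ∅ ∅ ∅ ∅ τ ρ → Ready p x ρ ∧ ρ.nreg rj = j + 1 ∧ ρ.nreg ri = i ∧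
      HoldsSeq s ρ ∧ ρ.rarr link = τ.rarr link := by
    intro ρ hρ
    have b := hτ.trans (hρ.mono (by simp) le_rfl le_rfl (by simp))
    exact ⟨h.of_agrees b (by simp [rn, ri]) (by simp [rm, ri]) (by simp) (by simp [xs, link])
      (by simp [gaps, link]), (b.nreg rj (by simp [rj, ri])).trans hj, (hρ.nreg ri (by simp)).trans hr,
      fun t => by rw [b.narr _ (by simp)]; exact hs t, hρ.rarr _ (by simp)⟩
  have write : ∀ (ρ : State) (E : RExp), Agrees ∅ ∅ ∅ ∅ τ ρ → E.eval ρ = edge p s (j + 1) i →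
      ((Cmd.putR link I E).exec ω ρ).rarr link =
        Function.update (τ.rarr link) (id i) (edge p s (j + 1) i) := by
    intro ρ E hρ hE
    obtain ⟨_, _, h3, _, h5⟩ := known ρ hρ
    simp [Cmd.exec, hE, h3, h5]
  obtain ⟨h1, h2, h3, h4, _⟩ := known τ .refl
  by_cases hlt : j + 1 < m
  · obtain ⟨ρ, hρ, e⟩ := exec_ifN_of_lt (ω := ω) (σ := τ) (e := J) (f := M)
      (c := .ifN I (.get sqn J) (.putR link I (phiE (.get sqn J - I) (J + 1))) (.putR link I 0))
      (d := .putR link I (phiE (N - I) (M + 1))) (by simp [h1.rm, h2, hlt])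
    rw [e]
    obtain ⟨g1, g2, g3, g4, _⟩ := known ρ hρ
    have hsj : ρ.narr sqn (j + 1) = s ⟨j + 1, hlt⟩ := g4 ⟨j + 1, hlt⟩
    by_cases hi' : i < (s ⟨j + 1, hlt⟩ : ℕ)
    · obtain ⟨ρ', hρ', e'⟩ := exec_ifN_of_lt (ω := ω) (σ := ρ) (e := I) (f := .get sqn J)
        (c := .putR link I (phiE (.get sqn J - I) (J + 1))) (d := .putR link I 0)
        (by simp [g2, g3, hsj, hi'])
      obtain ⟨f1, f2, f3, f4, _⟩ := known ρ' (hρ.trans hρ')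
      rw [e']
      refine write ρ' _ (hρ.trans hρ') ?_
      have hsj' : ρ'.narr sqn (j + 1) = s ⟨j + 1, hlt⟩ := f4 ⟨j + 1, hlt⟩
      rw [f1.eval_phiE (i := i) (i' := s ⟨j + 1, hlt⟩) (j := j + 1) (by simp [f2, f3, hsj']) hi'.le
        (by simp [f2]) hjm, edge, dif_pos hlt, if_pos hi']
    · obtain ⟨ρ', hρ', e'⟩ := exec_ifN_of_not_lt (ω := ω) (σ := ρ) (e := I) (f := .get sqn J)
        (c := .putR link I (phiE (.get sqn J - I) (J + 1))) (d := .putR link I 0)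
        (by simpa [g2, g3, hsj] using hi')
      rw [e']
      refine write ρ' _ (hρ.trans hρ') ?_
      rw [reval_zero, edge, dif_pos hlt, if_neg hi']
  · obtain ⟨ρ, hρ, e⟩ := exec_ifN_of_not_lt (ω := ω) (σ := τ) (e := J) (f := M)
      (c := .ifN I (.get sqn J) (.putR link I (phiE (.get sqn J - I) (J + 1))) (.putR link I 0))
      (d := .putR link I (phiE (N - I) (M + 1))) (by simpa [h1.rm, h2] using hlt)
    obtain ⟨g1, g2, g3, g4, _⟩ := known ρ hρ
    rw [e]
    refine write ρ _ hρ ?_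
    rw [g1.eval_phiE (i := i) (i' := n) (j := m) (by simp [g1.rn, g3]) (by omega)
      (by simp [g1.rm]) le_rfl, edge, dif_neg hlt]

/-- The weight that `draw` accumulates. -/
def weightE : RExp := alphaE J I (K + 1) * .get link I

lemma eval_weightE {j i k : ℕ} {s : Fin m → Fin (n + 1)} (h : Ready p x σ)
    (ht : TableUpTo p x m σ) (hl : ∀ i ≤ n, σ.rarr link i = edge p s (j + 1) i)
    (hj : σ.nreg rj = j + 1) (hjm : j + 1 ≤ m) (hi : σ.nreg ri = i) (hin : i ≤ n)
    (hk : σ.nreg rk = k) (hkj : k ≤ j) :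
    weightE.eval σ = drawWeight p x j s (i * (j + 1) + k) := by
  rw [weightE, reval_mul, alphaE, reval_get, reval_get, eval_I, hi, hl i hin,
    h.eval_cell (e := J) (f := I) (g := K + 1) (j := j + 1) (i := i) (k := k + 1) hj hi
      (by simp [hk]), ht _ _ _ (by omega) hin (by omega) (by omega), if_pos hjm, drawWeight,
    mul_comm i, Nat.mul_add_div (by omega), Nat.mul_add_mod, Nat.div_eq_of_lt (by omega),
    Nat.mod_eq_of_lt (by omega), add_zero]

/-- The state of the search in `draw` after the first `t` pairs. -/
def Searched (f : ℕ → ℝ) (T b : ℕ) (u : ℝ) (t : ℕ) (σ : State) : Prop :=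
  (σ.nreg found = 0 ∧ σ.nreg newI = 0 ∧ σ.nreg newK = 1 ∧
    σ.rreg acc = ∑ v ∈ Finset.range t, f v ∧
    ∀ t' < t, ¬ u * ∑ v ∈ Finset.range T, f v < ∑ v ∈ Finset.range (t' + 1), f v) ∨
  (σ.nreg found = 1 ∧ ∃ t₀ < t, u * ∑ v ∈ Finset.range T, f v < ∑ v ∈ Finset.range (t₀ + 1), f v ∧
    (∀ t' < t₀, ¬ u * ∑ v ∈ Finset.range T, f v < ∑ v ∈ Finset.range (t' + 1), f v) ∧
    σ.nreg newI = t₀ / b ∧ σ.nreg newK = t₀ % b + 1)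

lemma Searched.pick {f : ℕ → ℝ} {T b : ℕ} {u : ℝ} (h : Searched f T b u T σ) :
    σ.nreg newI = JointExp.pick f T u / b ∧ σ.nreg newK = JointExp.pick f T u % b + 1 := by
  rcases h with ⟨_, h1, h2, _, h3⟩ | ⟨_, t, ht, h1, h2, h3, h4⟩
  · rw [pick_eq_zero h3]
    simpa using ⟨h1, h2⟩
  · rw [pick_eq ht h1 h2]
    exact ⟨h3, h4⟩

/-- The examination of one pair. -/
def examine : Cmd := .ifN (.var found) 1
  (.seq (.setR acc (.var acc + weightE))
    (.ifR (.var unif * .var total) (.var acc)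
      (block [.setN found 1, .setN newI I, .setN newK (K + 1)])
      .skip))
  .skip

lemma examine_writesOnly : examine.WritesOnly {found, newI, newK} {acc} ∅ ∅ := by
  simp [examine, block, Cmd.WritesOnly]

lemma exec_examine {f : ℕ → ℝ} {T b i k : ℕ} {u : ℝ} (hi : σ.nreg ri = i) (hk : σ.nreg rk = k)
    (hkb : k < b) (hu : σ.rreg unif = u) (hT : σ.rreg total = ∑ v ∈ Finset.range T, f v)
    (hw : weightE.eval σ = f (i * b + k)) (hw' : ∀ τ, Agrees ∅ ∅ ∅ ∅ σ τ → weightE.eval τ = weightE.eval σ)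
    (h : Searched f T b u (i * b + k) σ) :
    Searched f T b u (i * b + k + 1) (examine.exec ω σ) := by
  have hdiv : (i * b + k) / b = i := by
    rw [mul_comm, Nat.mul_add_div (by omega), Nat.div_eq_of_lt hkb, add_zero]
  have hmod : (i * b + k) % b = k := by rw [mul_comm, Nat.mul_add_mod, Nat.mod_eq_of_lt hkb]
  have keep : ∀ τ, Agrees ∅ ∅ ∅ ∅ σ τ → Searched f T b u (i * b + k) τ := by
    intro τ hτ
    rw [Searched, hτ.nreg found (by simp), hτ.nreg newI (by simp), hτ.nreg newK (by simp),
      hτ.rreg acc (by simp)]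
    exact h
  by_cases hf : σ.nreg found = 0
  · obtain ⟨τ, a, e⟩ := exec_ifN_of_lt (ω := ω) (σ := σ) (e := .var found) (f := 1)
      (c := .seq (.setR acc (.var acc + weightE)) (.ifR (.var unif * .var total) (.var acc)
        (block [.setN found 1, .setN newI I, .setN newK (K + 1)]) .skip)) (d := .skip)
      (by simp [hf])
    rw [examine, e, Cmd.exec]
    rcases h with ⟨h1, h2, h3, h4, h5⟩ | ⟨h1, -⟩
    swap
    · omega
    set τ' := (Cmd.setR acc (.var acc + weightE)).exec ω τ with hτ'
    have a' : Agrees ∅ {acc} ∅ ∅ σ τ' := (a.mono le_rfl (by simp) le_rfl le_rfl).trans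
      (Cmd.WritesOnly.agrees (by simp [Cmd.WritesOnly]) _)
    have e1 : τ'.rreg acc = ∑ v ∈ Finset.range (i * b + k + 1), f v := by
      simp only [hτ', Cmd.exec, State.writeRReg_rreg, Function.update_self, reval_add, reval_var]
      rw [a.rreg acc (by simp), h4, hw' _ a, hw, Finset.sum_range_succ]
    have e2 : (RExp.var unif * RExp.var total).eval τ' = u * ∑ v ∈ Finset.range T, f v := by
      rw [reval_mul, reval_var, reval_var, a'.rreg unif (by simp [unif, acc]),
        a'.rreg total (by simp [total, acc]), hu, hT]
    by_cases hlt : u * ∑ v ∈ Finset.range T, f v < ∑ v ∈ Finset.range (i * b + k + 1), f v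
    · obtain ⟨ρ, c, e'⟩ := exec_ifR_of_lt (ω := ω) (σ := τ') (e := .var unif * .var total)
        (f := .var acc) (c := block [.setN found 1, .setN newI I, .setN newK (K + 1)]) (d := .skip)
        (by rw [e2, reval_var, e1]; exact hlt)
      rw [e']
      have ci : ρ.nreg ri = i :=
        ((c.nreg ri (by simp)).trans (a'.nreg ri (by simp))).trans hi
      have ck : ρ.nreg rk = k :=
        ((c.nreg rk (by simp)).trans (a'.nreg rk (by simp))).trans hk
      refine .inr ⟨?_, i * b + k, by omega, hlt, h5, ?_, ?_⟩
      · simp [block, Cmd.exec, newI, newK, found]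
      · rw [hdiv]
        simpa [block, Cmd.exec, newI, newK, ri, found] using ci
      · rw [hmod]
        simpa [block, Cmd.exec, newI, newK, rk, found] using ck
    · obtain ⟨ρ, c, e'⟩ := exec_ifR_of_not_lt (ω := ω) (σ := τ') (e := .var unif * .var total)
        (f := .var acc) (c := block [.setN found 1, .setN newI I, .setN newK (K + 1)]) (d := .skip)
        (by rw [e2, reval_var, e1]; exact hlt)
      rw [e', Cmd.exec]
      refine .inl ⟨((c.nreg _ (by simp)).trans (a'.nreg _ (by simp))).trans h1,
        ((c.nreg _ (by simp)).trans (a'.nreg _ (by simp))).trans h2,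
        ((c.nreg _ (by simp)).trans (a'.nreg _ (by simp))).trans h3,
        (c.rreg acc (by simp)).trans e1, fun t' ht' => ?_⟩
      rcases Nat.lt_succ_iff_lt_or_eq.1 ht' with h | rfl
      · exact h5 t' h
      · exact hlt
  · obtain ⟨τ, a, e⟩ := exec_ifN_of_not_lt (ω := ω) (σ := σ) (e := .var found) (f := 1)
      (c := .seq (.setR acc (.var acc + weightE)) (.ifR (.var unif * .var total) (.var acc)
        (block [.setN found 1, .setN newI I, .setN newK (K + 1)]) .skip)) (d := .skip)
      (by simpa using hf)
    rw [examine, e, Cmd.exec]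
    rcases keep τ a with ⟨h1, -⟩ | ⟨h1, t, ht, h2⟩
    · exact absurd ((a.nreg found (by simp)).symm.trans h1) hf
    · exact .inr ⟨h1, t, by omega, h2⟩

lemma draw_writesOnly :
    draw.WritesOnly {ri, rk, found, newI, newK} {total, acc} ∅ {link} := by
  simp [draw, links, block, Cmd.WritesOnly]

/-- In all states that differ from `σ` only in what the loops of `draw` change, `weightE` is the
weight of the current pair. -/
def HoldsWeights (n j : ℕ) (f : ℕ → ℝ) (σ : State) : Prop :=
  ∀ τ, Agrees {ri, rk, found, newI, newK} {total, acc} ∅ ∅ σ τ → ∀ i k, τ.nreg ri = i →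
    τ.nreg rk = k → i ≤ n → k ≤ j → weightE.eval τ = f (i * (j + 1) + k)

lemma HoldsWeights.of_agrees {j : ℕ} {f : ℕ → ℝ} (h : HoldsWeights n j f σ)
    (hτ : Agrees {ri, rk, found, newI, newK} {total, acc} ∅ ∅ σ τ) : HoldsWeights n j f τ :=
  fun ρ hρ => h ρ (hτ.trans hρ)

lemma exec_total {j : ℕ} {f : ℕ → ℝ} (hn : σ.nreg rn = n) (hj : σ.nreg rj = j + 1)
    (hw : HoldsWeights n j f σ) (h0 : σ.rreg total = 0) :
    ((Cmd.loop ri (N + 1) (.loop rk J (.setR total (.var total + weightE)))).exec ω σ).rreg total =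
      ∑ t ∈ Finset.range ((n + 1) * (j + 1)), f t := by
  rw [exec_loop_sum (ω := ω) (r := ri) (e := N + 1) (q := total)
    (c := .loop rk J (.setR total (.var total + weightE))) (σ := σ) (k := n + 1) (by simp [hn])
    (fun i => ∑ k ∈ Finset.range (j + 1), f (i * (j + 1) + k)) {ri, rk} {total} (by simp)
    (by simp [Cmd.WritesOnly]), h0, zero_add, sum_range_mul]
  intro i hi τ hτ hr
  refine exec_loop_sum (by simp [hτ.nreg rj (by simp [rj, ri, rk]), hj]) _
    {rk} {total} (by simp) (by simp [Cmd.WritesOnly]) fun k hk ρ hρ hrk => ?_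
  have c := hτ.trans (hρ.mono (by intro r; simp; tauto) (by simp) le_rfl le_rfl)
  simp only [Cmd.exec, State.writeRReg_rreg, Function.update_self, reval_add, reval_var]
  rw [hw ρ (c.mono (by intro r; simp; tauto) (by simp) le_rfl le_rfl) i k
    ((hρ.nreg ri (by simp [ri, rk])).trans hr) hrk (by omega) (by omega)]

lemma exec_search {j : ℕ} {f : ℕ → ℝ} {u : ℝ} (hn : σ.nreg rn = n) (hj : σ.nreg rj = j + 1)
    (hw : HoldsWeights n j f σ) (hu : σ.rreg unif = u)
    (hT : σ.rreg total = ∑ t ∈ Finset.range ((n + 1) * (j + 1)), f t)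
    (h : Searched f ((n + 1) * (j + 1)) (j + 1) u 0 σ) :
    Searched f ((n + 1) * (j + 1)) (j + 1) u ((n + 1) * (j + 1))
      ((Cmd.loop ri (N + 1) (.loop rk J examine)).exec ω σ) := by
  refine (exec_loop_induction (k := n + 1) (by simp [hn])
    (fun i τ => Agrees {ri, rk, found, newI, newK} {acc} ∅ ∅ σ τ ∧
      Searched f ((n + 1) * (j + 1)) (j + 1) u (i * (j + 1)) τ) ⟨Agrees.charge .refl, ?_⟩ ?_).2
  · simpa [Searched] using h
  · rintro i hi τ ⟨h1, h2⟩
    have h1' := h1.enter (r := ri) (v := i) (by simp)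
    have := exec_loop_induction (ω := ω) (r := rk) (e := J) (k := j + 1) (c := examine)
      (σ := τ.enter ri i) (by
        rw [eval_J, h1'.nreg rj (by simp [rj, ri, rk, found, newI, newK]), hj])
      (fun k ρ => Agrees {ri, rk, found, newI, newK} {acc} ∅ ∅ σ ρ ∧ ρ.nreg ri = i ∧
        Searched f ((n + 1) * (j + 1)) (j + 1) u (i * (j + 1) + k) ρ)
      ⟨h1'.charge, by simp, by simpa [Searched, found, newI, newK, ri] using h2⟩ ?_
    · refine ⟨this.1, ?_⟩
      rw [Nat.succ_mul i]
      exact this.2.2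
    · rintro k hk ρ ⟨g1, g2, g3⟩
      have g1' := g1.enter (r := rk) (v := k) (by simp)
      have wr := examine_writesOnly.agrees (ω := ω) (ρ.enter rk k)
      have g2' : (ρ.enter rk k).nreg ri = i := by simpa [ri, rk] using g2
      have g3' : (ρ.enter rk k).nreg rk = k := by simp
      have w : ∀ τ, Agrees ∅ ∅ ∅ ∅ (ρ.enter rk k) τ → weightE.eval τ = f (i * (j + 1) + k) := by
        intro τ hτ
        exact hw τ ((g1'.mono le_rfl (by simp) le_rfl le_rfl).trans
          (hτ.mono (by simp) (by simp) le_rfl le_rfl)) i k ((hτ.nreg ri (by simp)).trans g2')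
          ((hτ.nreg rk (by simp)).trans g3') (by omega) (by omega)
      refine ⟨g1'.trans (wr.mono (by intro r; simp; tauto) le_rfl le_rfl le_rfl),
        (wr.nreg ri (by simp [ri, found, newI, newK])).trans g2', ?_⟩
      exact exec_examine g2' g3' hk ((g1'.rreg unif (by simp [unif, acc])).trans hu)
        ((g1'.rreg total (by simp [total, acc])).trans hT) (w _ .refl)
        (fun τ hτ => (w τ hτ).trans (w _ .refl).symm)
        (by simpa [Searched, found, newI, newK, rk] using g3)

lemma draw_eq : draw = block [
    links,
    .setR total 0,
    .loop ri (N + 1) (.loop rk J (.setR total (.var total + weightE))),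
    .setR acc 0,
    .setN found 0,
    .setN newI 0,
    .setN newK 1,
    .loop ri (N + 1) (.loop rk J examine)] := rfl

/-- A draw of the backward pass chooses the pair `pickPair`. -/
lemma exec_draw {j : ℕ} {s : Fin m → Fin (n + 1)} (h : Ready p x σ) (ht : TableUpTo p x m σ)
    (hj : σ.nreg rj = j + 1) (hjm : j + 1 ≤ m) (hs : HoldsSeq s σ) :
    (draw.exec ω σ).nreg newI = (pickPair p x j s (σ.rreg unif)).1 ∧
      (draw.exec ω σ).nreg newK = (pickPair p x j s (σ.rreg unif)).2 + 1 := by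
  rw [pickPair_fst, pickPair_snd]
  refine Searched.pick ?_
  rw [draw_eq]
  simp only [exec_block_cons, exec_block_nil]
  have l1 := exec_links (ω := ω) h hj hjm hs
  have a1 : Agrees {ri} ∅ ∅ {link} σ (links.exec ω σ) :=
    Cmd.WritesOnly.agrees (by simp [links, Cmd.WritesOnly]) _
  generalize links.exec ω σ = σ1 at l1 a1
  have w1 : HoldsWeights n j (drawWeight p x j s) σ1 := by
    intro τ hτ i k hi hk hin hkj
    have b : Agrees {ri, rk, found, newI, newK} {total, acc} ∅ {link} σ τ :=
      (a1.mono (by simp) (by simp) (by simp) (by simp)).trans (hτ.mono le_rfl le_rfl le_rfl (by simp))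
    refine eval_weightE (h.of_agrees b (by simp [rn, ri, rk, found, newI, newK])
      (by simp [rm, ri, rk, found, newI, newK]) (by simp [reps, total, acc]) (by simp [xs, link])
      (by simp [gaps, link])) (fun j' i k h1 h2 h3 h4 => ?_) (fun i hi => ?_)
      ((b.nreg rj (by simp [rj, ri, rk, found, newI, newK])).trans hj) hjm hi hin hk hkj
    · rw [b.rarr tab (by simp [tab, link]), ht _ _ _ h1 h2 h3 h4]
    · rw [hτ.rarr link (by simp), l1 i hi]
  generalize drawWeight p x j s = f at w1
  have n1 : σ1.nreg rn = n := (a1.nreg rn (by simp [rn, ri])).trans h.rn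
  have j1 : σ1.nreg rj = j + 1 := (a1.nreg rj (by simp [rj, ri])).trans hj
  have u1 : σ1.rreg unif = σ.rreg unif := a1.rreg _ (by simp)
  generalize σ.rreg unif = u at u1
  have a2 : Agrees ∅ {total} ∅ ∅ σ1 ((Cmd.setR total 0).exec ω σ1) :=
    Cmd.WritesOnly.agrees (by simp [Cmd.WritesOnly]) _
  have z2 : ((Cmd.setR total 0).exec ω σ1).rreg total = 0 := by simp [Cmd.exec]
  generalize (Cmd.setR total 0).exec ω σ1 = σ2 at a2 z2
  have n2 := (a2.nreg rn (by simp)).trans n1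
  have j2 := (a2.nreg rj (by simp)).trans j1
  have w2 := w1.of_agrees (a2.mono (by simp) (by simp) (by simp) (by simp))
  have s3 := exec_total (ω := ω) n2 j2 w2 z2
  have a3 : Agrees {ri, rk} {total} ∅ ∅ σ2 ((Cmd.loop ri (N + 1) (.loop rk J
    (.setR total (.var total + weightE)))).exec ω σ2) :=
    Cmd.WritesOnly.agrees (by simp [Cmd.WritesOnly]) _
  generalize (Cmd.loop ri (N + 1) (.loop rk J
    (.setR total (.var total + weightE)))).exec ω σ2 = σ3 at s3 a3
  have a4 : Agrees {ri, rk, found, newI, newK} {acc} ∅ ∅ σ3 ((Cmd.setN newK 1).exec ω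
      ((Cmd.setN newI 0).exec ω ((Cmd.setN found 0).exec ω ((Cmd.setR acc 0).exec ω σ3)))) :=
    Cmd.WritesOnly.agrees (c := .seq (.setR acc 0) (.seq (.setN found 0) (.seq (.setN newI 0)
      (.setN newK 1)))) (by simp [Cmd.WritesOnly]) _
  have s4 : Searched f ((n + 1) * (j + 1)) (j + 1) u 0 ((Cmd.setN newK 1).exec ω
      ((Cmd.setN newI 0).exec ω ((Cmd.setN found 0).exec ω ((Cmd.setR acc 0).exec ω σ3)))) :=
    .inl (by simp [Cmd.exec, newK, newI, found])
  generalize (Cmd.setN newK 1).exec ω ((Cmd.setN newI 0).exec ω ((Cmd.setN found 0).exec ω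
    ((Cmd.setR acc 0).exec ω σ3))) = σ4 at a4 s4
  have a4' := (a3.mono (N' := {ri, rk, found, newI, newK}) (R' := {total, acc})
    (by intro r; simp; tauto) (by simp) le_rfl le_rfl).trans (a4.mono le_rfl (by simp) le_rfl le_rfl)
  exact exec_search ((a4'.nreg rn (by simp [rn, ri, rk, found, newI, newK])).trans n2)
    ((a4'.nreg rj (by simp [rj, ri, rk, found, newI, newK])).trans j2) (w2.of_agrees a4')
    (((a4'.rreg unif (by simp [unif, total, acc])).trans (a2.rreg unif (by simp [unif, total]))).trans
      u1) ((a4.rreg total (by simp [total, acc])).trans s3) s4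

/-- Filling in the drawn block. -/
lemma exec_block_fill {j i κ : ℕ} (hj : σ.nreg rj = j + 1) (hi : σ.nreg newI = i)
    (hk : σ.nreg newK = κ + 1) (hκ : κ ≤ j) (t : ℕ) :
    ((Cmd.loop rl (.var newK) (.putN sqn (J - .var newK + L) (.var newI))).exec ω σ).narr sqn t =
      if j - κ ≤ t ∧ t ≤ j then i else σ.narr sqn t := by
  have := exec_loop_induction (ω := ω) (r := rl) (e := .var newK) (k := κ + 1)
    (c := .putN sqn (J - .var newK + L) (.var newI)) (σ := σ) hk
    (fun v τ => Agrees {rl} ∅ {sqn} ∅ σ τ ∧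
      τ.narr sqn t = if j - κ ≤ t ∧ t < j - κ + v then i else σ.narr sqn t)
    ⟨Agrees.charge .refl, by rw [if_neg (by omega)]; simp⟩ ?_
  · rw [this.2]
    congr 1
    simp only [eq_iff_iff]; omega
  · rintro v hv τ ⟨h1, h2⟩
    have h1' := h1.enter (r := rl) (v := v) (by simp)
    refine ⟨h1'.trans (Cmd.WritesOnly.agrees (by simp [Cmd.WritesOnly]) _), ?_⟩
    have e1 : (J - NExp.var newK + L).eval (τ.enter rl v) = j - κ + v := by
      simp only [eval_add, eval_sub, eval_J, eval_var, eval_L]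
      rw [h1'.nreg rj (by simp [rj, rl]), h1'.nreg newK (by simp [newK, rl]), hj, hk]
      simp
    have e2 : (NExp.var newI).eval (τ.enter rl v) = i :=
      (h1'.nreg newI (by simp [newI, rl])).trans hi
    simp only [Cmd.exec, State.writeNArr_narr, State.charge_narr, Function.update_self, e1, e2]
    rcases eq_or_ne t (j - κ + v) with rfl | hne
    · rw [Function.update_self, if_pos (by omega)]
    · rw [Function.update_of_ne hne, State.enter_narr, h2]
      congr 1
      simp only [eq_iff_iff]; omega

/-- The backward pass computes the sequence `run`, and leaves parameters, data and table alone. -/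
lemma exec_backwardPass {d : ℕ} (h : Ready p x σ) (ht : TableUpTo p x m σ) (hd : σ.draws = d)
    (hs : HoldsSeq (fun _ : Fin m => (0 : Fin (n + 1))) σ) :
    Ready p x (backwardPass.exec ω σ) ∧ (backwardPass.exec ω σ).rarr tab = σ.rarr tab ∧
      (backwardPass.exec ω σ).draws = d + m ∧
      HoldsSeq (run p x m m (fun _ => 0) fun t => ω (d + t)) (backwardPass.exec ω σ) := by
  simp only [backwardPass, exec_block_cons, exec_block_nil]
  have a1 : Agrees {rj} ∅ ∅ ∅ σ ((Cmd.setN rj M).exec ω σ) :=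
    Cmd.WritesOnly.agrees (by simp [Cmd.WritesOnly]) _
  have j1 : ((Cmd.setN rj M).exec ω σ).nreg rj = m := by simp [Cmd.exec, h.rm]
  generalize (Cmd.setN rj M).exec ω σ = σ1 at a1 j1
  have h1 := h.of_agrees a1 (by simp [rn, rj]) (by simp [rm, rj]) (by simp) (by simp) (by simp)
  set body : Cmd := .seq (.rand unif) (.ifN 0 J (block [draw,
    .loop rl (.var newK) (.putN sqn (J - .var newK + L) (.var newI)),
    .setN rj (J - .var newK)]) .skip) with hbody
  have key := exec_loop_induction (ω := ω) (r := round) (e := M) (k := m) (c := body) (σ := σ1) h1.rm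
    (fun v τ => Ready p x τ ∧ τ.rarr tab = σ.rarr tab ∧ τ.draws = d + v ∧
      ∃ j s, j ≤ m ∧ τ.nreg rj = j ∧ HoldsSeq s τ ∧
        run p x (m - v) j s (fun t => ω (d + v + t)) =
          run p x m m (fun _ => 0) fun t => ω (d + t))
    ⟨⟨h1.rn, h1.rm, h1.reps, h1.xs, h1.gaps⟩, a1.rarr tab (by simp), a1.draws.trans hd, m,
      fun _ => 0, le_rfl, j1, fun t => by
        rw [State.charge_narr, a1.narr sqn (by simp)]; exact hs t, by simp⟩ ?_
  · obtain ⟨k1, k2, k3, j, s, _, _, k4, k5⟩ := key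
    refine ⟨k1, k2, k3, ?_⟩
    rw [← k5, Nat.sub_self, run]
    exact k4
  · rintro v hv τ ⟨k1, k2, k3, j, s, hjm, k4, k5, k6⟩
    set τ0 := (Cmd.rand unif).exec ω (τ.enter round v) with hτ0
    have b1 : Ready p x τ0 := by
      refine ⟨?_, ?_, ?_, k1.xs, k1.gaps⟩
      · simpa [hτ0, Cmd.exec, rn, round] using k1.rn
      · simpa [hτ0, Cmd.exec, rm, round] using k1.rm
      · simpa [hτ0, Cmd.exec, reps, unif] using k1.reps
    have b3 : τ0.draws = d + v + 1 := by simp [hτ0, Cmd.exec, k3]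
    have b4 : τ0.nreg rj = j := by simpa [hτ0, Cmd.exec, rj, round] using k4
    have b6 : τ0.rreg unif = ω (d + v) := by simp [hτ0, Cmd.exec, k3]
    have known : ∀ τ1, Agrees ∅ ∅ ∅ ∅ τ0 τ1 → Ready p x τ1 ∧ τ1.rarr tab = σ.rarr tab ∧
        τ1.draws = d + v + 1 ∧ τ1.nreg rj = j ∧ HoldsSeq s τ1 ∧ τ1.rreg unif = ω (d + v) := by
      intro τ1 a
      exact ⟨b1.of_agrees a (by simp) (by simp) (by simp) (by simp) (by simp),
        (a.rarr tab (by simp)).trans k2, a.draws.trans b3, (a.nreg rj (by simp)).trans b4,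
        fun t => by rw [a.narr sqn (by simp)]; exact k5 t, (a.rreg unif (by simp)).trans b6⟩
    rw [hbody, Cmd.exec, ← hτ0]
    have hmv : m - v = (m - (v + 1)) + 1 := by omega
    rcases j with _ | j
    · obtain ⟨τ1, a, e⟩ := exec_ifN_of_not_lt (ω := ω) (σ := τ0) (e := 0) (f := J) (c := block [draw,
        .loop rl (.var newK) (.putN sqn (J - .var newK + L) (.var newI)),
        .setN rj (J - .var newK)]) (d := .skip) (by simp [b4])
      obtain ⟨c1, c2, c3, c4, c5, c6⟩ := known τ1 a
      rw [e, Cmd.exec]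
      refine ⟨c1, c2, c3, 0, s, by omega, c4, c5, ?_⟩
      rw [← k6, run_zero, run_zero]
    · obtain ⟨τ1, a, e⟩ := exec_ifN_of_lt (ω := ω) (σ := τ0) (e := 0) (f := J) (c := block [draw,
        .loop rl (.var newK) (.putN sqn (J - .var newK + L) (.var newI)),
        .setN rj (J - .var newK)]) (d := .skip) (by simp [b4])
      obtain ⟨c1, c2, c3, c4, c5, c6⟩ := known τ1 a
      rw [e]
      simp only [exec_block_cons, exec_block_nil]
      have tb : TableUpTo p x m τ1 := fun j' i k g1 g2 g3 g4 => by rw [c2, ht _ _ _ g1 g2 g3 g4]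
      obtain ⟨d1, d2⟩ := exec_draw (ω := ω) c1 tb c4 hjm c5
      have d3 := draw_writesOnly.agrees (ω := ω) τ1
      rw [c6] at d1 d2
      set r := pickPair p x j s (ω (d + v)) with hr
      generalize draw.exec ω τ1 = τ2 at d1 d2 d3
      have e1 := exec_block_fill (ω := ω)
        ((d3.nreg rj (by simp [rj, ri, rk, found, newI, newK])).trans c4) d1 d2
        (Nat.lt_succ_iff.1 r.2.2)
      have e2 : Agrees {rl} ∅ {sqn} ∅ τ2 ((Cmd.loop rl (.var newK)
          (.putN sqn (J - .var newK + L) (.var newI))).exec ω τ2) :=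
        Cmd.WritesOnly.agrees (by simp [Cmd.WritesOnly]) _
      generalize (Cmd.loop rl (.var newK)
        (.putN sqn (J - .var newK + L) (.var newI))).exec ω τ2 = τ3 at e1 e2
      have f1 := (d3.mono (N' := {ri, rk, found, newI, newK, rl}) (R' := {total, acc}) (A' := {sqn})
        (B' := {link}) (by intro r; simp; tauto) le_rfl (by simp) le_rfl).trans
        (e2.mono (by simp) (by simp) le_rfl (by simp))
      have f2 : τ3.nreg rj = j + 1 :=
        (f1.nreg rj (by simp [rj, ri, rk, found, newI, newK, rl])).trans c4
      have f3 : τ3.nreg newK = r.2 + 1 := (e2.nreg newK (by simp [newK, rl])).trans d2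
      have f4 := c1.of_agrees f1 (by simp [rn, ri, rk, found, newI, newK, rl])
        (by simp [rm, ri, rk, found, newI, newK, rl]) (by simp [reps, total, acc])
        (by simp [xs, link]) (by simp [gaps, link])
      have f5 : HoldsSeq (fillIn j s r) τ3 := by
        intro t
        rw [e1, d3.narr sqn (by simp), fillIn]
        split_ifs
        · rfl
        · exact c5 t
      have f6 : Agrees {rj} ∅ ∅ ∅ τ3 ((Cmd.setN rj (J - .var newK)).exec ω τ3) :=
        Cmd.WritesOnly.agrees (by simp [Cmd.WritesOnly]) _
      refine ⟨f4.of_agrees f6 (by simp [rn, rj]) (by simp [rm, rj]) (by simp) (by simp) (by simp),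
        ?_, ?_, j - r.2, fillIn j s r, by omega, by simp [Cmd.exec, f2, f3], fun t => ?_, ?_⟩
      · rw [f6.rarr tab (by simp), f1.rarr tab (by simp [tab, link]), c2]
      · rw [f6.draws, f1.draws, c3]; ring
      · rw [f6.narr sqn (by simp)]
        exact f5 t
      · rw [← k6, hmv, run, add_zero]
        congr 1
        funext t
        congr 1
        ring

/-! #### Bubble sort -/

/-- The invariant of the sorting loops: after `i` rounds the last `i` entries are in place, and after
`l` more comparisons entry `l` is the largest of the first `l + 1` entries. -/
structure Bubble (m i l : ℕ) (y : ℕ → ℝ) : Prop where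
  placed : ∀ b < m, m ≤ b + i → ∀ a < b, y a ≤ y b
  largest : ∀ a < l, y a ≤ y l
  next : ∀ b ≤ l, b < m → m ≤ b + i + 1 → ∀ a < b, y a ≤ y b

lemma Bubble.step {i l : ℕ} {y z : ℕ → ℝ} (h : Bubble m i l y) (hl : l + 1 < m)
    (hz : z = if y (l + 1) < y l then y ∘ Equiv.swap l (l + 1) else y) : Bubble m i (l + 1) z := by
  have keep : ∀ b, l < b → b ≠ l + 1 → ∀ y' : ℕ → ℝ, (y' ∘ Equiv.swap l (l + 1)) b = y' b := by
    intro b hb hb' y'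
    simp [Equiv.swap_apply_of_ne_of_ne (by omega : b ≠ l) hb']
  split_ifs at hz with hlt
  · have hil : l + 1 + i < m := by
      by_contra hc
      exact absurd (h.placed (l + 1) hl (by omega) l (by omega)) (not_le.2 hlt)
    have val : ∀ a, z a = y (Equiv.swap l (l + 1) a) := fun a => by rw [hz]; rfl
    have big : ∀ a < l + 1, z a ≤ z (l + 1) := by
      intro a ha
      rw [val (l + 1), Equiv.swap_apply_right, val]
      rcases eq_or_ne a l with rfl | hne
      · rw [Equiv.swap_apply_left]; exact hlt.le
      · rw [Equiv.swap_apply_of_ne_of_ne hne (by omega)]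
        exact h.largest a (by omega)
    refine ⟨fun b hb hbi a ha => ?_, big, fun b hb hbm hbi a ha => ?_⟩
    · rw [val b, Equiv.swap_apply_of_ne_of_ne (by omega) (by omega), val a]
      refine h.placed b hb hbi _ ?_
      rw [Equiv.swap_apply_def]
      split_ifs <;> omega
    · obtain rfl : b = l + 1 := by omega
      exact big a ha
  · subst hz
    have big : ∀ a < l + 1, z a ≤ z (l + 1) := by
      intro a ha
      rcases eq_or_ne a l with rfl | hne
      · exact not_lt.1 hlt
      · exact (h.largest a (by omega)).trans (not_lt.1 hlt)
    refine ⟨h.placed, big, fun b hb hbm hbi a ha => ?_⟩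
    rcases Nat.lt_succ_iff_lt_or_eq.1 (Nat.lt_succ_of_le hb) with hb' | rfl
    · exact h.next b (by omega) hbm hbi a ha
    · exact big a ha

/-- The first `m` cells of `out` are a rearrangement of `o`. -/
def Rearranged (o : Fin m → ℝ) (y : ℕ → ℝ) : Prop :=
  ∃ π : Equiv.Perm (Fin m), ∀ t : Fin m, y t = o (π t)

lemma Rearranged.swap {o : Fin m → ℝ} {y : ℕ → ℝ} {l : ℕ} (h : Rearranged o y) (hl : l + 1 < m) :
    Rearranged o (y ∘ Equiv.swap l (l + 1)) := by
  obtain ⟨π, hπ⟩ := h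
  refine ⟨Equiv.swap ⟨l, by omega⟩ ⟨l + 1, hl⟩ |>.trans π, fun t => ?_⟩
  have : Equiv.swap l (l + 1) (t : ℕ) =
      ((Equiv.swap (⟨l, by omega⟩ : Fin m) ⟨l + 1, hl⟩ t : Fin m) : ℕ) := by
    rw [Equiv.swap_apply_def, Equiv.swap_apply_def]
    simp only [Fin.ext_iff]
    split_ifs <;> rfl
  simp [this, hπ]

/-- The comparison of two adjacent cells of `out`, and their exchange if they are out of order. -/
def compareSwap : Cmd := .ifR (.get out (L + 1)) (.get out L)
  (block [.setR tmp (.get out L), .putR out L (.get out (L + 1)), .putR out (L + 1) (.var tmp)])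
  .skip

lemma exec_compareSwap {l : ℕ} (hl : σ.nreg rl = l) :
    (compareSwap.exec ω σ).rarr out = if σ.rarr out (l + 1) < σ.rarr out l then
      σ.rarr out ∘ Equiv.swap l (l + 1) else σ.rarr out := by
  simp only [compareSwap, Cmd.exec, reval_get, eval_add, eval_L, eval_one, hl]
  split_ifs with h
  · simp only [block, Cmd.exec, reval_get, eval_add, eval_L, eval_one, reval_var,
      State.writeRArr_rarr, State.charge_rarr, State.writeRReg_rarr, State.writeRReg_nreg,
      State.charge_nreg, State.writeRArr_nreg, State.writeRReg_rreg, State.writeRArr_rreg,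
      State.charge_rreg, Function.update_self, hl]
    funext a
    simp only [Function.comp_apply, Equiv.swap_apply_def]
    split_ifs with h1 h2
    · subst h1
      rw [Function.update_of_ne (by omega), Function.update_self]
    · subst h2
      rw [Function.update_self]
    · rw [Function.update_of_ne h2, Function.update_of_ne h1]
  · simp

/-- The sorting loops. -/
lemma exec_bubbleSort {o : Fin m → ℝ} (hm : σ.nreg rm = m) (h : ∀ t : Fin m, σ.rarr out t = o t) :
    ∀ t : Fin m, ((Cmd.loop ri M (.loop rl (M - 1) compareSwap)).exec ω σ).rarr out t =
      sorted o t := by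
  have cw : compareSwap.WritesOnly {ri, rl} {tmp} ∅ {out} := by
    simp [compareSwap, block, Cmd.WritesOnly]
  have key := exec_loop_induction (ω := ω) (r := ri) (e := M) (k := m)
    (c := .loop rl (M - 1) compareSwap) (σ := σ) hm
    (fun i τ => Agrees {ri, rl} {tmp} ∅ {out} σ τ ∧ Rearranged o (τ.rarr out) ∧
      ∀ b < m, m ≤ b + i → ∀ a < b, τ.rarr out a ≤ τ.rarr out b)
    ⟨Agrees.charge .refl, ⟨1, fun t => by simpa using h t⟩, fun b hb hb' => by omega⟩ ?_
  · obtain ⟨_, ⟨π, hπ⟩, h2⟩ := key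
    generalize (Cmd.loop ri M (.loop rl (M - 1) compareSwap)).exec ω σ = τ at hπ h2
    have mono : Monotone (o ∘ π) := by
      intro a b hab
      simp only [Function.comp_apply, ← hπ]
      rcases hab.eq_or_lt with rfl | hlt
      · exact le_rfl
      · exact h2 b b.2 (by omega) a hlt
    have := Tuple.unique_monotone (f := o) (Tuple.monotone_sort o) mono
    intro t
    rw [hπ]
    exact (congrFun this t).symm
  · rintro i hi τ ⟨h1, h2, h3⟩
    have h1' := h1.enter (r := ri) (v := i) (by simp)
    have := exec_loop_induction (ω := ω) (r := rl) (e := M - 1) (k := m - 1)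
      (c := compareSwap) (σ := τ.enter ri i)
      (by rw [eval_sub, eval_M, h1'.nreg rm (by simp [rm, ri, rl]), hm]; rfl)
      (fun l ρ => Agrees {ri, rl} {tmp} ∅ {out} σ ρ ∧ Rearranged o (ρ.rarr out) ∧
        Bubble m i l (ρ.rarr out))
      ⟨h1'.charge, h2, ⟨h3, by simp, fun b hb _ _ a ha => by omega⟩⟩ ?_
    · exact ⟨this.1, this.2.1, fun b hb hb' => this.2.2.next b (by omega) hb (by omega)⟩
    · rintro l hl ρ ⟨g1, g2, g3⟩
      have e := exec_compareSwap (ω := ω) (σ := ρ.enter rl l) (l := l) (by simp)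
      rw [State.enter_rarr] at e
      refine ⟨(g1.enter (by simp)).trans (cw.agrees _), ?_, g3.step (by omega) e⟩
      rw [e]
      split_ifs
      · exact g2.swap (by omega)
      · exact g2

/-- The real numbers that the program draws for the interval sequence `s`, before sorting. -/
def samples (p : Params m) (x : Fin n → ℝ) (s : Fin m → Fin (n + 1)) (ω : ℕ → unitInterval) :
    Fin m → ℝ :=
  fun l => pad p.a p.b x (s l) + (ω l : ℝ) * tau p x (s l)

lemma exec_output {d : ℕ} {s : Fin m → Fin (n + 1)} (h : Ready p x σ) (hd : σ.draws = d)
    (hs : HoldsSeq s σ) :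
    (output.exec ω σ).rarr tab = σ.rarr tab ∧ HoldsSeq s (output.exec ω σ) ∧
      ∀ t : Fin m, (output.exec ω σ).rarr out t =
        sorted (samples p x s fun t => ω (d + t)) t := by
  simp only [output, exec_block_cons, exec_block_nil]
  set body : Cmd := .seq (.rand unif)
    (.putR out L (.get xs (.get sqn L) + .var unif * tauE (.get sqn L))) with hbody
  have key := exec_loop_induction (ω := ω) (r := rl) (e := M) (k := m) (c := body) (σ := σ) h.rm
    (fun v τ => Ready p x τ ∧ τ.rarr tab = σ.rarr tab ∧ τ.draws = d + v ∧ HoldsSeq s τ ∧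
      ∀ t : Fin m, (t : ℕ) < v → τ.rarr out t = samples p x s (fun t => ω (d + t)) t)
    ⟨⟨h.rn, h.rm, h.reps, h.xs, h.gaps⟩, rfl, hd, hs, by simp⟩ ?_
  · obtain ⟨k1, k2, _, k3, k4⟩ := key
    generalize (Cmd.loop rl M body).exec ω σ = σ1 at k1 k2 k3 k4
    have a : Agrees {ri, rl} {tmp} ∅ {out} σ1
        ((Cmd.loop ri M (.loop rl (M - 1) compareSwap)).exec ω σ1) :=
      Cmd.WritesOnly.agrees (by simp [compareSwap, block, Cmd.WritesOnly]) _
    refine ⟨(a.rarr tab (by simp [tab, out])).trans k2, fun t => ?_,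
      exec_bubbleSort k1.rm fun t => k4 t t.2⟩
    exact (congrFun (a.narr sqn (by simp)) _).trans (k3 t)
  · rintro v hv τ ⟨k1, k2, k3, k4, k5⟩
    set τ1 := (Cmd.rand unif).exec ω (τ.enter rl v) with hτ1
    have c1 : Ready p x τ1 := by
      refine ⟨?_, ?_, ?_, k1.xs, k1.gaps⟩
      · simpa [hτ1, Cmd.exec, rn, rl] using k1.rn
      · simpa [hτ1, Cmd.exec, rm, rl] using k1.rm
      · simpa [hτ1, Cmd.exec, reps, unif] using k1.reps
    have c3 : τ1.draws = d + (v + 1) := by simp [hτ1, Cmd.exec, k3]; ring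
    have c4 : τ1.nreg rl = v := by simp [hτ1, Cmd.exec]
    have c5 : HoldsSeq s τ1 := k4
    have c6 : τ1.rreg unif = ω (d + v) := by simp [hτ1, Cmd.exec, k3]
    have a : Agrees ∅ ∅ ∅ {out} τ1 ((Cmd.putR out L (.get xs (.get sqn L) +
        .var unif * tauE (.get sqn L))).exec ω τ1) :=
      Cmd.WritesOnly.agrees (by simp [Cmd.WritesOnly]) _
    refine ⟨c1.of_agrees a (by simp) (by simp) (by simp) (by simp [xs, out]) (by simp [gaps, out]),
      (a.rarr tab (by simp [tab, out])).trans k2, a.draws.trans c3,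
      fun t => (congrFun (a.narr sqn (by simp)) _).trans (c5 t), fun t ht => ?_⟩
    change ((Cmd.putR out L (.get xs (.get sqn L) +
        .var unif * tauE (.get sqn L))).exec ω τ1).rarr out t = _
    simp only [Cmd.exec, State.writeRArr_rarr, Function.update_self, eval_L, c4]
    rcases Nat.lt_succ_iff_lt_or_eq.1 ht with hlt | heq
    · rw [Function.update_of_ne hlt.ne]
      exact k5 t hlt
    · have e : (NExp.get sqn L).eval τ1 = s t := by
        rw [eval_get, eval_L, c4, ← heq]; exact c5 t
      have hst : (s t : ℕ) ≤ n := Nat.lt_succ_iff.1 (s t).2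
      rw [heq, Function.update_self, reval_add, reval_get, reval_mul, reval_var,
        c1.eval_tauE e hst, e, c1.xs _ (by omega), c6, samples, heq]

/-- The program fills the table, and its result is a function of the uniform numbers: the first `m` of
them determine the interval sequence, and the next `m` the points in its intervals. -/
theorem exec_jointExp (hm : 1 ≤ m) (p : Params m) (x : Fin n → ℝ) (ω : ℕ → unitInterval) :
    TableUpTo p x m (final toeplitz p x ω) ∧
      result m (final toeplitz p x ω) =
        (fun t => (run p x m m (fun _ => 0) ω t : ℕ),
          sorted (samples p x (run p x m m (fun _ => 0) ω) fun t => ω (m + t))) := by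
  simp only [final, jointExp, exec_block_cons, exec_block_nil]
  obtain ⟨r1, a1⟩ := exec_setup (ω := ω) (p := p) (x := x)
  generalize setup.exec ω (init p x) = σ1 at r1 a1
  obtain ⟨r2, t2, a2⟩ := exec_forward (ω := ω) hm r1 (fun l => by
    rw [a1.rarr tab (by simp [tab, xs, qs, gaps])]; simp [init, tab, inX, inQ])
  have d2 : ((forward toeplitz).exec ω σ1).draws = 0 := a2.draws.trans a1.draws
  have s2 : HoldsSeq (fun _ : Fin m => (0 : Fin (n + 1))) ((forward toeplitz).exec ω σ1) := by
    intro t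
    rw [a2.narr sqn (by simp [sqn]), a1.narr sqn (by simp)]
    simp [init]
  generalize (forward toeplitz).exec ω σ1 = σ2 at r2 t2 d2 s2
  obtain ⟨r3, t3, d3, s3⟩ := exec_backwardPass (ω := ω) r2 t2 d2 s2
  simp only [zero_add] at d3 s3
  generalize backwardPass.exec ω σ2 = σ3 at r3 t3 d3 s3
  obtain ⟨t4, s4, o4⟩ := exec_output (ω := ω) r3 d3 s3
  refine ⟨fun j i k h1 h2 h3 h4 => by rw [t4, t3, t2 j i k h1 h2 h3 h4], ?_⟩
  exact Prod.ext (funext s4) (funext o4)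

end Prog

end

section

/-! ### The law of the interval sequence -/

variable {n m : ℕ} {p : Params m} {x : Fin n → ℝ}

lemma sum_mul_drawProp {ι : Type*} [Fintype ι] [Nonempty ι] (w : ι → ℝ) (i : ι) :
    (∑ i, ENNReal.ofReal (w i)) * drawProp w i = ENNReal.ofReal (w i) := by
  have htop : ∑ i, ENNReal.ofReal (w i) ≠ ⊤ := ENNReal.sum_ne_top.2 fun _ _ => ENNReal.ofReal_ne_top
  by_cases h : ∑ i, ENNReal.ofReal (w i) ≠ 0
  · rw [drawProp, dif_pos h, PMF.normalize_apply, tsum_fintype, mul_comm, mul_assoc,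
      ENNReal.inv_mul_cancel h htop, mul_one]
  · rw [not_not] at h
    rw [h, zero_mul]
    exact ((Finset.sum_eq_zero_iff.1 h) i (Finset.mem_univ i)).symm

lemma phi_nonneg (i i' j : ℕ) : 0 ≤ phi p n i i' j := by
  rw [phi]; split_ifs <;> positivity

lemma phi_eq_zero {i i' : ℕ} (h : i' < i) (j : ℕ) : phi p n i i' j = 0 := by
  rw [phi, if_neg (by omega)]

lemma edge_nonneg (s : Fin m → Fin (n + 1)) (j i : ℕ) : 0 ≤ edge p s j i := by
  rw [edge]; split_ifs
  · exact phi_nonneg _ _ _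
  · exact le_rfl
  · exact phi_nonneg _ _ _

lemma pad_of_le {lo hi : ℝ} (x : Fin n → ℝ) {i : ℕ} (h : i < n) : pad lo hi x (i + 1) = x ⟨i, h⟩ := by
  simp [pad, h]

/-- The sorted data, padded with the ends of the range, is nondecreasing. -/
lemma pad_mono {lo hi : ℝ} (hlo : lo ≤ hi) (hx : Monotone x) (hmem : ∀ i, x i ∈ Set.Icc lo hi) :
    Monotone (pad lo hi x) := by
  refine monotone_nat_of_le_succ fun i => ?_
  rcases i with _ | i
  · simp only [pad]
    split_ifs
    · exact (hmem _).1
    · exact hlo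
  · simp only [pad]
    split_ifs with h1 h2
    · exact hx (Nat.le_succ i)
    · exact (hmem _).2
    · omega
    · exact le_rfl

lemma pad_mem {lo hi : ℝ} (hlo : lo ≤ hi) (hmem : ∀ i, x i ∈ Set.Icc lo hi) (l : ℕ) :
    pad lo hi x l ∈ Set.Icc lo hi := by
  rcases l with _ | l
  · exact ⟨le_rfl, hlo⟩
  · simp only [pad]
    split_ifs
    · exact hmem _
    · exact ⟨hlo, le_rfl⟩

lemma tau_nonneg (hp : p.a < p.b) (hx : Monotone x) (hmem : ∀ i, x i ∈ Set.Icc p.a p.b) (i : ℕ) :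
    0 ≤ tau p x i :=
  sub_nonneg.2 (pad_mono hp.le hx hmem (Nat.le_succ i))

lemma exists_tau_pos (hp : p.a < p.b) (x : Fin n → ℝ) : ∃ i : Fin (n + 1), 0 < tau p x i := by
  by_contra! h
  have hsum : ∑ i ∈ Finset.range (n + 1), tau p x i = p.b - p.a := by
    simp only [tau]
    rw [Finset.sum_range_sub]
    simp [pad]
  have : ∑ i ∈ Finset.range (n + 1), tau p x i ≤ 0 :=
    Finset.sum_nonpos fun i hi => h ⟨i, Finset.mem_range.1 hi⟩
  linarith

/-- The total weight of all initial pieces of length `j` that are followed by an entry `i` outside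
the last block. -/
def totalBefore (p : Params m) (x : Fin n → ℝ) : ℕ → ℕ → ℝ
  | 0, i => phi p n 0 i 1
  | j + 1, i => ∑ i' ∈ Finset.range i, phi p n i' i (j + 2) *
      ∑ k ∈ Finset.Icc 1 (j + 1), alpha p x (j + 1) i' k

/-- The weight of a last block of `κ + 1` entries `i` at the end of the first `j + 1` positions. -/
def blockWeight (p : Params m) (x : Fin n → ℝ) : ℕ → ℕ → ℕ → ℝ
  | 0, _, i => tau p x i
  | _ + 1, 0, _ => 0
  | κ + 1, j + 1, i => tau p x i * phi p n i i (j + 2) * blockWeight p x κ j i / ((κ : ℝ) + 2)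

/-- The dynamic program splits off the last block. -/
lemma alpha_eq_blockWeight_mul : ∀ {κ j : ℕ} (i : ℕ), κ ≤ j →
    alpha p x (j + 1) i (κ + 1) = blockWeight p x κ j i * totalBefore p x (j - κ) i
  | 0, 0, i, _ => by simp [alpha, blockWeight, totalBefore, mul_comm]
  | 0, j + 1, i, _ => by simp [alpha, blockWeight, totalBefore]
  | κ + 1, j + 1, i, h => by
    rw [alpha, blockWeight, alpha_eq_blockWeight_mul (κ := κ) (j := j) i (by omega),
      Nat.add_sub_add_right]
    ring

lemma blockWeight_nonneg (hτ : ∀ i, 0 ≤ tau p x i) : ∀ κ j i : ℕ, 0 ≤ blockWeight p x κ j i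
  | 0, _, i => hτ i
  | _ + 1, 0, _ => le_rfl
  | κ + 1, j + 1, i => by
    rw [blockWeight]
    have := blockWeight_nonneg hτ κ j i
    have := hτ i
    have := phi_nonneg (p := p) (n := n) i i (j + 2)
    positivity

lemma alpha_nonneg (hτ : ∀ i, 0 ≤ tau p x i) : ∀ j i k : ℕ, 0 ≤ alpha p x j i k
  | 0, _, _ => by rw [alpha]
  | 1, i, k => by
    rw [alpha]
    split_ifs
    · exact mul_nonneg (phi_nonneg _ _ _) (hτ i)
    · exact le_rfl
  | _ + 2, _, 0 => by rw [alpha]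
  | j + 2, i, 1 => by
    rw [alpha]
    exact mul_nonneg (hτ i) (Finset.sum_nonneg fun i' _ => mul_nonneg (phi_nonneg _ _ _)
      (Finset.sum_nonneg fun k _ => alpha_nonneg hτ (j + 1) i' k))
  | j + 2, i, k + 2 => by
    rw [alpha]
    have := alpha_nonneg hτ (j + 1) i (k + 1)
    have := hτ i
    have := phi_nonneg (p := p) (n := n) i i (j + 2)
    positivity

/-- The number of entries up to position `l` (counted from `0`) that are equal to entry `l`. -/
def multiplicity (t : Fin m → Fin (n + 1)) (l : ℕ) : ℕ :=
  ((Finset.range (l + 1)).filter fun l' => padSeq t (l' + 1) = padSeq t (l + 1)).card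

/-- The weight of the first `j` entries of an interval sequence. -/
def prefixWeight (p : Params m) (x : Fin n → ℝ) (j : ℕ) (t : Fin m → Fin (n + 1)) : ℝ :=
  ∏ l ∈ Finset.range j, phi p n (padSeq t l) (padSeq t (l + 1)) (l + 1) *
    tau p x (padSeq t (l + 1)) / multiplicity t l

lemma padSeq_succ (t : Fin m → Fin (n + 1)) {l : ℕ} (h : l < m) : padSeq t (l + 1) = t ⟨l, h⟩ := by
  simp [padSeq, h]

lemma prefixWeight_eq_zero {t : Fin m → Fin (n + 1)} {j j' : ℕ} (h : j ≤ j')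
    (h0 : prefixWeight p x j t = 0) : prefixWeight p x j' t = 0 := by
  rw [prefixWeight, Finset.prod_eq_zero_iff] at h0 ⊢
  obtain ⟨l, hl, h0⟩ := h0
  exact ⟨l, Finset.mem_range.2 ((Finset.mem_range.1 hl).trans_le h), h0⟩

lemma padSeq_le_of_prefixWeight_ne_zero {t : Fin m → Fin (n + 1)} {j : ℕ}
    (h : prefixWeight p x j t ≠ 0) {l : ℕ} (hl : l ≤ j) : padSeq t l ≤ padSeq t j := by
  induction j, hl using Nat.le_induction with
  | base => exact le_rfl
  | succ j hlj ih =>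
    refine (ih fun h0 => h (prefixWeight_eq_zero (Nat.le_succ j) h0)).trans ?_
    by_contra hlt
    refine h (Finset.prod_eq_zero (Finset.mem_range.2 (Nat.lt_succ_self j)) ?_)
    rw [phi_eq_zero (not_le.1 hlt), zero_mul, zero_div]

/-- The weight of an initial piece splits off a block of equal entries at its end. -/
lemma prefixWeight_block {t : Fin m → Fin (n + 1)} {i : ℕ} : ∀ {κ j : ℕ}, κ ≤ j →
    (∀ l, j - κ ≤ l → l ≤ j → padSeq t (l + 1) = i) → (∀ l < j - κ, padSeq t (l + 1) ≠ i) →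
    prefixWeight p x (j + 1) t = blockWeight p x κ j i *
      (prefixWeight p x (j - κ) t * phi p n (padSeq t (j - κ)) i (j - κ + 1)) := by
  intro κ
  induction κ with
  | zero =>
    intro j _ h1 h2
    have hj := h1 j (by simp) le_rfl
    have hmult : multiplicity t j = 1 := by
      rw [multiplicity, hj, Finset.card_eq_one]
      refine ⟨j, ?_⟩
      ext l
      simp only [Finset.mem_filter, Finset.mem_range, Finset.mem_singleton]
      constructor
      · rintro ⟨g1, g2⟩
        by_contra hne
        exact h2 l (by omega) g2
      · rintro rfl
        exact ⟨by omega, hj⟩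
    rw [prefixWeight, Finset.prod_range_succ, hj, hmult, ← prefixWeight, blockWeight]
    simp only [Nat.sub_zero, Nat.cast_one, div_one]
    ring
  | succ κ ih =>
    intro j hκ h1 h2
    obtain ⟨j, rfl⟩ : ∃ j', j = j' + 1 := ⟨j - 1, by omega⟩
    rw [Nat.add_sub_add_right] at h1 h2 ⊢
    have hj := h1 (j + 1) (by omega) le_rfl
    have hj' := h1 j (by omega) (by omega)
    have hmult : multiplicity t (j + 1) = κ + 2 := by
      have : (Finset.range (j + 1 + 1)).filter (fun l' => padSeq t (l' + 1) = padSeq t (j + 1 + 1)) =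
          Finset.Ico (j - κ) (j + 2) := by
        ext l
        simp only [Finset.mem_filter, Finset.mem_range, Finset.mem_Ico, hj]
        constructor
        · rintro ⟨g1, g2⟩
          refine ⟨?_, by omega⟩
          by_contra hne
          exact h2 l (by omega) g2
        · rintro ⟨g1, g2⟩
          exact ⟨by omega, h1 l g1 (by omega)⟩
      rw [multiplicity, this, Nat.card_Ico]
      omega
    rw [prefixWeight, Finset.prod_range_succ, ← prefixWeight,
      ih (j := j) (by omega) (fun l g1 g2 => h1 l g1 (by omega)) h2, hj, hj', hmult, blockWeight]
    push_cast
    ring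

/-- The weight of the sequence `t`, relative to the continuation `s`, in a backward pass that has
still to sample positions `1, …, j`. -/
def jointWeight (p : Params m) (x : Fin n → ℝ) (j : ℕ) (s t : Fin m → Fin (n + 1)) : ℝ :=
  if ∀ l : Fin m, j ≤ l → t l = s l then
    prefixWeight p x j t *
      if h : 0 < m ∧ j = 0 then phi p n 0 (s ⟨0, h.1⟩) 1 else edge p s j (padSeq t j)
  else 0

/-- The recursion for the weights, by the last block of equal entries among the first `j + 1`. -/
lemma jointWeight_succ {j : ℕ} (hj : j < m) (s t : Fin m → Fin (n + 1)) :
    jointWeight p x (j + 1) s t = ∑ r : Fin (n + 1) × Fin (j + 1),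
      blockWeight p x r.2 j r.1 * edge p s (j + 1) r.1 *
        jointWeight p x (j - r.2) (fillIn j s r) t := by
  have agree : ∀ r : Fin (n + 1) × Fin (j + 1),
      (∀ l : Fin m, j - r.2 ≤ (l : ℕ) → t l = fillIn j s r l) →
      (∀ l : Fin m, j + 1 ≤ (l : ℕ) → t l = s l) ∧
        ∀ l : Fin m, j - r.2 ≤ (l : ℕ) → (l : ℕ) ≤ j → t l = r.1 := by
    intro r h
    refine ⟨fun l hl => ?_, fun l hl hl' => ?_⟩
    · rw [h l (by omega), fillIn, if_neg (by omega)]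
    · rw [h l hl, fillIn, if_pos ⟨hl, hl'⟩]
  by_cases hs : ∀ l : Fin m, j + 1 ≤ (l : ℕ) → t l = s l
  swap
  · rw [jointWeight, if_neg hs]
    refine (Finset.sum_eq_zero fun r _ => ?_).symm
    rw [jointWeight, if_neg fun h => hs (agree r h).1, mul_zero]
  set i := t ⟨j, hj⟩ with hi
  -- `κ + 1` is the length of the last block
  obtain ⟨κ, hκj, hκ1, hκ2⟩ : ∃ κ ≤ j, (∀ l : Fin m, j - κ ≤ (l : ℕ) → (l : ℕ) ≤ j → t l = i) ∧
      ∀ h : κ < j, t ⟨j - κ - 1, by omega⟩ ≠ i := by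
    classical
    set P : ℕ → Prop := fun κ => ∀ l : Fin m, j - κ ≤ (l : ℕ) → (l : ℕ) ≤ j → t l = i with hP
    have h0 : P 0 := by
      intro l h1 h2
      have : l = ⟨j, hj⟩ := Fin.ext (by simp at h1 ⊢; omega)
      rw [this]
    refine ⟨Nat.findGreatest P j, Nat.findGreatest_le j, Nat.findGreatest_spec (Nat.zero_le j) h0,
      fun h heq => ?_⟩
    refine Nat.findGreatest_is_greatest (P := P) (Nat.lt_succ_self _) (n := j) h fun l h1 h2 => ?_
    rcases eq_or_ne (l : ℕ) (j - Nat.findGreatest P j - 1) with he | hne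
    · have : l = ⟨j - Nat.findGreatest P j - 1, by omega⟩ := Fin.ext he
      rw [this, heq]
    · exact Nat.findGreatest_spec (P := P) (Nat.zero_le j) h0 l (by omega) h2
  have hpad : ∀ l, j - κ ≤ l → l ≤ j → padSeq t (l + 1) = i := by
    intro l h1 h2
    rw [padSeq_succ t (by omega : l < m), hκ1 ⟨l, by omega⟩ h1 h2]
  rw [Finset.sum_eq_single (i, ⟨κ, by omega⟩)]
  · have hagree : ∀ l : Fin m, j - κ ≤ (l : ℕ) → t l = fillIn j s (i, ⟨κ, by omega⟩) l := by
      intro l hl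
      rw [fillIn]
      split_ifs with h
      · exact hκ1 l hl h.2
      · simp only at h
        exact hs l (by omega)
    -- the factor that links the last block to the rest
    have hlink : (if h : 0 < m ∧ j - κ = 0 then
          phi p n 0 (fillIn j s (i, ⟨κ, by omega⟩) ⟨0, h.1⟩ : Fin (n + 1)) 1
        else edge p (fillIn j s (i, ⟨κ, by omega⟩)) (j - κ) (padSeq t (j - κ))) =
        phi p n (padSeq t (j - κ)) i (j - κ + 1) := by
      split_ifs with h
      · rw [← hagree ⟨0, h.1⟩ h.2.le, hκ1 ⟨0, h.1⟩ h.2.le (Nat.zero_le _), h.2]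
        rfl
      · have hpos : 0 < j - κ := Nat.pos_of_ne_zero fun h0 => h ⟨by omega, h0⟩
        have hval : fillIn j s (i, ⟨κ, by omega⟩) ⟨j - κ, by omega⟩ = i := by
          rw [← hagree ⟨j - κ, by omega⟩ le_rfl, hκ1 ⟨j - κ, by omega⟩ le_rfl (Nat.sub_le _ _)]
        rw [edge, dif_pos (by omega), hval]
        have hne : padSeq t (j - κ) ≠ i := by
          have e : j - κ = (j - κ - 1) + 1 := by omega
          rw [e, padSeq_succ t (by omega)]
          exact fun h => hκ2 (by omega) (Fin.ext h)
        split_ifs with hlt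
        · rfl
        · rw [phi_eq_zero (by omega)]
    rw [jointWeight, if_pos hs, jointWeight, if_pos hagree, hlink, dif_neg (by omega),
      padSeq_succ t hj, ← hi]
    by_cases h0 : prefixWeight p x (j - κ) t * phi p n (padSeq t (j - κ)) i (j - κ + 1) = 0
    · rw [h0, mul_zero]
      have : prefixWeight p x (j - κ + 1) t = 0 := by
        rw [prefixWeight, Finset.prod_range_succ, ← prefixWeight, hpad (j - κ) le_rfl (by omega),
          mul_div_assoc, ← mul_assoc, h0, zero_mul]
      rw [prefixWeight_eq_zero (by omega) this, zero_mul]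
    · rw [prefixWeight_block hκj hpad]
      · simp only
        ring
      · intro l hl heq
        have h1 := padSeq_le_of_prefixWeight_ne_zero (left_ne_zero_of_mul h0)
          (show l + 1 ≤ j - κ by omega)
        have h2 : padSeq t (j - κ) ≤ i := by
          by_contra hlt
          exact right_ne_zero_of_mul h0 (phi_eq_zero (not_le.1 hlt) _)
        have e : j - κ = (j - κ - 1) + 1 := by omega
        refine hκ2 (by omega) (Fin.ext ?_)
        rw [e, padSeq_succ t (by omega : j - κ - 1 < m)] at h1 h2
        omega
  · rintro ⟨i', κ', hκ'⟩ _ hne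
    rw [jointWeight]
    split_ifs with h hzero
    · -- a block that starts at the first position
      exfalso
      have h1 := (agree _ h).2
      simp only at h1 hzero
      have e1 : i = i' := h1 ⟨j, hj⟩ (by simp) le_rfl
      refine hne (Prod.ext e1.symm (Fin.ext ?_))
      simp only
      by_contra hκne
      exact hκ2 (by omega) ((h1 _ (by simp; omega) (by simp; omega)).trans e1.symm)
    · have h1 := (agree _ h).2
      simp only at h1 hzero h
      have e1 : i = i' := h1 ⟨j, hj⟩ (by simp) le_rfl
      have hpos : 0 < j - κ' := Nat.pos_of_ne_zero fun h0 => hzero ⟨by omega, h0⟩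
      have hκne : κ' ≠ κ := fun heq => hne (Prod.ext e1.symm (Fin.ext heq))
      rcases lt_or_gt_of_ne hκne with hlt | hlt
      · -- a block that is too short is linked to an equal entry
        have e2 : padSeq t (j - κ') = i := by
          have e : j - κ' = (j - κ' - 1) + 1 := by omega
          rw [e]
          exact hpad (j - κ' - 1) (by omega) (by omega)
        have e3 : fillIn j s (i', ⟨κ', hκ'⟩) ⟨j - κ', by omega⟩ = i := by
          rw [fillIn, if_pos ⟨le_rfl, Nat.sub_le _ _⟩, e1]
        simp only [edge]
        rw [dif_pos (by omega : j - κ' < m), e2, e3, if_neg (lt_irrefl _), mul_zero, mul_zero]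
      · exact absurd ((h1 _ (by simp; omega) (by simp; omega)).trans e1.symm) (hκ2 (by omega))
    · rw [mul_zero]
  · intro h
    exact absurd (Finset.mem_univ _) h

/-- The total weight in a draw of the backward pass. -/
def totalWeight (p : Params m) (x : Fin n → ℝ) (j : ℕ) (s : Fin m → Fin (n + 1)) : ℝ :=
  if h : j < m then totalBefore p x j (s ⟨j, h⟩)
  else ∑ r : Fin (n + 1) × Fin j, alpha p x j r.1 (r.2 + 1) * edge p s j r.1

lemma sum_alpha_mul_edge (j : ℕ) (s : Fin m → Fin (n + 1)) :
    ∑ r : Fin (n + 1) × Fin (j + 1), alpha p x (j + 1) r.1 (r.2 + 1) * edge p s (j + 1) r.1 =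
      totalWeight p x (j + 1) s := by
  rw [totalWeight]
  split_ifs with h
  · have hs : (s ⟨j + 1, h⟩ : ℕ) ≤ n + 1 := (s ⟨j + 1, h⟩).2.le
    rw [Fintype.sum_prod_type, totalBefore]
    calc _ = ∑ i ∈ Finset.range (n + 1), if i < (s ⟨j + 1, h⟩ : ℕ) then
          phi p n i (s ⟨j + 1, h⟩) (j + 2) * ∑ k ∈ Finset.Icc 1 (j + 1), alpha p x (j + 1) i k
          else 0 := by
          rw [Finset.sum_range]
          refine Finset.sum_congr rfl fun i _ => ?_
          simp only [edge, dif_pos h]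
          split_ifs with hi
          · rw [← Finset.sum_mul, mul_comm]
            congr 1
            rw [← Finset.sum_range (fun k => alpha p x (j + 1) i (k + 1)), Finset.range_eq_Ico,
              Finset.sum_Ico_add' (fun k => alpha p x (j + 1) i k)]
            rfl
          · simp
      _ = _ := by
          rw [← Finset.sum_filter]
          refine Finset.sum_congr ?_ fun _ _ => rfl
          ext i; simp; omega
  · rfl

/-- In every draw of the backward pass, the weight of a pair is the weight of its block times the
total weight of the draw that follows. -/
lemma alpha_eq_blockWeight_mul_totalWeight {j : ℕ} (hj : j < m) (s : Fin m → Fin (n + 1))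
    (r : Fin (n + 1) × Fin (j + 1)) : alpha p x (j + 1) r.1 (r.2 + 1) =
      blockWeight p x r.2 j r.1 * totalWeight p x (j - r.2) (fillIn j s r) := by
  rw [alpha_eq_blockWeight_mul _ (Nat.lt_succ_iff.1 r.2.2), totalWeight, dif_pos (by omega), fillIn,
    if_pos ⟨le_rfl, by simp⟩]

/-- The law of the backward pass. Both sides vanish if no sequence has positive weight. -/
theorem totalWeight_mul_backward (hm : 0 < m) (hτ : ∀ i, 0 ≤ tau p x i) (t : Fin m → Fin (n + 1))
    (j : ℕ) : ∀ s, j ≤ m → ENNReal.ofReal (totalWeight p x j s) * backward p x j s t =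
      ENNReal.ofReal (jointWeight p x j s t) := by
  induction j using Nat.strong_induction_on with
  | _ j ih =>
  intro s hj
  have jw : ∀ j s, 0 ≤ jointWeight p x j s t := by
    intro j s
    rw [jointWeight]
    split_ifs
    · refine mul_nonneg (Finset.prod_nonneg fun l _ => ?_) (phi_nonneg _ _ _)
      exact div_nonneg (mul_nonneg (phi_nonneg _ _ _) (hτ _)) (Nat.cast_nonneg _)
    · refine mul_nonneg (Finset.prod_nonneg fun l _ => ?_) (edge_nonneg _ _ _)
      exact div_nonneg (mul_nonneg (phi_nonneg _ _ _) (hτ _)) (Nat.cast_nonneg _)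
    · exact le_rfl
  rcases j with _ | j
  · rw [backward, totalWeight, dif_pos hm, totalBefore, PMF.pure_apply, jointWeight]
    by_cases h : t = s
    · subst h
      simp [prefixWeight, hm]
    · rw [if_neg h, if_neg fun h' => h (funext fun l => h' l (Nat.zero_le _))]
      simp
  · have w0 : ∀ r : Fin (n + 1) × Fin (j + 1),
        0 ≤ alpha p x (j + 1) r.1 (r.2 + 1) * edge p s (j + 1) r.1 :=
      fun r => mul_nonneg (alpha_nonneg hτ _ _ _) (edge_nonneg _ _ _)
    have b0 : ∀ r : Fin (n + 1) × Fin (j + 1),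
        0 ≤ blockWeight p x r.2 j r.1 * edge p s (j + 1) r.1 :=
      fun r => mul_nonneg (blockWeight_nonneg hτ _ _ _) (edge_nonneg _ _ _)
    rw [← sum_alpha_mul_edge, ENNReal.ofReal_sum_of_nonneg fun r _ => w0 r, backward,
      PMF.bind_apply, tsum_fintype, Finset.mul_sum, jointWeight_succ (by omega),
      ENNReal.ofReal_sum_of_nonneg fun r _ => mul_nonneg (b0 r) (jw _ _)]
    refine Finset.sum_congr rfl fun r _ => ?_
    rw [← mul_assoc, sum_mul_drawProp, ENNReal.ofReal_mul (b0 r),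
      ← ih (j - r.2) (by omega) (fillIn j s r) (by omega),
      alpha_eq_blockWeight_mul_totalWeight (by omega) s r,
      show blockWeight p x r.2 j r.1 * totalWeight p x (j - r.2) (fillIn j s r) *
          edge p s (j + 1) r.1 = blockWeight p x r.2 j r.1 * edge p s (j + 1) r.1 *
          totalWeight p x (j - r.2) (fillIn j s r) by ring, ENNReal.ofReal_mul (b0 r), mul_assoc]
    rfl

/-- The factorials of the multiplicities, as a product over the positions. -/
lemma gamma_eq_prod (t : Fin m → Fin (n + 1)) :
    gamma t = ∏ l ∈ Finset.range m, multiplicity t l := by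
  set cnt : ℕ → ℕ → ℕ := fun j i => ((Finset.range j).filter fun l => padSeq t (l + 1) = i).card
    with hcnt
  have key : ∀ j ≤ m, ∏ i : Fin (n + 1), (cnt j i).factorial =
      ∏ l ∈ Finset.range j, multiplicity t l := by
    intro j
    induction j with
    | zero => intro _; simp [hcnt]
    | succ j ih =>
      intro hj
      rw [Finset.prod_range_succ, ← ih (by omega)]
      have step : ∀ i : Fin (n + 1), (cnt (j + 1) i).factorial =
          (cnt j i).factorial * if t ⟨j, hj⟩ = i then multiplicity t j else 1 := by
        intro i
        simp only [hcnt, Finset.range_add_one, Finset.filter_insert, padSeq_succ t hj]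
        by_cases h : t ⟨j, hj⟩ = i
        · subst h
          rw [if_pos rfl, if_pos rfl, Finset.card_insert_of_notMem (by simp), Nat.factorial_succ,
            mul_comm]
          congr 1
          rw [multiplicity, Finset.range_add_one, Finset.filter_insert, padSeq_succ t hj, if_pos rfl,
            Finset.card_insert_of_notMem (by simp)]
        · rw [if_neg h, if_neg fun h' => h (Fin.ext h'), mul_one]
      rw [Finset.prod_congr rfl fun i _ => step i, Finset.prod_mul_distrib,
        Finset.prod_ite_eq Finset.univ (t ⟨j, hj⟩) (fun _ => multiplicity t j),
        if_pos (Finset.mem_univ _)]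
  rw [← key m le_rfl, gamma]
  refine Finset.prod_congr rfl fun i _ => ?_
  congr 1
  rw [Fintype.card_subtype, hcnt]
  simp only
  rw [← Finset.card_map Fin.valEmbedding]
  congr 1
  ext l
  simp only [Finset.mem_map, Finset.mem_filter, Finset.mem_univ, true_and, Fin.valEmbedding_apply,
    Finset.mem_range]
  constructor
  · rintro ⟨k, hk, rfl⟩
    exact ⟨k.2, by rw [padSeq_succ t k.2, ← hk]⟩
  · rintro ⟨hl, h⟩
    exact ⟨⟨l, hl⟩, Fin.ext (by rw [← h, padSeq_succ t hl]), rfl⟩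

open Classical in
/-- The weights of `intervalLawQ'`. -/
def weightQ' (p : Params m) (x : Fin n → ℝ) (s : Fin m → Fin (n + 1)) : ℝ :=
  if Monotone s then
    Real.exp (p.ε * utilQ' p s / (2 * 2)) * (∏ j, tau p x (s j)) / (gamma s : ℝ)
  else 0

lemma weightQ'_eq (hm : 0 < m) (t s : Fin m → Fin (n + 1)) :
    weightQ' p x t = jointWeight p x m s t := by
  rw [jointWeight, if_pos fun l hl => absurd l.2 (by omega), dif_neg (by omega), edge,
    dif_neg (lt_irrefl _), prefixWeight, Finset.prod_div_distrib, Finset.prod_mul_distrib,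
    ← Nat.cast_prod, ← gamma_eq_prod]
  have hτ : ∏ l ∈ Finset.range m, tau p x (padSeq t (l + 1)) = ∏ j, tau p x (t j) := by
    rw [Finset.prod_range]
    exact Finset.prod_congr rfl fun j _ => by rw [padSeq_succ t j.2]
  have hlast : padSeq t (m + 1) = n := by simp [padSeq]
  have hφ : (∏ l ∈ Finset.range m, phi p n (padSeq t l) (padSeq t (l + 1)) (l + 1)) *
      phi p n (padSeq t m) n (m + 1) =
      ∏ l ∈ Finset.range (m + 1), phi p n (padSeq t l) (padSeq t (l + 1)) (l + 1) := by
    rw [Finset.prod_range_succ, hlast]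
  rw [hτ, div_mul_eq_mul_div, mul_right_comm, hφ, weightQ']
  split_ifs with hmono
  · congr 2
    have hle : ∀ l < m + 1, padSeq t l ≤ padSeq t (l + 1) := by
      intro l hl
      rcases l with _ | l
      · exact Nat.zero_le _
      · rw [padSeq_succ t (by omega)]
        rcases Nat.lt_or_ge (l + 1) m with h | h
        · rw [padSeq_succ t h]
          exact hmono (Fin.mk_le_mk.2 (Nat.le_succ l))
        · rw [show l + 1 = m by omega, hlast]
          exact Nat.lt_succ_iff.1 (t _).2
    rw [utilQ', show p.ε * -(∑ j ∈ Finset.Icc 1 (m + 1), |((padSeq t j : ℝ) - (padSeq t (j - 1) : ℝ))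
        - gap p n j|) / (2 * 2) = ∑ j ∈ Finset.Icc 1 (m + 1), -(p.ε / (2 * 2)) *
        |((padSeq t j : ℝ) - (padSeq t (j - 1) : ℝ)) - gap p n j| by
      rw [← Finset.mul_sum]; ring, Real.exp_sum]
    rw [show Finset.Icc 1 (m + 1) = Finset.Ico (0 + 1) (m + 1 + 1) from rfl,
      ← Finset.prod_Ico_add', ← Finset.range_eq_Ico]
    refine Finset.prod_congr rfl fun l hl => ?_
    rw [phi, if_pos (hle l (Finset.mem_range.1 hl)), Nat.add_sub_cancel]
  · have : ∃ l, ∃ h : l + 1 < m, t ⟨l + 1, h⟩ < t ⟨l, by omega⟩ := by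
      by_contra! hc
      refine hmono ?_
      intro a b hab
      obtain ⟨a, ha⟩ := a
      obtain ⟨b, hb⟩ := b
      have hab : a ≤ b := hab
      induction b, hab using Nat.le_induction with
      | base => exact le_rfl
      | succ b hab' ih =>
        exact (ih (by omega) hab').trans (hc b hb)
    obtain ⟨l, h, hlt⟩ := this
    rw [Finset.prod_eq_zero (Finset.mem_range.2 (show l + 1 < m + 1 by omega)), zero_mul, zero_div]
    rw [padSeq_succ t h, padSeq_succ t (by omega : l < m), phi_eq_zero hlt]

lemma weightQ'_nonneg (hτ : ∀ i, 0 ≤ tau p x i) (t : Fin m → Fin (n + 1)) : 0 ≤ weightQ' p x t := by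
  rw [weightQ']
  split_ifs
  · have := Finset.prod_nonneg fun (j : Fin m) (_ : j ∈ Finset.univ) => hτ (t j)
    positivity
  · exact le_rfl

lemma gamma_pos (t : Fin m → Fin (n + 1)) : 0 < gamma t :=
  Finset.prod_pos fun _ _ => Nat.factorial_pos _

lemma sum_weightQ'_pos (hp : p.a < p.b) (hτ : ∀ i, 0 ≤ tau p x i) :
    0 < ∑ t : Fin m → Fin (n + 1), weightQ' p x t := by
  obtain ⟨i, hi⟩ := exists_tau_pos hp x
  refine Finset.sum_pos' (fun t _ => weightQ'_nonneg hτ t) ⟨fun _ => i, Finset.mem_univ _, ?_⟩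
  have := gamma_pos fun _ : Fin m => i
  rw [weightQ', if_pos monotone_const]
  have h : 0 < ∏ _j : Fin m, tau p x i := Finset.prod_pos fun _ _ => hi
  positivity

lemma sum_weightQ'_mul_intervalLawQ' (hτ : ∀ i, 0 ≤ tau p x i) (t : Fin m → Fin (n + 1)) :
    ENNReal.ofReal (∑ t : Fin m → Fin (n + 1), weightQ' p x t) * intervalLawQ' p x t =
      ENNReal.ofReal (weightQ' p x t) := by
  rw [ENNReal.ofReal_sum_of_nonneg fun t _ => weightQ'_nonneg hτ t]
  exact sum_mul_drawProp (fun t => weightQ' p x t) t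

lemma totalWeight_eq (hm : 0 < m) (hτ : ∀ i, 0 ≤ tau p x i) (s : Fin m → Fin (n + 1)) :
    ENNReal.ofReal (totalWeight p x m s) =
      ENNReal.ofReal (∑ t : Fin m → Fin (n + 1), weightQ' p x t) := by
  rw [ENNReal.ofReal_sum_of_nonneg fun t _ => weightQ'_nonneg hτ t]
  have h1 := (backward p x m s).tsum_coe
  rw [tsum_fintype] at h1
  rw [← mul_one (ENNReal.ofReal (totalWeight p x m s)), ← h1, Finset.mul_sum]
  refine Finset.sum_congr rfl fun t _ => ?_
  rw [totalWeight_mul_backward hm hτ t m s le_rfl, weightQ'_eq hm t s]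

/-- The backward pass samples from the law of the interval sequence of `M_{Q'}`. -/
theorem intervalLaw_eq_intervalLawQ' (hm : 0 < m) (hp : p.a < p.b) (hτ : ∀ i, 0 ≤ tau p x i) :
    intervalLaw p x = intervalLawQ' p x := by
  refine PMF.ext fun t => ?_
  have h0 : ENNReal.ofReal (∑ t : Fin m → Fin (n + 1), weightQ' p x t) ≠ 0 := by
    simpa using sum_weightQ'_pos hp hτ
  refine (ENNReal.mul_right_inj h0 ENNReal.ofReal_ne_top).1 ?_
  rw [sum_weightQ'_mul_intervalLawQ' hτ, ← totalWeight_eq hm hτ fun _ => 0, intervalLaw,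
    totalWeight_mul_backward hm hτ t m _ le_rfl, weightQ'_eq hm]

end

section

/-! ### The law of the memory after a run with independent uniform numbers -/

variable {n m : ℕ} {p : Params m} {x : Fin n → ℝ}

/-- A stream of uniform numbers from its first number and the rest. -/
def consStream (z : unitInterval × (ℕ → unitInterval)) : ℕ → unitInterval
  | 0 => z.1
  | t + 1 => z.2 t

lemma measurable_consStream : Measurable consStream := by
  refine measurable_pi_iff.2 fun t => ?_
  cases t with
  | zero => exact measurable_fst
  | succ t => exact (measurable_pi_apply t).comp measurable_snd

instance : IsProbabilityMeasure Prog.source := by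
  unfold Prog.source; infer_instance

lemma source_pi_range (N : ℕ) {B : ℕ → Set unitInterval} (hB : ∀ t, MeasurableSet (B t)) :
    Prog.source (Set.pi (Finset.range N) B) = ∏ t ∈ Finset.range N, volume (B t) :=
  Measure.infinitePi_pi _ fun t _ => hB t

lemma measurePreserving_consStream :
    MeasurePreserving consStream (volume.prod Prog.source) Prog.source := by
  refine ⟨measurable_consStream, Measure.eq_infinitePi _ fun s t ht => ?_⟩
  classical
  obtain ⟨N, hN⟩ := s.exists_nat_subset_range
  have hB : ∀ i, MeasurableSet (if i ∈ s then t i else Set.univ) := by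
    intro i; split_ifs
    exacts [ht i, MeasurableSet.univ]
  have e1 : Set.pi (s : Set ℕ) t =
      Set.pi (Finset.range (N + 1)) fun i => if i ∈ s then t i else Set.univ := by
    ext ω
    simp only [Set.mem_pi, Finset.mem_coe]
    constructor
    · intro h i _
      split_ifs with his
      exacts [h i his, Set.mem_univ _]
    · intro h i his
      have := h i (Finset.mem_range.2 (by have := Finset.mem_range.1 (hN his); omega))
      rwa [if_pos his] at this
  have e2 : ∏ i ∈ s, (volume : Measure unitInterval) (t i) =
      ∏ i ∈ Finset.range (N + 1), volume (if i ∈ s then t i else Set.univ) := by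
    rw [← Finset.prod_subset (hN.trans (Finset.range_mono (Nat.le_succ N)))]
    · exact Finset.prod_congr rfl fun i hi => by rw [if_pos hi]
    · intro i _ hi
      rw [if_neg hi, measure_univ]
  have e3 : consStream ⁻¹' (Set.pi (Finset.range (N + 1)) fun i => if i ∈ s then t i else Set.univ) =
      (if 0 ∈ s then t 0 else Set.univ) ×ˢ
        Set.pi (Finset.range N) fun i => if i + 1 ∈ s then t (i + 1) else Set.univ := by
    ext z
    simp only [Set.mem_preimage, Set.mem_pi, Finset.mem_coe, Finset.mem_range, Set.mem_prod]
    constructor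
    · exact fun h => ⟨h 0 (by omega), fun i hi => h (i + 1) (by omega)⟩
    · rintro ⟨h0, h⟩ i hi
      cases i with
      | zero => exact h0
      | succ i => exact h i (by omega)
  rw [e1, e2, Measure.map_apply measurable_consStream
    (MeasurableSet.pi (Finset.countable_toSet _) fun i _ => hB i), e3, Measure.prod_prod,
    source_pi_range N fun i => hB (i + 1), Finset.prod_range_succ', mul_comm]

lemma lintegral_source {F : (ℕ → unitInterval) → ℝ≥0∞} (hF : Measurable F) :
    ∫⁻ ω, F ω ∂Prog.source = ∫⁻ u, ∫⁻ ω, F (consStream (u, ω)) ∂Prog.source ∂volume := by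
  rw [← measurePreserving_consStream.lintegral_comp hF]
  exact lintegral_prod _ (hF.comp measurable_consStream).aemeasurable

lemma lintegral_source_shift (R : ℕ) {F : (ℕ → unitInterval) → ℝ≥0∞} (hF : Measurable F) :
    ∫⁻ ω, F (fun t => ω (R + t)) ∂Prog.source = ∫⁻ ω, F ω ∂Prog.source := by
  have hs : ∀ R : ℕ, Measurable fun (ω : ℕ → unitInterval) t => ω (R + t) :=
    fun R => measurable_pi_iff.2 fun t => measurable_pi_apply _
  induction R with
  | zero => simp
  | succ R ih =>
    rw [lintegral_source (F := fun ω => F fun t => ω (R + 1 + t)) (hF.comp (hs (R + 1))), ← ih]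
    have : ∀ (u : unitInterval) (ω : ℕ → unitInterval),
        (fun t => consStream (u, ω) (R + 1 + t)) = fun t => ω (R + t) := by
      intro u ω
      funext t
      rw [show R + 1 + t = R + t + 1 by omega]; rfl
    simp [this]

/-! #### The law of one draw -/

lemma measurable_pick (f : ℕ → ℝ) (T : ℕ) : Measurable (pick f T) := by
  let D : ℝ → Fin T → Prop := fun u t =>
    u * ∑ v ∈ Finset.range T, f v < ∑ v ∈ Finset.range (t + 1), f v
  have hD : Measurable D := by
    refine measurable_pi_iff.2 fun t => measurableSet_setOfPred.1 ?_
    exact measurableSet_lt (measurable_id.mul_const _) measurable_const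
  have : pick f T = (fun P : Fin T → Prop => sInf {t | ∃ h : t < T, P ⟨t, h⟩}) ∘ D := by
    funext u
    simp only [pick, Function.comp_apply, D, exists_prop]
  rw [this]
  exact (Measurable.of_discrete).comp hD

/-- `pick` at a uniform number follows the law proportional to the weights. -/
lemma volume_pick_eq {f : ℕ → ℝ} (hf : ∀ t, 0 ≤ f t) {T : ℕ} {t : ℕ} (ht : t < T)
    (hS : 0 < ∑ v ∈ Finset.range T, f v) :
    volume {u : unitInterval | pick f T u = t} =
      ENNReal.ofReal (f t / ∑ v ∈ Finset.range T, f v) := by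
  set S := ∑ v ∈ Finset.range T, f v with hSdef
  set P : ℕ → ℝ := fun t => ∑ v ∈ Finset.range t, f v with hP
  have hmono : Monotone P := fun a b hab =>
    Finset.sum_le_sum_of_subset_of_nonneg (Finset.range_mono hab) fun v _ _ => hf v
  -- the event is the interval `[P t / S, P (t + 1) / S)`, up to the number `1`
  have hIco : volume ((fun u : unitInterval => (u : ℝ)) ⁻¹' Set.Ico (P t / S) (P (t + 1) / S)) =
      ENNReal.ofReal (f t / S) := by
    rw [unitInterval.measurePreserving_coe.measure_preimage measurableSet_Ico.nullMeasurableSet,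
      Measure.restrict_apply measurableSet_Ico, Set.inter_eq_left.2, Real.volume_Ico]
    · congr 1
      rw [← sub_div, hP]
      simp [Finset.sum_range_succ]
    · intro u hu
      refine ⟨le_trans (div_nonneg (Finset.sum_nonneg fun v _ => hf v) hS.le) hu.1,
        hu.2.le.trans ((div_le_one hS).2 (hmono ht))⟩
  rw [← hIco]
  refine measure_congr ?_
  have h1 : ∀ᵐ u : unitInterval, u ≠ 1 := by
    rw [ae_iff]
    simp
  filter_upwards [h1] with u hu
  have hu1 : (u : ℝ) < 1 := lt_of_le_of_ne u.2.2 fun h => hu (Subtype.ext h)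
  refine propext ?_
  change pick f T u = t ↔ P t / S ≤ u ∧ (u : ℝ) < P (t + 1) / S
  rw [div_le_iff₀ hS, lt_div_iff₀ hS]
  constructor
  · intro h
    have hne : {t | t < T ∧ (u : ℝ) * ∑ v ∈ Finset.range T, f v <
        ∑ v ∈ Finset.range (t + 1), f v}.Nonempty := by
      refine ⟨T - 1, by omega, ?_⟩
      rw [Nat.sub_add_cancel (by omega)]
      exact mul_lt_of_lt_one_left hS hu1
    have hmem := Nat.sInf_mem hne
    rw [pick] at h
    rw [h] at hmem
    refine ⟨?_, hmem.2⟩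
    by_contra hlt
    rw [not_le] at hlt
    cases t with
    | zero =>
      simp only [hP, Finset.range_zero, Finset.sum_empty] at hlt
      exact absurd (mul_nonneg u.2.1 hS.le) (not_le.2 hlt)
    | succ t =>
      have : sInf {t | t < T ∧ (u : ℝ) * ∑ v ∈ Finset.range T, f v <
        ∑ v ∈ Finset.range (t + 1), f v} ≤ t := Nat.sInf_le ⟨by omega, hlt⟩
      omega
  · rintro ⟨h1, h2⟩
    exact pick_eq ht h2 fun t' ht' => not_lt.2 ((hmono (Nat.succ_le_of_lt ht')).trans h1)

lemma measurable_pickPair (j : ℕ) (s : Fin m → Fin (n + 1)) : Measurable (pickPair p x j s) := by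
  have h : Measurable fun u => (⟨pick (drawWeight p x j s) ((n + 1) * (j + 1)) u,
      pick_lt (by positivity)⟩ : Fin ((n + 1) * (j + 1))) :=
    measurable_to_countable' fun t => by
      have := measurable_pick (drawWeight p x j s) ((n + 1) * (j + 1)) (measurableSet_singleton (t : ℕ))
      convert this using 1
      ext u
      simp [Fin.ext_iff]
  exact (Measurable.of_discrete (f := finProdFinEquiv.symm)).comp h

lemma drawWeight_pair (j : ℕ) (s : Fin m → Fin (n + 1)) (r : Fin (n + 1) × Fin (j + 1)) :
    drawWeight p x j s (finProdFinEquiv r) =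
      alpha p x (j + 1) r.1 (r.2 + 1) * edge p s (j + 1) r.1 := by
  have h2 := r.2.2
  rw [drawWeight, finProdFinEquiv_apply_val, Nat.add_mul_div_left _ _ (Nat.succ_pos j),
    Nat.div_eq_of_lt h2, Nat.add_mul_mod_self_left, Nat.mod_eq_of_lt h2, zero_add]

lemma sum_drawWeight (j : ℕ) (s : Fin m → Fin (n + 1)) :
    ∑ t ∈ Finset.range ((n + 1) * (j + 1)), drawWeight p x j s t = totalWeight p x (j + 1) s := by
  rw [← sum_alpha_mul_edge, ← Fin.sum_univ_eq_sum_range, ← finProdFinEquiv.sum_comp]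
  exact Finset.sum_congr rfl fun r _ => drawWeight_pair j s r

lemma volume_pickPair (hτ : ∀ i, 0 ≤ tau p x i) {j : ℕ} {s : Fin m → Fin (n + 1)}
    (h : 0 < totalWeight p x (j + 1) s) (r : Fin (n + 1) × Fin (j + 1)) :
    volume {u : unitInterval | pickPair p x j s u = r} =
      drawProp (fun r : Fin (n + 1) × Fin (j + 1) =>
        alpha p x (j + 1) r.1 (r.2 + 1) * edge p s (j + 1) r.1) r := by
  have hw : ∀ t, 0 ≤ drawWeight p x j s t := fun t =>
    mul_nonneg (alpha_nonneg hτ _ _ _) (edge_nonneg _ _ _)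
  have hs : {u : unitInterval | pickPair p x j s u = r} =
      {u : unitInterval | pick (drawWeight p x j s) ((n + 1) * (j + 1)) u = finProdFinEquiv r} := by
    ext u
    rw [Set.mem_ofPred_eq, pickPair, Equiv.symm_apply_eq, Fin.ext_iff]
    rfl
  rw [hs, volume_pick_eq hw (finProdFinEquiv r).2 (by rwa [sum_drawWeight]), sum_drawWeight]
  have h0 : ENNReal.ofReal (totalWeight p x (j + 1) s) ≠ 0 := by simpa using h
  refine (ENNReal.mul_right_inj h0 ENNReal.ofReal_ne_top).1 ?_
  have := sum_mul_drawProp (fun r : Fin (n + 1) × Fin (j + 1) =>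
    alpha p x (j + 1) r.1 (r.2 + 1) * edge p s (j + 1) r.1) r
  rw [← ENNReal.ofReal_sum_of_nonneg fun r _ => mul_nonneg (alpha_nonneg hτ _ _ _)
    (edge_nonneg _ _ _), sum_alpha_mul_edge] at this
  rw [this, ← ENNReal.ofReal_mul h.le, mul_div_cancel₀ _ h.ne', drawWeight_pair]

/-! #### The law of the interval sequence -/

lemma measurable_run : ∀ (R j : ℕ) (s : Fin m → Fin (n + 1)), Measurable (run p x R j s) := by
  intro R
  induction R with
  | zero => intro j s; exact measurable_const
  | succ R ih =>
    intro j s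
    cases j with
    | zero => exact measurable_const
    | succ j =>
      have h1 : Measurable fun ω : ℕ → unitInterval => (pickPair p x j s (ω 0), fun t => ω (t + 1)) :=
        ((measurable_pickPair j s).comp (f := fun ω : ℕ → unitInterval => (ω 0 : ℝ))
          (measurable_subtype_coe.comp (measurable_pi_apply 0))).prodMk
          (measurable_pi_iff.2 fun t => measurable_pi_apply (t + 1))
      have h2 : Measurable fun z : (Fin (n + 1) × Fin (j + 1)) × (ℕ → unitInterval) =>
          run p x R (j - z.1.2) (fillIn j s z.1) z.2 :=
        measurable_from_prod_countable_right fun r => ih (j - r.2) (fillIn j s r)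
      exact h2.comp h1

/-- The rounds of the program draw the interval sequence from its law, independently of the random
numbers that are left. The total weight has to be positive: otherwise the program and `backward`
resort to different arbitrary choices. -/
theorem lintegral_run (hτ : ∀ i, 0 ≤ tau p x i)
    {g : (Fin m → Fin (n + 1)) → (ℕ → unitInterval) → ℝ≥0∞} (hg : ∀ t, Measurable (g t)) :
    ∀ (R j : ℕ) (s : Fin m → Fin (n + 1)), j ≤ R → j ≤ m → 0 < totalWeight p x j s →
      ∫⁻ ω, g (run p x R j s ω) (fun t => ω (R + t)) ∂Prog.source =
        ∑ t, backward p x j s t * ∫⁻ ω, g t ω ∂Prog.source := by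
  have base : ∀ (R : ℕ) (s : Fin m → Fin (n + 1)),
      ∫⁻ ω, g (run p x R 0 s ω) (fun t => ω (R + t)) ∂Prog.source =
        ∑ t, backward p x 0 s t * ∫⁻ ω, g t ω ∂Prog.source := by
    intro R s
    simp only [run_zero]
    rw [lintegral_source_shift R (hg s), Finset.sum_eq_single s]
    · simp [backward]
    · intro t _ ht
      simp [backward, ht]
    · simp
  have hg' : Measurable fun z : (Fin m → Fin (n + 1)) × (ℕ → unitInterval) => g z.1 z.2 :=
    measurable_from_prod_countable_right hg
  intro R
  induction R with
  | zero =>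
    intro j s hj _ _
    obtain rfl : j = 0 := by omega
    exact base 0 s
  | succ R ih =>
    intro j s hj hjm h
    cases j with
    | zero => exact base _ s
    | succ j =>
      have hshift : Measurable fun (ω : ℕ → unitInterval) t => ω (R + 1 + t) :=
        measurable_pi_iff.2 fun t => measurable_pi_apply _
      rw [lintegral_source (F := fun ω => g (run p x (R + 1) (j + 1) s ω) fun t => ω (R + 1 + t))
        (hg'.comp ((measurable_run (R + 1) (j + 1) s).prodMk hshift))]
      let H : Fin (n + 1) × Fin (j + 1) → ℝ≥0∞ := fun r =>
        ∫⁻ ω, g (run p x R (j - r.2) (fillIn j s r) ω) (fun t => ω (R + t)) ∂Prog.source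
      have e1 : ∀ u : unitInterval, (∫⁻ ω, g (run p x (R + 1) (j + 1) s (consStream (u, ω)))
          (fun t => consStream (u, ω) (R + 1 + t)) ∂Prog.source) = H (pickPair p x j s u) := by
        intro u
        refine lintegral_congr fun ω => ?_
        have : (fun t => consStream (u, ω) (R + 1 + t)) = fun t => ω (R + t) := by
          funext t
          rw [show R + 1 + t = R + t + 1 by omega]; rfl
        rw [this, run]
        rfl
      have e2 : ∫⁻ u : unitInterval, H (pickPair p x j s u) =
          ∑ r, H r * volume {u : unitInterval | pickPair p x j s u = r} := by
        have hm : Measurable fun u : unitInterval => pickPair p x j s u :=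
          (measurable_pickPair j s).comp measurable_subtype_coe
        rw [← lintegral_map (f := H) (g := fun u : unitInterval => pickPair p x j s u)
          Measurable.of_discrete hm, lintegral_fintype]
        refine Finset.sum_congr rfl fun r _ => ?_
        rw [Measure.map_apply hm (measurableSet_singleton r)]
        rfl
      have e3 : ∀ t, backward p x (j + 1) s t =
          ∑ r : Fin (n + 1) × Fin (j + 1), drawProp (fun r : Fin (n + 1) × Fin (j + 1) =>
            alpha p x (j + 1) r.1 (r.2 + 1) * edge p s (j + 1) r.1) r *
              backward p x (j - r.2) (fillIn j s r) t := by
        intro t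
        rw [backward, PMF.bind_apply, tsum_fintype]
        rfl
      rw [lintegral_congr e1, e2]
      simp_rw [e3, Finset.sum_mul]
      rw [Finset.sum_comm]
      refine Finset.sum_congr rfl fun r _ => ?_
      rw [volume_pickPair hτ h]
      by_cases hr : alpha p x (j + 1) r.1 (r.2 + 1) * edge p s (j + 1) r.1 = 0
      · have : drawProp (fun r : Fin (n + 1) × Fin (j + 1) =>
            alpha p x (j + 1) r.1 (r.2 + 1) * edge p s (j + 1) r.1) r = 0 := by
          have h1 := sum_mul_drawProp (fun r : Fin (n + 1) × Fin (j + 1) =>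
            alpha p x (j + 1) r.1 (r.2 + 1) * edge p s (j + 1) r.1) r
          rw [← ENNReal.ofReal_sum_of_nonneg fun r _ => mul_nonneg (alpha_nonneg hτ _ _ _)
            (edge_nonneg _ _ _), sum_alpha_mul_edge, hr, ENNReal.ofReal_zero, mul_eq_zero] at h1
          exact h1.resolve_left (by simpa using h)
        simp [this]
      · have hpos : 0 < totalWeight p x (j - r.2) (fillIn j s r) := by
          have h1 := left_ne_zero_of_mul hr
          have h2 := lt_of_le_of_ne (alpha_nonneg hτ _ _ _) (Ne.symm h1)
          rw [alpha_eq_blockWeight_mul_totalWeight (by omega)] at h2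
          exact pos_of_mul_pos_right h2 (blockWeight_nonneg hτ _ _ _)
        change (∫⁻ ω, g (run p x R (j - r.2) (fillIn j s r) ω) (fun t => ω (R + t)) ∂Prog.source) * _ = _
        rw [ih _ _ (by omega) (by omega) hpos, mul_comm, Finset.mul_sum]
        simp_rw [mul_assoc]

/-! #### The law of the output -/

lemma map_affine_volume (c : ℝ) {d : ℝ} (hd : 0 < d) {B : Set ℝ} (hB : MeasurableSet B) :
    volume {u : unitInterval | c + u * d ∈ B} =
      ProbabilityTheory.cond volume (Set.Ico c (c + d)) B := by
  have hf : Measurable fun u : ℝ => c + u * d := (measurable_id.mul_const d).const_add c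
  have e1 : volume {u : unitInterval | c + u * d ∈ B} =
      (volume.restrict unitInterval) ((fun u : ℝ => c + u * d) ⁻¹' B) := by
    rw [← unitInterval.measurePreserving_coe.measure_preimage (hf hB).nullMeasurableSet]
    rfl
  have e2 : (fun u : ℝ => c + u * d) ⁻¹' B ∩ unitInterval =
      (fun u : ℝ => u * d) ⁻¹' ((fun v => c + v) ⁻¹' (B ∩ Set.Icc c (c + d))) := by
    ext u
    simp only [Set.mem_inter_iff, Set.mem_preimage, Set.mem_Icc, unitInterval]
    refine and_congr_right fun _ => and_congr ?_ ?_
    · rw [le_add_iff_nonneg_right, mul_nonneg_iff_of_pos_right hd]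
    · rw [add_le_add_iff_left, mul_le_iff_le_one_left hd]
  have e3 : volume (B ∩ Set.Icc c (c + d)) = volume (Set.Ico c (c + d) ∩ B) := by
    rw [Set.inter_comm]
    exact measure_congr ((Ico_ae_eq_Icc (μ := volume)).symm.inter (ae_eq_refl B))
  rw [e1, Measure.restrict_apply (hf hB), e2, Real.volume_preimage_mul_right hd.ne',
    measure_preimage_add, e3, cond_apply measurableSet_Ico, Real.volume_Ico, abs_of_pos (inv_pos.2 hd),
    add_sub_cancel_left, ENNReal.ofReal_inv_of_pos hd]

lemma measurable_samples (s : Fin m → Fin (n + 1)) : Measurable (Prog.samples p x s) := by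
  refine measurable_pi_iff.2 fun l => ?_
  exact ((measurable_subtype_coe.comp (measurable_pi_apply (l : ℕ))).mul_const _).const_add _

/-- The uniform law on the product of the intervals of a sequence. -/
def uniformOn (p : Params m) (x : Fin n → ℝ) (s : Fin m → Fin (n + 1)) : Measure (Fin m → ℝ) :=
  Measure.pi fun j : Fin m => ProbabilityTheory.cond volume
    (Set.Ico (pad p.a p.b x (s j)) (pad p.a p.b x (s j + 1)))

lemma map_samples (s : Fin m → Fin (n + 1)) (h : ∀ l, 0 < tau p x (s l)) :
    Prog.source.map (Prog.samples p x s) = uniformOn p x s := by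
  refine (Measure.pi_eq fun B hB => ?_).symm
  rw [Measure.map_apply (measurable_samples s) (MeasurableSet.univ_pi hB)]
  have hset : Prog.samples p x s ⁻¹' Set.univ.pi B = Set.pi (Finset.range m) fun t =>
      {u : unitInterval | ∀ ht : t < m,
        pad p.a p.b x (s ⟨t, ht⟩) + u * tau p x (s ⟨t, ht⟩) ∈ B ⟨t, ht⟩} := by
    ext ω
    simp only [Prog.samples, Set.mem_preimage, Set.mem_pi, Set.mem_univ, true_imp_iff,
      Finset.coe_range, Set.mem_Iio, Set.mem_ofPred_eq]
    exact ⟨fun h t _ ht => h ⟨t, ht⟩, fun h t => h t t.2 t.2⟩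
  rw [hset, source_pi_range, ← Fin.prod_univ_eq_prod_range]
  · refine Finset.prod_congr rfl fun l _ => ?_
    have := map_affine_volume (pad p.a p.b x (s l)) (h l) (hB l)
    rw [tau, add_sub_cancel] at this
    rw [← this]
    simp [tau]
  · intro t
    by_cases ht : t < m
    · simp only [ht, forall_true_left]
      exact ((measurable_subtype_coe.mul_const _).const_add _) (hB _)
    · simp [ht]

lemma measurable_sorted : Measurable (sorted : (Fin m → ℝ) → Fin m → ℝ) := by
  intro S hS
  have : sorted ⁻¹' S = ⋃ σ : Equiv.Perm (Fin m),
      {o : Fin m → ℝ | Monotone (o ∘ σ)} ∩ (fun o : Fin m → ℝ => o ∘ σ) ⁻¹' S := by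
    ext o
    simp only [Set.mem_preimage, Set.mem_iUnion, Set.mem_inter_iff, Set.mem_ofPred_eq]
    constructor
    · exact fun h => ⟨Tuple.sort o, Tuple.monotone_sort o, h⟩
    · rintro ⟨σ, h1, h2⟩
      rwa [sorted, ← Tuple.comp_sort_eq_comp_iff_monotone.2 h1]
  rw [this]
  have hσ : ∀ σ : Equiv.Perm (Fin m), Measurable fun o : Fin m → ℝ => o ∘ σ :=
    fun σ => measurable_pi_iff.2 fun j => measurable_pi_apply (σ j)
  refine MeasurableSet.iUnion fun σ => MeasurableSet.inter ?_ (hσ σ hS)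
  simp only [Monotone, Set.ofPred_forall]
  exact MeasurableSet.iInter fun i => MeasurableSet.iInter fun j => MeasurableSet.iInter fun _ =>
    measurableSet_le (measurable_pi_apply _) (measurable_pi_apply _)

lemma tau_pos_of_intervalLaw_ne_zero (hm : 0 < m) (hp : p.a < p.b) (hτ : ∀ i, 0 ≤ tau p x i)
    {t : Fin m → Fin (n + 1)} (h : intervalLaw p x t ≠ 0) (l : Fin m) : 0 < tau p x (t l) := by
  rw [intervalLaw_eq_intervalLawQ' hm hp hτ] at h
  have h1 := sum_weightQ'_mul_intervalLawQ' hτ t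
  refine lt_of_le_of_ne (hτ _) fun h0 => ?_
  have : weightQ' p x t = 0 := by
    rw [weightQ', Finset.prod_eq_zero (Finset.mem_univ l) h0.symm]
    simp
  rw [this, ENNReal.ofReal_zero, mul_eq_zero] at h1
  exact h (h1.resolve_left (by simpa using sum_weightQ'_pos hp hτ))

lemma jointLaw_apply (p : Params m) (x : Fin n → ℝ)
    {S : Set ((Fin m → Fin (n + 1)) × (Fin m → ℝ))} (hS : MeasurableSet S) :
    jointLaw p x S = ∑ s, intervalLaw p x s * uniformOn p x s {o | (s, sorted o) ∈ S} := by
  rw [jointLaw, Measure.finsetSum_apply]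
  refine Finset.sum_congr rfl fun s _ => ?_
  rw [Measure.smul_apply, Measure.map_apply (measurable_const.prodMk measurable_sorted) hS]
  rfl

/-- The pair that the program produces has the joint law of JointExp. -/
theorem Prog.hasLaw_result (hm : 1 ≤ m) (hp : p.a < p.b) (hτ : ∀ i, 0 ≤ tau p x i) :
    HasLaw (fun ω => result m (final toeplitz p x ω))
      ((jointLaw p x).map (Prod.map (fun s j => (s j : ℕ)) id)) source := by
  have hcast : Measurable fun (s : Fin m → Fin (n + 1)) j => (s j : ℕ) := Measurable.of_discrete
  have hpm : Measurable (Prod.map (fun (s : Fin m → Fin (n + 1)) j => (s j : ℕ))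
      (id : (Fin m → ℝ) → Fin m → ℝ)) := hcast.prodMap measurable_id
  have hshift : Measurable fun (ω : ℕ → unitInterval) t => ω (m + t) :=
    measurable_pi_iff.2 fun t => measurable_pi_apply _
  have hG : Measurable fun z : (Fin m → Fin (n + 1)) × (ℕ → unitInterval) =>
      ((fun t => (z.1 t : ℕ)), sorted (samples p x z.1 z.2)) :=
    measurable_from_prod_countable_right fun s =>
      (measurable_const (a := fun t => (s t : ℕ))).prodMk
        (measurable_sorted.comp (measurable_samples s))
  have hres : (fun ω => result m (final toeplitz p x ω)) = fun ω =>
      ((fun t => (run p x m m (fun _ => 0) ω t : ℕ)),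
        sorted (samples p x (run p x m m (fun _ => 0) ω) fun t => ω (m + t))) :=
    funext fun ω => (exec_jointExp hm p x ω).2
  have hmeas : Measurable fun ω => result m (final toeplitz p x ω) := by
    rw [hres]
    exact hG.comp ((measurable_run m m _).prodMk hshift)
  refine ⟨hmeas.aemeasurable, Measure.ext fun S hS => ?_⟩
  have hpos : 0 < totalWeight p x m fun _ => 0 := by
    have := totalWeight_eq hm hτ (p := p) (x := x) fun _ => 0
    rw [← ENNReal.ofReal_pos, this, ENNReal.ofReal_pos]
    exact sum_weightQ'_pos hp hτ
  rw [Measure.map_apply hmeas hS, ← lintegral_indicator_one (hmeas hS),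
    Measure.map_apply hpm hS, jointLaw_apply p x (hpm hS)]
  have key := lintegral_run hτ (p := p) (x := x) (g := fun s ω =>
    S.indicator 1 ((fun t => (s t : ℕ)), sorted (samples p x s ω)))
    (fun s => (measurable_one.indicator hS).comp (hG.comp (measurable_const.prodMk measurable_id)))
    m m (fun _ => 0) le_rfl le_rfl hpos
  calc _ = ∫⁻ ω, S.indicator 1 ((fun t => (run p x m m (fun _ => 0) ω t : ℕ)),
        sorted (samples p x (run p x m m (fun _ => 0) ω) fun t => ω (m + t))) ∂source := by
        refine lintegral_congr fun ω => ?_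
        rw [← congrFun hres ω]
        rfl
    _ = _ := by
        refine key.trans (Finset.sum_congr rfl fun s _ => ?_)
        change intervalLaw p x s * _ = _
        by_cases h0 : intervalLaw p x s = 0
        · rw [h0, zero_mul, zero_mul]
        congr 1
        rw [← map_samples s (tau_pos_of_intervalLaw_ne_zero hm hp hτ h0)]
        have hT : MeasurableSet {o : Fin m → ℝ | (s, sorted o) ∈
            (Prod.map (fun (s : Fin m → Fin (n + 1)) j => (s j : ℕ)) id) ⁻¹' S} :=
          (measurable_const.prodMk measurable_sorted) (hpm hS)
        rw [Measure.map_apply (measurable_samples s) hT,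
          ← lintegral_indicator_one (measurable_samples s hT)]
        rfl

end

section

/-! ### The exponential mechanism: decomposition into boxes, and privacy -/

variable {n m : ℕ} {p : Params m} {x : Fin n → ℝ}

/-- The outputs whose `j`-th entry lies in interval `s j`. -/
def box (p : Params m) (x : Fin n → ℝ) (s : Fin m → Fin (n + 1)) : Set (Fin m → ℝ) :=
  Set.univ.pi fun j => Set.Ico (pad p.a p.b x (s j)) (pad p.a p.b x (s j + 1))

lemma measurableSet_box (s : Fin m → Fin (n + 1)) : MeasurableSet (box p x s) :=
  MeasurableSet.univ_pi fun _ => measurableSet_Ico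

lemma measurableSet_outputSpace : MeasurableSet (outputSpace p) := by
  simp only [outputSpace, Monotone, Set.ofPred_and, Set.ofPred_forall]
  refine MeasurableSet.inter (MeasurableSet.iInter fun i => MeasurableSet.iInter fun j =>
    MeasurableSet.iInter fun _ => measurableSet_le (measurable_pi_apply _) (measurable_pi_apply _)) ?_
  exact MeasurableSet.iInter fun j => measurable_pi_apply j measurableSet_Icc

lemma prod_tau_mul_uniformOn {s : Fin m → Fin (n + 1)} (hs : ∀ j, 0 < tau p x (s j))
    (T : Set (Fin m → ℝ)) (hT : MeasurableSet T) :
    (∏ j, ENNReal.ofReal (tau p x (s j))) * uniformOn p x s T = volume (box p x s ∩ T) := by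
  have h : uniformOn p x s =
      (∏ j, (ENNReal.ofReal (tau p x (s j)))⁻¹) • (volume.restrict (box p x s)) := by
    refine Measure.pi_eq fun B hB => ?_
    rw [Measure.smul_apply, Measure.restrict_apply (MeasurableSet.univ_pi hB), box,
      ← Set.pi_inter_distrib, volume_pi_pi, smul_eq_mul, ← Finset.prod_mul_distrib]
    refine Finset.prod_congr rfl fun j _ => ?_
    rw [cond_apply measurableSet_Ico, Real.volume_Ico, Set.inter_comm]
    rfl
  rw [h, Measure.smul_apply, Measure.restrict_apply hT, smul_eq_mul, ← mul_assoc,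
    ← Finset.prod_mul_distrib, Finset.prod_eq_one, one_mul, Set.inter_comm]
  intro j _
  exact ENNReal.mul_inv_cancel (by simpa using hs j) ENNReal.ofReal_ne_top

/-! #### The utility is constant on a box -/

lemma padSeq_le (s : Fin m → Fin (n + 1)) (j : ℕ) : padSeq s j ≤ n := by
  cases j with
  | zero => exact Nat.zero_le n
  | succ j =>
    rw [padSeq]
    split_ifs
    · exact Nat.lt_succ_iff.1 (s _).2
    · exact le_rfl

lemma padSeq_mono {s : Fin m → Fin (n + 1)} (hs : Monotone s) : Monotone (padSeq s) := by
  refine monotone_nat_of_le_succ fun j => ?_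
  cases j with
  | zero => exact Nat.zero_le _
  | succ j =>
    by_cases h : j + 1 < m
    · rw [padSeq_succ s h, padSeq_succ s (by omega : j < m)]
      exact hs (Fin.mk_le_mk.2 (Nat.le_succ j))
    · have : padSeq s (j + 1 + 1) = n := by rw [padSeq, dif_neg h]
      rw [this]
      exact padSeq_le s _

lemma countIn_comp_perm (Y : Fin n → ℝ) (e : Equiv.Perm (Fin n)) (u v : ℝ) :
    countIn (Y ∘ e) u v = countIn Y u v :=
  Fintype.card_congr (e.subtypeEquiv fun _ => Iff.rfl)

lemma utilQ_sorted (Y : Fin n → ℝ) (o : Fin m → ℝ) : utilQ p (sorted Y) o = utilQ p Y o := by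
  simp only [utilQ, sorted, countIn_comp_perm]

/-- The data points below output `o_j` are exactly the first `i_j` ones. -/
lemma lt_pad_iff (hp : p.a < p.b) (hx : Monotone x) (hmem : ∀ i, x i ∈ Set.Icc p.a p.b)
    {s : Fin m → Fin (n + 1)} {o : Fin m → ℝ}
    (ho : ∀ j, pad p.a p.b x (s j) < o j ∧ o j < pad p.a p.b x (s j + 1)) (j : ℕ) (l : Fin n) :
    x l < pad p.a (p.b + 1) o j ↔ (l : ℕ) < padSeq s j := by
  have hmono := pad_mono hp.le hx hmem
  cases j with
  | zero => simpa [pad, padSeq] using (hmem l).1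
  | succ j =>
    by_cases h : j < m
    · rw [pad_of_le o h, padSeq_succ s h, ← pad_of_le (lo := p.a) (hi := p.b) x l.2]
      constructor
      · intro hlt
        by_contra hle
        exact absurd (hmono (by omega : (s ⟨j, h⟩ : ℕ) + 1 ≤ l + 1))
          (not_le.2 (hlt.trans (ho ⟨j, h⟩).2))
      · intro hlt
        exact (hmono (by omega : (l : ℕ) + 1 ≤ s ⟨j, h⟩)).trans_lt (ho ⟨j, h⟩).1
    · simp only [pad, padSeq, dif_neg h, l.2, iff_true]
      linarith [(hmem l).2]

lemma utilQ_eq_utilQ' (hp : p.a < p.b) (hx : Monotone x) (hmem : ∀ i, x i ∈ Set.Icc p.a p.b)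
    {s : Fin m → Fin (n + 1)} (hs : Monotone s) {o : Fin m → ℝ}
    (ho : ∀ j, pad p.a p.b x (s j) < o j ∧ o j < pad p.a p.b x (s j + 1)) :
    utilQ p x o = utilQ' p s := by
  rw [utilQ, utilQ']
  congr 1
  refine Finset.sum_congr rfl fun j _ => ?_
  have hle := padSeq_mono hs (Nat.sub_le j 1)
  have hcard : countIn x (pad p.a (p.b + 1) o (j - 1)) (pad p.a (p.b + 1) o j) =
      padSeq s j - padSeq s (j - 1) := by
    rw [countIn, Fintype.card_subtype]
    have : ∀ l : Fin n, (pad p.a (p.b + 1) o (j - 1) ≤ x l ∧ x l < pad p.a (p.b + 1) o j) ↔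
        (l : ℕ) ∈ Finset.Ico (padSeq s (j - 1)) (padSeq s j) := by
      intro l
      rw [lt_pad_iff hp hx hmem ho, ← not_lt, lt_pad_iff hp hx hmem ho, Finset.mem_Ico, not_lt]
    simp only [this]
    have hmap : (Finset.univ.filter fun l : Fin n =>
        (l : ℕ) ∈ Finset.Ico (padSeq s (j - 1)) (padSeq s j)).map Fin.valEmbedding =
          Finset.Ico (padSeq s (j - 1)) (padSeq s j) := by
      ext t
      simp only [Finset.mem_map, Finset.mem_filter, Finset.mem_univ, true_and,
        Fin.valEmbedding_apply]
      constructor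
      · rintro ⟨l, hl, rfl⟩
        exact hl
      · intro ht
        have := padSeq_le s j
        exact ⟨⟨t, by have := (Finset.mem_Ico.1 ht).2; omega⟩, ht, rfl⟩
    have h := congrArg Finset.card hmap
    rwa [Finset.card_map, Nat.card_Ico] at h
  rw [hcard, Nat.cast_sub hle]

lemma ae_mem_Ioo_of_mem_box (s : Fin m → Fin (n + 1)) : ∀ᵐ o : Fin m → ℝ, o ∈ box p x s →
    ∀ j, pad p.a p.b x (s j) < o j ∧ o j < pad p.a p.b x (s j + 1) := by
  have h : ∀ᵐ o : Fin m → ℝ, ∀ j, o j ≠ pad p.a p.b x (s j) :=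
    ae_all_iff.2 fun j => Measure.ae_eval_ne _ j _
  filter_upwards [h] with o ho hb j
  exact ⟨lt_of_le_of_ne (hb j trivial).1 (ho j).symm, (hb j trivial).2⟩

/-! #### Sorting a uniform point of a box -/

lemma monotone_of_mem_box (hp : p.a < p.b) (hx : Monotone x) (hmem : ∀ i, x i ∈ Set.Icc p.a p.b)
    {s : Fin m → Fin (n + 1)} {o : Fin m → ℝ} (ho : o ∈ box p x s) {e : Equiv.Perm (Fin m)}
    (h : Monotone (o ∘ e)) : Monotone (s ∘ e) := by
  intro i j hij
  by_contra hlt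
  rw [not_le] at hlt
  have h1 := (ho (e j) trivial).2
  have h2 := (ho (e i) trivial).1
  have h3 := pad_mono hp.le hx hmem (Nat.succ_le_of_lt (Fin.lt_def.1 hlt))
  exact absurd (h hij) (not_le.2 (h1.trans_le (h3.trans h2)))

lemma comp_perm_mem_box {s : Fin m → Fin (n + 1)} {e : Equiv.Perm (Fin m)} (he : s ∘ e = s)
    {o : Fin m → ℝ} : o ∘ e ∈ box p x s ↔ o ∈ box p x s := by
  have he' : ∀ j, s (e j) = s j := congrFun he
  simp only [box, Set.mem_univ_pi, Function.comp_apply]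
  constructor
  · intro h j
    have := h (e.symm j)
    rwa [e.apply_symm_apply, ← he' (e.symm j), e.apply_symm_apply] at this
  · intro h j
    rw [← he' j]
    exact h (e j)

lemma measurePreserving_comp_perm (e : Equiv.Perm (Fin m)) :
    MeasurePreserving (fun o : Fin m → ℝ => o ∘ e) volume volume := by
  have h := volume_measurePreserving_piCongrLeft (fun _ : Fin m => ℝ) e.symm
  convert h using 1
  funext o j
  have := Equiv.piCongrLeft_apply_apply (fun _ : Fin m => ℝ) e.symm o (e j)
  rw [e.symm_apply_apply] at this
  exact this.symm

lemma ae_injective : ∀ᵐ o : Fin m → ℝ, Function.Injective o := by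
  have h : ∀ i j : Fin m, i ≠ j → ∀ᵐ o : Fin m → ℝ, o i ≠ o j := by
    intro i j hij
    let V : Submodule ℝ (Fin m → ℝ) :=
      LinearMap.ker (LinearMap.proj (R := ℝ) (φ := fun _ : Fin m => ℝ) i - LinearMap.proj j)
    have hV : V ≠ ⊤ := by
      intro htop
      have hmem : (Pi.single i 1 : Fin m → ℝ) ∈ V := by rw [htop]; trivial
      simp [V, hij.symm] at hmem
    have h0 := Measure.addHaar_submodule (volume : Measure (Fin m → ℝ)) V hV
    rw [ae_iff]
    convert h0 using 2
    ext o
    simp [V, sub_eq_zero]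
  have h2 : ∀ᵐ o : Fin m → ℝ, ∀ i j : Fin m, i ≠ j → o i ≠ o j :=
    ae_all_iff.2 fun i => ae_all_iff.2 fun j => by
      by_cases hij : i = j
      · simp [hij]
      · simpa [hij] using h i j hij
  filter_upwards [h2] with o ho i j hij
  by_contra hne
  exact ho i j hne hij

lemma box_subset (hp : p.a < p.b) (hmem : ∀ i, x i ∈ Set.Icc p.a p.b)
    {s : Fin m → Fin (n + 1)} {o : Fin m → ℝ} (ho : o ∈ box p x s) (j : Fin m) :
    o j ∈ Set.Icc p.a p.b :=
  ⟨(pad_mem hp.le hmem _).1.trans (ho j trivial).1,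
    (ho j trivial).2.le.trans (pad_mem hp.le hmem _).2⟩

/-- Up to a null set, the points of a box whose ordered version lies in `S` are the disjoint union
of the permuted copies of the ordered points of the box that lie in `S`, over the `γ(s)`
permutations that fix the interval sequence. -/
theorem volume_box_inter_sorted (hp : p.a < p.b) (hx : Monotone x)
    (hmem : ∀ i, x i ∈ Set.Icc p.a p.b) {s : Fin m → Fin (n + 1)} (hs : Monotone s)
    {S : Set (Fin m → ℝ)} (hS : MeasurableSet S) :
    volume (box p x s ∩ sorted ⁻¹' S) =
      gamma s * volume (outputSpace p ∩ S ∩ box p x s) := by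
  set A := outputSpace p ∩ S ∩ box p x s with hA
  have hAm : MeasurableSet A := (measurableSet_outputSpace.inter hS).inter (measurableSet_box s)
  have hunion : box p x s ∩ sorted ⁻¹' S =
      ⋃ e : {e : Equiv.Perm (Fin m) // s ∘ e = s}, (fun o : Fin m → ℝ => o ∘ e.1) ⁻¹' A := by
    ext o
    simp only [Set.mem_inter_iff, Set.mem_preimage, Set.mem_iUnion, hA]
    constructor
    · rintro ⟨hb, hS⟩
      have he : s ∘ Tuple.sort o = s := by
        have h1 := Tuple.comp_sort_eq_comp_iff_monotone.2
          (monotone_of_mem_box hp hx hmem hb (Tuple.monotone_sort o))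
        have h2 : s ∘ (1 : Equiv.Perm (Fin m)) = s ∘ Tuple.sort s :=
          Tuple.comp_sort_eq_comp_iff_monotone.2 hs
        rw [h1, ← h2]
        rfl
      have hb' := (comp_perm_mem_box (p := p) (x := x) he).2 hb
      exact ⟨⟨Tuple.sort o, he⟩,
        ⟨⟨Tuple.monotone_sort o, box_subset hp hmem hb'⟩, hS⟩, hb'⟩
    · rintro ⟨⟨e, he⟩, ⟨h1, h2⟩, h3⟩
      refine ⟨(comp_perm_mem_box he).1 h3, ?_⟩
      rwa [sorted, ← Tuple.comp_sort_eq_comp_iff_monotone.2 h1.1]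
  rw [hunion, measure_iUnion₀, tsum_fintype]
  · simp_rw [fun e : {e : Equiv.Perm (Fin m) // s ∘ e = s} =>
      (measurePreserving_comp_perm e.1).measure_preimage hAm.nullMeasurableSet]
    rw [Finset.sum_const, Finset.card_univ, nsmul_eq_mul, DomMulAct.stabilizer_card, gamma]
  · intro e e' hne
    refine measure_mono_null ?_ (ae_iff.1 (ae_injective (m := m)))
    rintro o ⟨h1, h2⟩ hinj
    have h := (Tuple.comp_sort_eq_comp_iff_monotone.2 h1.1.1.1).trans
      (Tuple.comp_sort_eq_comp_iff_monotone.2 h2.1.1.1).symm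
    exact hne (Subtype.ext (Equiv.ext fun i => hinj (congrFun h i)))
  · exact fun e => ((measurePreserving_comp_perm e.1).measurable hAm).nullMeasurableSet

/-! #### The output of JointExp has the law of the mechanism -/

/-- The density of the mechanism, before normalization. -/
def densityQ (p : Params m) (x : Fin n → ℝ) (o : Fin m → ℝ) : ℝ≥0∞ :=
  ENNReal.ofReal (Real.exp (p.ε * utilQ p x o / (2 * 2)))

lemma box_disjoint (hp : p.a < p.b) (hx : Monotone x) (hmem : ∀ i, x i ∈ Set.Icc p.a p.b) :
    Pairwise (Function.onFun Disjoint (box p x)) := by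
  intro s t hst
  refine Set.disjoint_left.2 fun o h1 h2 => hst (funext fun j => ?_)
  have hmono := pad_mono hp.le hx hmem
  have key : ∀ s t : Fin m → Fin (n + 1), o ∈ box p x s → o ∈ box p x t → s j ≤ t j := by
    intro s t h1 h2
    by_contra hlt
    have h3 := hmono (Nat.succ_le_of_lt (Fin.lt_def.1 (not_le.1 hlt)))
    exact absurd ((h2 j trivial).2.trans_le h3) (not_lt.2 (h1 j trivial).1)
  exact le_antisymm (key s t h1 h2) (key t s h2 h1)

lemma exists_mem_box {o : Fin m → ℝ} (ho : o ∈ outputSpace p) (hb : ∀ j, o j ≠ p.b) :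
    ∃ s : Fin m → Fin (n + 1), o ∈ box p x s := by
  classical
  refine ⟨fun j => ⟨Nat.findGreatest (fun i => pad p.a p.b x i ≤ o j) n,
    Nat.lt_succ_of_le (Nat.findGreatest_le n)⟩, fun j _ => ⟨?_, ?_⟩⟩
  · exact Nat.findGreatest_spec (P := fun i => pad p.a p.b x i ≤ o j) (Nat.zero_le n) (ho.2 j).1
  · change o j < pad p.a p.b x (Nat.findGreatest (fun i => pad p.a p.b x i ≤ o j) n + 1)
    have hle := Nat.findGreatest_le (P := fun i => pad p.a p.b x i ≤ o j) n
    rcases hle.lt_or_eq with h | h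
    · exact not_le.1 (Nat.findGreatest_is_greatest (P := fun i => pad p.a p.b x i ≤ o j)
        (Nat.lt_succ_self _) h)
    · rw [h]
      simpa [pad] using lt_of_le_of_ne (ho.2 j).2 (hb j)

/-- Weight by weight, the law of JointExp agrees with the unnormalized mechanism on the boxes. -/
lemma weightQ'_mul_uniformOn (hp : p.a < p.b) (hx : Monotone x)
    (hmem : ∀ i, x i ∈ Set.Icc p.a p.b) (s : Fin m → Fin (n + 1))
    {S : Set (Fin m → ℝ)} (hS : MeasurableSet S) :
    ENNReal.ofReal (weightQ' p x s) * uniformOn p x s (sorted ⁻¹' S) =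
      ∫⁻ o in outputSpace p ∩ S ∩ box p x s, densityQ p x o := by
  have hτ := tau_nonneg hp hx hmem
  by_cases hs : Monotone s
  · by_cases hpos : ∀ j, 0 < tau p x (s j)
    · have hdens : ∫⁻ o in outputSpace p ∩ S ∩ box p x s, densityQ p x o =
          ENNReal.ofReal (Real.exp (p.ε * utilQ' p s / (2 * 2))) *
            volume (outputSpace p ∩ S ∩ box p x s) := by
        rw [← setLIntegral_const]
        refine setLIntegral_congr_fun_ae
          ((measurableSet_outputSpace.inter hS).inter (measurableSet_box s)) ?_
        filter_upwards [ae_mem_Ioo_of_mem_box (p := p) (x := x) s] with o ho hb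
        rw [densityQ, utilQ_eq_utilQ' hp hx hmem hs (ho hb.2)]
      have hγ : (gamma s : ℝ≥0∞) ≠ 0 := by exact_mod_cast (gamma_pos s).ne'
      have hw : ENNReal.ofReal (weightQ' p x s) =
          ENNReal.ofReal (Real.exp (p.ε * utilQ' p s / (2 * 2))) *
            (∏ j, ENNReal.ofReal (tau p x (s j))) * (gamma s : ℝ≥0∞)⁻¹ := by
        rw [weightQ', if_pos hs, div_eq_mul_inv, ENNReal.ofReal_mul (by
          have := Finset.prod_nonneg fun (j : Fin m) (_ : j ∈ Finset.univ) => hτ (s j)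
          positivity), ENNReal.ofReal_mul (by positivity),
          ENNReal.ofReal_prod_of_nonneg fun j _ => hτ _,
          ENNReal.ofReal_inv_of_pos (by exact_mod_cast gamma_pos s), ENNReal.ofReal_natCast]
      rw [hdens, hw, mul_right_comm, mul_assoc (ENNReal.ofReal _),
        prod_tau_mul_uniformOn hpos _ (measurable_sorted hS),
        volume_box_inter_sorted hp hx hmem hs hS, mul_assoc, mul_right_comm,
        ENNReal.mul_inv_cancel hγ (ENNReal.natCast_ne_top _), one_mul]
    · push Not at hpos
      obtain ⟨j, hj⟩ := hpos
      have h0 : tau p x (s j) = 0 := le_antisymm hj (hτ _)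
      have hempty : box p x s = ∅ := by
        refine Set.eq_empty_of_forall_notMem fun o ho => ?_
        have : o j ∈ Set.Ico (pad p.a p.b x (s j)) (pad p.a p.b x (s j + 1)) := ho j trivial
        rw [tau, sub_eq_zero] at h0
        rw [h0] at this
        exact absurd this.2 (not_lt.2 this.1)
      rw [weightQ', Finset.prod_eq_zero (Finset.mem_univ j) h0, hempty]
      simp
  · have hempty : outputSpace p ∩ S ∩ box p x s = ∅ := by
      refine Set.eq_empty_of_forall_notMem fun o ho => hs ?_
      exact monotone_of_mem_box hp hx hmem ho.2 (e := 1) ho.1.1.1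
    rw [weightQ', if_neg hs, hempty]
    simp

lemma setLIntegral_densityQ (hp : p.a < p.b) (hx : Monotone x)
    (hmem : ∀ i, x i ∈ Set.Icc p.a p.b) {S : Set (Fin m → ℝ)} (hS : MeasurableSet S) :
    ∫⁻ o in outputSpace p ∩ S, densityQ p x o =
      ∑ s, ENNReal.ofReal (weightQ' p x s) * uniformOn p x s (sorted ⁻¹' S) := by
  simp_rw [weightQ'_mul_uniformOn hp hx hmem _ hS]
  have hm := fun s => (measurableSet_outputSpace (p := p).inter hS).inter
    (measurableSet_box (p := p) (x := x) s)
  rw [← tsum_fintype (L := .unconditional _), ← lintegral_iUnion hm]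
  · refine setLIntegral_congr ?_
    have hb : ∀ᵐ o : Fin m → ℝ, ∀ j, o j ≠ p.b := ae_all_iff.2 fun j => Measure.ae_eval_ne _ j _
    filter_upwards [hb] with o ho
    refine propext ⟨fun h => ?_, fun h => ?_⟩
    · obtain ⟨s, hs⟩ := exists_mem_box (n := n) (x := x) h.1 ho
      exact Set.mem_iUnion.2 ⟨s, h, hs⟩
    · obtain ⟨s, hs⟩ := Set.mem_iUnion.1 h
      exact hs.1
  · exact fun s t hst => (box_disjoint hp hx hmem hst).mono Set.inter_subset_right
      Set.inter_subset_right

lemma jointLaw_snd_apply (p : Params m) (x : Fin n → ℝ) {S : Set (Fin m → ℝ)}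
    (hS : MeasurableSet S) : (jointLaw p x).map Prod.snd S =
      ∑ s, intervalLaw p x s * uniformOn p x s (sorted ⁻¹' S) := by
  rw [Measure.map_apply measurable_snd hS, jointLaw_apply p x (measurable_snd hS)]
  rfl

lemma isProbabilityMeasure_jointLaw_snd (hm : 0 < m) (hp : p.a < p.b) (hτ : ∀ i, 0 ≤ tau p x i) :
    IsProbabilityMeasure ((jointLaw p x).map Prod.snd) := by
  refine ⟨?_⟩
  have h1 := (intervalLaw p x).tsum_coe
  rw [tsum_fintype] at h1
  rw [jointLaw_snd_apply p x MeasurableSet.univ, ← h1]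
  refine Finset.sum_congr rfl fun s _ => ?_
  by_cases h0 : intervalLaw p x s = 0
  · rw [h0, zero_mul]
  · have hs := tau_pos_of_intervalLaw_ne_zero hm hp hτ h0
    have : IsProbabilityMeasure (uniformOn p x s) := by
      rw [← map_samples s hs]
      exact Measure.isProbabilityMeasure_map (measurable_samples s).aemeasurable
    rw [Set.preimage_univ, measure_univ, mul_one]

lemma clamp_mem {a b : ℝ} (hab : a ≤ b) (X : Fin n → ℝ) (i : Fin n) :
    clamp a b X i ∈ Set.Icc a b :=
  ⟨le_max_left _ _, max_le hab (min_le_left _ _)⟩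

lemma expMechanism_apply (p : Params m) (Y : Fin n → ℝ) {S : Set (Fin m → ℝ)}
    (hS : MeasurableSet S) :
    expMechanism (volume.restrict (outputSpace p)) (utilQ p Y) p.ε 2 S =
      (∫⁻ o in outputSpace p, densityQ p Y o)⁻¹ * ∫⁻ o in outputSpace p ∩ S, densityQ p Y o := by
  rw [expMechanism, Measure.smul_apply, withDensity_apply _ hS, Measure.restrict_restrict hS,
    Set.inter_comm S, smul_eq_mul]
  rfl

theorem mechanism_eq_mechQ (hm : 0 < m) (hp : p.a < p.b) (X : Fin n → ℝ) :
    mechanism p X = mechQ p X := by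
  set x := sorted (clamp p.a p.b X) with hxdef
  have hx : Monotone x := Tuple.monotone_sort _
  have hmem : ∀ i, x i ∈ Set.Icc p.a p.b := fun i => clamp_mem hp.le X _
  have hτ := tau_nonneg hp hx hmem
  have hd : densityQ p (clamp p.a p.b X) = densityQ p x := by
    funext o
    rw [densityQ, densityQ, hxdef, utilQ_sorted]
  set W := ENNReal.ofReal (∑ t : Fin m → Fin (n + 1), weightQ' p x t)
  have hW : W ≠ 0 := by simpa [W] using sum_weightQ'_pos hp hτ
  have key : ∀ S, MeasurableSet S → ∫⁻ o in outputSpace p ∩ S, densityQ p x o =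
      W * mechanism p X S := by
    intro S hS
    rw [setLIntegral_densityQ hp hx hmem hS, mechanism, jointLaw_snd_apply _ _ hS, Finset.mul_sum]
    refine Finset.sum_congr rfl fun s _ => ?_
    rw [intervalLaw_eq_intervalLawQ' hm hp hτ, ← mul_assoc, sum_weightQ'_mul_intervalLawQ' hτ]
  have hprob : IsProbabilityMeasure (mechanism p X) :=
    isProbabilityMeasure_jointLaw_snd hm hp hτ
  have hZ := key Set.univ MeasurableSet.univ
  rw [Set.inter_univ, measure_univ, mul_one] at hZ
  refine Measure.ext fun S hS => ?_
  rw [mechQ, expMechanism_apply p _ hS, hd, hZ, key S hS, ← mul_assoc,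
    ENNReal.inv_mul_cancel hW ENNReal.ofReal_ne_top, one_mul]

/-! #### Privacy -/

/-- The sum, over all the intervals `[o_{j-1}, o_j)`, of the indicator functions is at most `1`. -/
lemma sum_indicator_le_one {N : ℕ} {y : ℕ → ℝ} (hy : Monotone y) (v : ℝ) :
    ∑ j ∈ Finset.Icc 1 N, (if y (j - 1) ≤ v ∧ v < y j then (1 : ℝ) else 0) ≤ 1 := by
  rw [Finset.sum_boole]
  have : ((Finset.Icc 1 N).filter fun j => y (j - 1) ≤ v ∧ v < y j).card ≤ 1 := by
    refine Finset.card_le_one.2 ?_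
    have key : ∀ i j : ℕ, y (i - 1) ≤ v → v < y j → i ≤ j := by
      intro i j h1 h2
      by_contra hlt
      exact absurd (hy (by omega : j ≤ i - 1)) (not_le.2 (h1.trans_lt h2))
    intro i hi j hj
    rw [Finset.mem_filter] at hi hj
    exact le_antisymm (key i j hi.2.1 hj.2.2) (key j i hj.2.1 hi.2.2)
  exact_mod_cast this

/-- The utility has sensitivity `2`: moving one data point takes it out of one interval and puts it into
another. -/
lemma utilQ_le_add_two (hp : p.a < p.b) {Y Y' : Fin n → ℝ} (h : Neighbors Y Y') {o : Fin m → ℝ}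
    (ho : o ∈ outputSpace p) : utilQ p Y o ≤ utilQ p Y' o + 2 := by
  obtain ⟨i, hi⟩ := h
  set y := pad p.a (p.b + 1) o with hy
  have hmono : Monotone y :=
    pad_mono (by linarith) ho.1 fun j => ⟨(ho.2 j).1, (ho.2 j).2.trans (by linarith)⟩
  let f : ℕ → ℝ → ℝ := fun j v => if y (j - 1) ≤ v ∧ v < y j then 1 else 0
  have hf0 : ∀ j v, 0 ≤ f j v := fun j v => by simp only [f]; split_ifs <;> norm_num
  have hcount : ∀ (Y : Fin n → ℝ) (j : ℕ), (countIn Y (y (j - 1)) (y j) : ℝ) = ∑ l, f j (Y l) := by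
    intro Y j
    rw [countIn, Fintype.card_subtype, Finset.sum_boole]
  have hdiff : ∀ j, ∑ l, f j (Y l) - ∑ l, f j (Y' l) = f j (Y i) - f j (Y' i) := by
    intro j
    rw [← Finset.sum_sub_distrib]
    refine Finset.sum_eq_single i (fun l _ hl => ?_) (by simp)
    rw [hi l hl, sub_self]
  have hterm : ∀ j, |(countIn Y' (y (j - 1)) (y j) : ℝ) - gap p n j| ≤
      |(countIn Y (y (j - 1)) (y j) : ℝ) - gap p n j| + (f j (Y i) + f j (Y' i)) := by
    intro j
    have h1 := hdiff j
    rw [← hcount, ← hcount] at h1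
    have h2 := hf0 j (Y i)
    have h3 := hf0 j (Y' i)
    have h4 := le_abs_self ((countIn Y (y (j - 1)) (y j) : ℝ) - gap p n j)
    have h5 := neg_abs_le ((countIn Y (y (j - 1)) (y j) : ℝ) - gap p n j)
    rw [abs_le]
    constructor <;> linarith
  have hsum := Finset.sum_le_sum fun j (_ : j ∈ Finset.Icc 1 (m + 1)) => hterm j
  rw [Finset.sum_add_distrib, Finset.sum_add_distrib] at hsum
  have h1 := sum_indicator_le_one (N := m + 1) hmono (Y i)
  have h2 := sum_indicator_le_one (N := m + 1) hmono (Y' i)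
  simp only [utilQ, ← hy]
  simp only [f] at hsum
  linarith

lemma Neighbors.symm {Y Y' : Fin n → ℝ} (h : Neighbors Y Y') : Neighbors Y' Y :=
  h.imp fun _ hi l hl => (hi l hl).symm

lemma Neighbors.clamp {X X' : Fin n → ℝ} (h : Neighbors X X') (a b : ℝ) :
    Neighbors (clamp a b X) (JointExp.clamp a b X') :=
  h.imp fun _ hi l hl => by simp only [JointExp.clamp, hi l hl]

lemma setLIntegral_densityQ_le (hp : p.a < p.b) (hε : 0 < p.ε) {Y Y' : Fin n → ℝ}
    (h : Neighbors Y Y') {S : Set (Fin m → ℝ)} (hS : MeasurableSet S) :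
    ∫⁻ o in outputSpace p ∩ S, densityQ p Y o ≤
      ENNReal.ofReal (Real.exp (p.ε / 2)) * ∫⁻ o in outputSpace p ∩ S, densityQ p Y' o := by
  rw [← lintegral_const_mul' _ _ ENNReal.ofReal_ne_top]
  refine setLIntegral_mono' (measurableSet_outputSpace.inter hS) fun o ho => ?_
  rw [densityQ, densityQ, ← ENNReal.ofReal_mul (Real.exp_pos _).le, ← Real.exp_add]
  refine ENNReal.ofReal_le_ofReal (Real.exp_le_exp.2 ?_)
  have := utilQ_le_add_two hp h ho.1
  nlinarith

/-- The factor `exp (ε / 2)` occurs twice, in the density and in its normalization. -/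
theorem isPureDP_mechQ (hp : p.a < p.b) (hε : 0 < p.ε) :
    IsPureDP p.ε (fun X : Fin n → ℝ => mechQ p X) := by
  intro X X' h S hS
  have hN := h.clamp p.a p.b
  set c := ENNReal.ofReal (Real.exp (p.ε / 2)) with hc
  have hc0 : c ≠ 0 := by simp [hc, Real.exp_pos]
  have hct : c ≠ ⊤ := ENNReal.ofReal_ne_top
  have h1 := setLIntegral_densityQ_le hp hε hN hS
  have h2 := setLIntegral_densityQ_le hp hε hN.symm MeasurableSet.univ
  rw [Set.inter_univ] at h2
  have h3 : (∫⁻ o in outputSpace p, densityQ p (clamp p.a p.b X) o)⁻¹ ≤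
      c * (∫⁻ o in outputSpace p, densityQ p (clamp p.a p.b X') o)⁻¹ := by
    have := mul_le_mul_right (ENNReal.inv_le_inv.2 h2) c
    rwa [ENNReal.mul_inv (Or.inl hc0) (Or.inl hct), ← mul_assoc, ENNReal.mul_inv_cancel hc0 hct,
      one_mul] at this
  have hcc : ENNReal.ofReal (Real.exp p.ε) = c * c := by
    rw [hc, ← ENNReal.ofReal_mul (Real.exp_pos _).le, ← Real.exp_add, add_halves]
  simp only [mechQ]
  rw [expMechanism_apply p _ hS, expMechanism_apply p _ hS, hcc]
  refine (mul_le_mul' h3 h1).trans (le_of_eq ?_)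
  ring

end

section

/-! ### Resources of the program -/

namespace Prog

section Static

variable (β γ : ℕ → ℕ) (V : ℕ) (e f : NExp)

@[simp] lemma ub_sub : (e - f).ub β γ = e.ub β γ := rfl

@[simp] lemma fits_sub : (e - f).Fits β γ V ↔ e.Fits β γ V ∧ f.Fits β γ V := Iff.rfl

@[simp] lemma rfits_sub (e f : RExp) : (e - f).Fits β γ V ↔ e.Fits β γ V ∧ f.Fits β γ V := Iff.rfl
@[simp] lemma rfits_div (e f : RExp) : (e / f).Fits β γ V ↔ e.Fits β γ V ∧ f.Fits β γ V := Iff.rfl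

@[simp] lemma cost_sub : (e - f).cost = e.cost + f.cost + 1 := rfl

@[simp] lemma rcost_sub (e f : RExp) : (e - f).cost = e.cost + f.cost + 1 := rfl
@[simp] lemma rcost_div (e f : RExp) : (e / f).cost = e.cost + f.cost + 1 := rfl

end Static

/-- Bounds for the natural-number registers, in the order `rn`, `rm`, `rj`, `ri`, `rk`, `rl`, `found`,
`newI`, `newK`, `round`, and `rsize`, `rlog`, `rhalf`, `rcell`, `rstage`. The bound `k` for the register `newK` is `0` during the
forward pass, and `n + m + 3` afterwards. -/
def regBound (n m k : ℕ) : ℕ → ℕ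
  | 0 => n
  | 1 => m
  | 2 => m + 2
  | 3 => n + m
  | 4 => n + m + 2
  | 5 => n + m + k
  | 6 => 1
  | 7 => n + m
  | 8 => k
  | 9 => m
  | 16 => 4 * n + 4
  | 17 => Nat.clog 2 (2 * n + 2)
  | 18 => 4 * n + 4
  | 19 => 4 * n + 4
  | 20 => Nat.clog 2 (2 * n + 2)
  | _ => 0

/-- A bound for the entries of the natural-number arrays. -/
def arrBound (n m : ℕ) : ℕ → ℕ := fun _ => n + m

/-- A bound for all natural numbers in the run of the program. -/
def peakBound (n m : ℕ) : ℕ := ((m + 2) * (n + 1) + (n + m)) * m + 20 * (n + m) + 20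

lemma regBound_mono {n m k k' : ℕ} (h : k ≤ k') (r : ℕ) : regBound n m k r ≤ regBound n m k' r := by
  unfold regBound
  split <;> omega

section Bounds

variable {n m k : ℕ}

@[simp] lemma regBound_rn : regBound n m k rn = n := rfl
@[simp] lemma regBound_rm : regBound n m k rm = m := rfl
@[simp] lemma regBound_rj : regBound n m k rj = m + 2 := rfl
@[simp] lemma regBound_ri : regBound n m k ri = n + m := rfl
@[simp] lemma regBound_rk : regBound n m k rk = n + m + 2 := rfl
@[simp] lemma regBound_rl : regBound n m k rl = n + m + k := rfl
@[simp] lemma regBound_found : regBound n m k found = 1 := rfl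
@[simp] lemma regBound_newI : regBound n m k newI = n + m := rfl
@[simp] lemma regBound_newK : regBound n m k newK = k := rfl
@[simp] lemma regBound_round : regBound n m k round = m := rfl
@[simp] lemma regBound_rsize : regBound n m k rsize = 4 * n + 4 := rfl
@[simp] lemma regBound_rlog : regBound n m k rlog = Nat.clog 2 (2 * n + 2) := rfl
@[simp] lemma regBound_rhalf : regBound n m k rhalf = 4 * n + 4 := rfl
@[simp] lemma regBound_rcell : regBound n m k rcell = 4 * n + 4 := rfl
@[simp] lemma regBound_rstage : regBound n m k rstage = Nat.clog 2 (2 * n + 2) := rfl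

lemma clog_le (n : ℕ) : Nat.clog 2 (2 * n + 2) ≤ 2 * n + 2 :=
  Nat.clog_le_of_le_pow Nat.lt_two_pow_self.le

/-- The doubling stops in time: it happens only below `2 * n + 2`, and the current power and its
exponent stay related. -/
lemma fftSize_bounded : fftSize.Bounded (regBound n m k) (arrBound n m) (peakBound n m)
    (fftSize.time (regBound n m k) (arrBound n m)) := by
  have hV : 20 * n + 20 ≤ peakBound n m := by unfold peakBound; omega
  have hlog := clog_le n
  intro ω σ hσ hp
  set β := regBound n m k with hβ
  set γ := arrBound n m
  let c : Cmd := .ifN (.var rsize) (2 * N + 2)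
    (.seq (.setN rsize (2 * .var rsize)) (.setN rlog (.var rlog + 1))) .skip
  let σ0 := (Cmd.setN rlog 0).exec ω ((Cmd.setN rsize 1).exec ω σ)
  have hσ0 : σ0.Within β γ :=
    State.Within.writeNReg (σ := ((Cmd.setN rsize 1).exec ω σ).charge _ _ _)
      (State.Within.writeNReg (σ := σ.charge _ _ _) hσ (by rw [hβ, regBound_rsize]; simp))
      (by simp)
  have hrn0 : σ0.nreg rn ≤ n := hσ0.1 rn
  have hpeak0 : σ0.peak ≤ peakBound n m := by
    change max (max σ.peak 1) 0 ≤ _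
    omega
  have hloop := exec_loop_induction (ω := ω) (r := rcell) (e := 2 * N + 2) (c := c) (σ := σ0)
    (k := 2 * σ0.nreg rn + 2) rfl
    (fun v τ => τ.Within β γ ∧ τ.nreg rsize = 2 ^ τ.nreg rlog ∧
      τ.steps ≤ σ.steps + (10 + v * (c.time β γ + 1)) ∧ τ.peak ≤ peakBound n m)
    ⟨hσ0, rfl, ?_, ?_⟩ ?_
  · refine ⟨hloop.1, hloop.2.2.1.trans ?_, hloop.2.2.2⟩
    have e1 : fftSize.time β γ = 2 + (2 + (6 + (2 * n + 2) * (c.time β γ + 1) + 0)) := rfl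
    have e2 : (2 * σ0.nreg rn + 2) * (c.time β γ + 1) ≤ (2 * n + 2) * (c.time β γ + 1) := by gcongr
    omega
  · change σ.steps + 2 + 2 + 6 ≤ _
    omega
  · change max σ0.peak (max (2 * σ0.nreg rn + 2) (max (max (2 * σ0.nreg rn)
      (max 2 (σ0.nreg rn))) 2)) ≤ _
    omega
  · rintro v hv τ ⟨h1, h2, h3, h4⟩
    have hc : c.time β γ = 15 := rfl
    have w1 : (τ.enter rcell v).Within β γ := h1.enter (by rw [hβ, regBound_rcell]; omega)
    have hrn : (τ.enter rcell v).nreg rn ≤ n := w1.1 rn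
    have e1 : (τ.enter rcell v).nreg rsize = τ.nreg rsize := by simp [rcell, rsize]
    have e2 : (τ.enter rcell v).nreg rlog = τ.nreg rlog := by simp [rcell, rlog]
    have hs := h1.1 rsize
    rw [hβ, regBound_rsize] at hs
    have hp1 : (τ.enter rcell v).peak ≤ peakBound n m := max_le h4 (by omega)
    have hst : (τ.enter rcell v).steps = τ.steps + 1 := by simp
    set τ1 := (τ.enter rcell v).charge 7
      ((NExp.var rsize).cells (τ.enter rcell v) ∪ (2 * N + 2 : NExp).cells (τ.enter rcell v)) (max (τ.nreg rsize) (max (2 * (τ.enter rcell v).nreg rn + 2)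
      (max (max (2 * (τ.enter rcell v).nreg rn) (max 2 ((τ.enter rcell v).nreg rn))) 2))) with hτ1
    have hp2 : τ1.peak ≤ peakBound n m := max_le hp1 (by omega)
    have hstep : c.exec ω (τ.enter rcell v) =
        if τ.nreg rsize < 2 * (τ.enter rcell v).nreg rn + 2 then
          (Cmd.setN rlog (.var rlog + 1)).exec ω ((Cmd.setN rsize (2 * .var rsize)).exec ω τ1)
        else τ1 := by
      simp only [c, Cmd.exec]
      rfl
    rw [hstep]
    split_ifs with hlt
    · have hpow : τ.nreg rlog < Nat.clog 2 (2 * n + 2) := by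
        rw [Nat.lt_clog_iff_pow_lt (by omega), ← h2]
        omega
      refine ⟨?_, ?_, ?_, ?_⟩
      · refine State.Within.writeNReg (σ := ((Cmd.setN rsize (2 * .var rsize)).exec ω τ1).charge _ _ _)
          (State.Within.writeNReg (σ := τ1.charge _ _ _) w1 ?_) ?_
        · rw [hβ, regBound_rsize]
          change 2 * (τ.enter rcell v).nreg rsize ≤ _
          omega
        · rw [hβ, regBound_rlog]
          change (τ.enter rcell v).nreg rlog + 1 ≤ _
          omega
      · change 2 * (τ.enter rcell v).nreg rsize = 2 ^ ((τ.enter rcell v).nreg rlog + 1)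
        rw [e1, e2, h2, pow_succ, mul_comm]
      · change (τ.enter rcell v).steps + 7 + 4 + 4 ≤ _
        rw [add_mul]
        omega
      · change max (max τ1.peak (max (2 * (τ.enter rcell v).nreg rsize) (max 2 _)))
          (max ((τ.enter rcell v).nreg rlog + 1) (max ((τ.enter rcell v).nreg rlog) 1)) ≤ _
        have : (τ1.nreg rsize) = τ.nreg rsize := e1
        change max (max τ1.peak (max (2 * (τ.enter rcell v).nreg rsize) (max 2 (τ1.nreg rsize))))
          (max ((τ.enter rcell v).nreg rlog + 1) (max ((τ.enter rcell v).nreg rlog) 1)) ≤ _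
        omega
    · refine ⟨w1, e1.trans (h2.trans (by rw [← e2]; rfl)), ?_, hp2⟩
      change (τ.enter rcell v).steps + 7 ≤ _
      rw [add_mul]
      omega

end Bounds

end Prog

end

section

namespace Prog

section Phases

variable {n m k : ℕ}

lemma peakBound_ge (n m : ℕ) : 20 * (n + m) + 20 ≤ peakBound n m := by unfold peakBound; omega

/-- Bounds for the intermediate results in the computation of an address in the table of `α`. -/
lemma cell_le {n m : ℕ} (hm : 1 ≤ m) :
    (m + 2) * (n + 1) ≤ peakBound n m ∧
    (m + 2) * (n + 1) + (n + m) ≤ peakBound n m ∧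
    ((m + 2) * (n + 1) + (n + m)) * m ≤ peakBound n m ∧
    ((m + 2) * (n + 1) + (n + m)) * m + (n + m + 4) ≤ peakBound n m := by
  have h : ((m + 2) * (n + 1) + (n + m)) * 1 ≤ ((m + 2) * (n + 1) + (n + m)) * m :=
    Nat.mul_le_mul_left _ hm
  unfold peakBound
  omega

lemma setup_fits :
    setup.Fits (regBound n m 0) (arrBound n m) (peakBound n m) := by
  have h1 := peakBound_ge n m
  simp [setup, block, Cmd.Fits, NExp.Fits, RExp.Fits, NExp.ub, N, M, L]
  omega

lemma base_fits (hn : 1 ≤ n) (hm : 1 ≤ m)  :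
    base.Fits (regBound n m 0) (arrBound n m) (peakBound n m) := by
  have h1 := peakBound_ge n m
  have h2 := cell_le (n := n) hm
  simp [base, cell, phiE, tauE, Cmd.Fits, NExp.Fits, RExp.Fits, NExp.ub, N, M, I]
  have : (n + 1 + (n + m)) * m ≤ ((m + 2) * (n + 1) + (n + m)) * m := by
    gcongr
    nlinarith
  omega

lemma toeplitz_bounded : toeplitz.Bounded (regBound n m k) (arrBound n m) (peakBound n m)
    (toeplitz.time (regBound n m k) (arrBound n m)) := by
  have h1 := peakBound_ge n m
  have hlog := clog_le n
  refine fftSize_bounded.seq (Cmd.Fits.bounded ?_)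
  simp [fft, assign, stageRe, stageIm, src, high, low, angle, block, Cmd.Fits, NExp.Fits,
    RExp.Fits, NExp.ub, N]
  omega

lemma forwardRound_bounded (hn : 1 ≤ n) (hm : 1 ≤ m) :
    (forwardRound toeplitz).Bounded (regBound n m 0) (arrBound n m) (peakBound n m)
      ((forwardRound toeplitz).time (regBound n m 0) (arrBound n m)) := by
  have h1 := peakBound_ge n m
  have h2 := cell_le (n := n) hm
  refine Cmd.Bounded.seq (Cmd.Fits.bounded ?_) (Cmd.Bounded.seq (Cmd.Fits.bounded ?_)
    (Cmd.Bounded.seq (Cmd.Fits.bounded ?_) (toeplitz_bounded.seq (Cmd.Fits.bounded ?_))))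
  all_goals
    simp [cell, phiE, tauE, alphaE, block, Cmd.Fits, NExp.Fits, RExp.Fits, NExp.ub, N, M, I, J, K,
      L]
    try omega

lemma forward_bounded (hn : 1 ≤ n) (hm : 1 ≤ m) :
    (forward toeplitz).Bounded (regBound n m 0) (arrBound n m) (peakBound n m)
      ((forward toeplitz).time (regBound n m 0) (arrBound n m)) := by
  have h1 := peakBound_ge n m
  refine (base_fits hn hm).bounded.seq (Cmd.Bounded.seq (Cmd.Bounded.loop ?_ ?_
    (Cmd.Bounded.seq (Cmd.Fits.bounded ?_) (forwardRound_bounded hn hm))) (Cmd.Fits.bounded trivial))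
  all_goals
    simp [Cmd.Fits, NExp.Fits, NExp.ub, M]
    try omega

lemma backwardPass_fits (hn : 1 ≤ n) (hm : 1 ≤ m) :
    backwardPass.Fits (regBound n m (n + m + 3)) (arrBound n m) (peakBound n m) := by
  have h1 := peakBound_ge n m
  have h2 := cell_le (n := n) hm
  simp [backwardPass, draw, links, cell, phiE, alphaE, block, Cmd.Fits, NExp.Fits, RExp.Fits,
    NExp.ub, N, M, I, J, K, L, arrBound]
  omega

lemma output_fits  :
    output.Fits (regBound n m (n + m + 3)) (arrBound n m) (peakBound n m) := by
  have h1 := peakBound_ge n m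
  simp [output, tauE, block, Cmd.Fits, NExp.Fits, RExp.Fits, NExp.ub, M, L, arrBound]
  omega

lemma time_le (hn : 1 ≤ n) (hm : 1 ≤ m) :
    setup.time (regBound n m 0) (arrBound n m) +
      (forward toeplitz).time (regBound n m 0) (arrBound n m) +
      backwardPass.time (regBound n m (n + m + 3)) (arrBound n m) +
      output.time (regBound n m (n + m + 3)) (arrBound n m) ≤
    10000 * (m * n * Nat.clog 2 (2 * n + 2) + m ^ 2 * n) := by
  simp [setup, forward, base, forwardRound, toeplitz, fftSize, fft, assign, stageRe, stageIm, src,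
    high, low, angle, backwardPass, output, draw, links, cell, phiE, alphaE, tauE, block,
    Cmd.time, NExp.cost, RExp.cost, NExp.ub, N, M, I, J, K, L]
  set c := Nat.clog 2 (2 * n + 2)
  have hc : 1 ≤ c := Nat.clog_pos (by omega) (by omega)
  have h1 : m * n ≤ m ^ 2 * n := Nat.mul_le_mul_right n (Nat.le_self_pow (by omega) m)
  have h2 : m ≤ m * n := by nlinarith
  have h3 : n ≤ m * n := by nlinarith
  have h4 : m ^ 2 ≤ m ^ 2 * n := by nlinarith
  have h5 : m * c ≤ m * n * c := Nat.mul_le_mul_right c (Nat.le_mul_of_pos_right m hn)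
  have h6 : m ≤ m * c := Nat.le_mul_of_pos_right m hc
  ring_nf at h1 h2 h3 h4 h5 h6 ⊢
  omega

lemma arrays_lt : ∀ A ∈ (jointExp toeplitz).arrays, A < 32 := by
  decide

lemma init_within (p : Params m) (x : Fin n → ℝ) :
    (init p x).Within (regBound n m 0) (arrBound n m) := by
  refine ⟨fun r => ?_, fun A l => Nat.zero_le _⟩
  simp only [init]
  split_ifs with h1 h2
  · rw [h1, regBound_rn]
  · rw [h2, regBound_rm]
  · exact Nat.zero_le _

/-- Time and largest number, in terms of natural numbers. -/
theorem final_resources (hn : 1 ≤ n) (hm : 1 ≤ m) (p : Params m) (x : Fin n → ℝ)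
    (ω : ℕ → unitInterval) :
    (final toeplitz p x ω).steps ≤ 10000 * (m * n * Nat.clog 2 (2 * n + 2) + m ^ 2 * n) ∧
      (final toeplitz p x ω).peak ≤ peakBound n m := by
  obtain ⟨w1, s1, p1⟩ := setup_fits.bounded ω _ (init_within p x) (Nat.zero_le _)
  obtain ⟨w2, s2, p2⟩ := forward_bounded hn hm ω _ w1 p1
  have hk : ∀ r, regBound n m 0 r ≤ regBound n m (n + m + 3) r := regBound_mono (Nat.zero_le _)
  obtain ⟨w3, s3, p3⟩ := (backwardPass_fits hn hm).bounded ω _ (State.Within.mono w2 hk) p2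
  obtain ⟨w4, s4, p4⟩ := output_fits.bounded ω _ w3 p3
  have ht := time_le hn hm
  have h0 : (init p x).steps = 0 := rfl
  refine ⟨?_, p4⟩
  change (Cmd.exec ω output (Cmd.exec ω backwardPass (Cmd.exec ω (forward toeplitz)
    (Cmd.exec ω setup (init p x))))).steps ≤ _
  omega

lemma peakBound_le (hn : 1 ≤ n) (hm : 1 ≤ m) : peakBound n m ≤ 100 * (m ^ 2 * n) := by
  have h1 : m * n ≤ m ^ 2 * n := Nat.mul_le_mul_right n (Nat.le_self_pow (by omega) m)
  have h2 : m ≤ m * n := by nlinarith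
  have h3 : n ≤ m * n := by nlinarith
  have h4 : m ^ 2 ≤ m ^ 2 * n := by nlinarith
  unfold peakBound
  linarith

lemma card_cells_le (hn : 1 ≤ n) (hm : 1 ≤ m) (p : Params m) (x : Fin n → ℝ)
    (ω : ℕ → unitInterval) : (final toeplitz p x ω).cells.card ≤ 10000 * (m ^ 2 * n) := by
  have h1 := Finset.card_le_card (Cmd.cells_subset (ω := ω) arrays_lt
    (σ := init p x) (Finset.empty_subset _))
  rw [card_cellBox] at h1
  have h2 := (final_resources hn hm p x ω).2
  have h3 := peakBound_le hn hm
  have h4 : 1 ≤ m ^ 2 * n := Nat.mul_pos (by positivity) hn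
  change (final toeplitz p x ω).cells.card ≤ 2 * (32 * ((final toeplitz p x ω).peak + 1)) at h1
  omega

/-- The size of the Fourier transform is a power of two of order `n`. -/
lemma clog_le_log (hn : 1 ≤ n) : (Nat.clog 2 (2 * n + 2) : ℝ) ≤ 3 + 2 * Real.log n := by
  have hpow := Nat.pow_pred_clog_lt_self (b := 2) (by omega) (x := 2 * n + 2) (by omega)
  have hc : 1 ≤ Nat.clog 2 (2 * n + 2) := Nat.clog_pos (by omega) (by omega)
  obtain ⟨c, hc'⟩ := Nat.exists_eq_add_of_le' hc
  rw [hc'] at hpow ⊢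
  simp only [Nat.pred_eq_sub_one, Nat.add_sub_cancel] at hpow
  have h4 : (2 : ℝ) ^ c ≤ 2 ^ 2 * n := by
    have : 2 ^ c ≤ 2 ^ 2 * n := by omega
    exact_mod_cast this
  have hn' : (0 : ℝ) < n := by exact_mod_cast hn
  have h5 := Real.log_le_log (by positivity) h4
  rw [Real.log_mul (by positivity) hn'.ne', Real.log_pow, Real.log_pow] at h5
  have h6 := Real.log_two_gt_d9
  have h7 : 0 ≤ Real.log n := Real.log_natCast_nonneg n
  have h8 : ((c : ℝ) - 2) * Real.log 2 ≤ Real.log n := by push_cast at h5; linarith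
  push_cast
  by_contra hlt
  have : 2 * Real.log n < (c : ℝ) - 2 := by linarith
  nlinarith

end Phases

end Prog

end

end

end JointExp

theorem theorem1 :
    -- privacy, and correctness of the law of the interval sequence and of the output
    (∀ (n m : ℕ), 1 ≤ m → ∀ p : JointExp.Params m, p.Admissible →
      JointExp.IsPureDP p.ε (fun X : Fin n → ℝ => JointExp.mechanism p X) ∧
      ∀ X : Fin n → ℝ,
        MeasureTheory.IsProbabilityMeasure (JointExp.mechanism p X) ∧
        JointExp.intervalLaw p (JointExp.sorted (JointExp.clamp p.a p.b X)) =
          JointExp.intervalLawQ' p (JointExp.sorted (JointExp.clamp p.a p.b X)) ∧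
        JointExp.mechanism p X = JointExp.mechQ p X) ∧
    -- time and space of the program
    (∃ (toeplitz : JointExp.Cmd) (C : ℝ), JointExp.Prog.IsSubroutine toeplitz ∧
      ∀ (n m : ℕ), 1 ≤ n → 1 ≤ m → ∀ p : JointExp.Params m, p.Admissible →
      ∀ x : Fin n → ℝ, Monotone x → (∀ i, x i ∈ Set.Icc p.a p.b) →
        -- resources, in the worst case over the random numbers
        (∀ ω : ℕ → unitInterval,
          ((JointExp.Prog.final toeplitz p x ω).steps : ℝ) ≤
            C * ((m : ℝ) * n * Real.log n + (m : ℝ) ^ 2 * n) ∧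
          ((JointExp.Prog.final toeplitz p x ω).cells.card : ℝ) ≤ C * ((m : ℝ) ^ 2 * n) ∧
          ((JointExp.Prog.final toeplitz p x ω).peak : ℝ) ≤ C * ((m : ℝ) ^ 2 * n) ∧
          -- the table of the dynamic program is computed correctly
          ∀ j ∈ Finset.Icc 1 m, ∀ i ∈ Finset.range (n + 1), ∀ k ∈ Finset.Icc 1 m,
            (JointExp.Prog.final toeplitz p x ω).rarr JointExp.Prog.tab
              (JointExp.Prog.tabIndex n m j i k) = JointExp.alpha p x j i k) ∧
        -- the program samples from the laws of JointExp
        ProbabilityTheory.HasLaw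
          (fun ω => JointExp.Prog.result m (JointExp.Prog.final toeplitz p x ω))
          ((JointExp.jointLaw p x).map (Prod.map (fun s j => (s j : ℕ)) id))
          JointExp.Prog.source) := by
  refine ⟨fun n m hm p hp => ⟨?_, fun X => ?_⟩, JointExp.Prog.toeplitz, 100000,
    JointExp.Prog.isSubroutine_toeplitz, fun n m hn hm p hp x hx hmem => ⟨fun ω => ?_, ?_⟩⟩
  · have h : (fun X : Fin n → ℝ => JointExp.mechanism p X) = fun X => JointExp.mechQ p X :=
      funext fun X => JointExp.mechanism_eq_mechQ hm hp.range X
    rw [h]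
    exact JointExp.isPureDP_mechQ hp.range hp.eps
  · have hτ := JointExp.tau_nonneg hp.range (Tuple.monotone_sort (JointExp.clamp p.a p.b X))
      fun i => JointExp.clamp_mem hp.range.le X _
    exact ⟨JointExp.isProbabilityMeasure_jointLaw_snd hm hp.range hτ,
      JointExp.intervalLaw_eq_intervalLawQ' hm hp.range hτ,
      JointExp.mechanism_eq_mechQ hm hp.range X⟩
  · obtain ⟨hsteps, hpeak⟩ := JointExp.Prog.final_resources hn hm p x ω
    have hcells := JointExp.Prog.card_cells_le hn hm p x ω
    have htable := (JointExp.Prog.exec_jointExp hm p x ω).1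
    generalize JointExp.Prog.final JointExp.Prog.toeplitz p x ω = σ at hsteps hpeak hcells htable ⊢
    have hpeak' := hpeak.trans (JointExp.Prog.peakBound_le hn hm)
    have hm1 : (1 : ℝ) ≤ m := by exact_mod_cast hm
    have hn1 : (1 : ℝ) ≤ n := by exact_mod_cast hn
    have hmn : (0 : ℝ) ≤ (m : ℝ) * n := by positivity
    have hlog : 0 ≤ Real.log n := Real.log_natCast_nonneg n
    have hmmn : (m : ℝ) * n ≤ (m : ℝ) ^ 2 * n := by nlinarith
    refine ⟨?_, ?_, ?_, fun j hj i hi k hk => ?_⟩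
    · have h1 : (σ.steps : ℝ) ≤
          10000 * ((m : ℝ) * n * Nat.clog 2 (2 * n + 2) + (m : ℝ) ^ 2 * n) := by
        exact_mod_cast hsteps
      have h2 := mul_le_mul_of_nonneg_left (JointExp.Prog.clog_le_log hn) hmn
      have h3 : 0 ≤ (m : ℝ) * n * Real.log n := mul_nonneg hmn hlog
      linarith
    · have h1 : (σ.cells.card : ℝ) ≤ 10000 * ((m : ℝ) ^ 2 * n) := by
        exact_mod_cast hcells
      linarith
    · have h1 : (σ.peak : ℝ) ≤ 100 * ((m : ℝ) ^ 2 * n) := by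
        exact_mod_cast hpeak'
      linarith
    · rw [Finset.mem_Icc] at hj hk
      rw [Finset.mem_range] at hi
      have h := htable j i k hj.1 (by omega) hk.1 hk.2
      rwa [if_pos hj.2] at h
  · exact JointExp.Prog.hasLaw_result hm hp.range (JointExp.tau_nonneg hp.range hx hmem)
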